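/- All digraphs are finite. A knot of a digraph $D$ is a strongly connected component $K$ of $D$ with at least two vertices such that no arc of $D$ leads from a vertex of $K$ to a vertex outside $K$; $D$ is knot-free if it has no knot. (Loops play no role for knots and are ignored below.) Algorithm $\mathrm{KFVD}(D,\varphi)$. The input is a digraph $D$ with potentials $\varphi:V(D)\to\{1,\tfrac14\}$; let $U=\{v:\varphi(v)=1\}$ be the set of undecided vertices. Write $N^+(v)$, $N^-(v)$ for the sets of out- and in-neighbours of $v$ in $D$ and $N(v)$ for their union; $R^-(v)$ for the set of vertices with a directed path to $v$ in $D-N^+(v)$; $R(v)=N^+(v)\cup R^-(v)$; $R^+(v)=\{u\in U: v\in R^-(u)\}$; $\psi(v)=\sum_{u\in R(v)}\varphi(u)+\tfrac34|R^+(v)\setminus R(v)|$; $\mathcal S_v=\{u\in N^+(v):N^-(u)\cap U=\{v\}\}$; $\mathcal C_v=\bigcup_{y\in N^+(v)}R^+(y)$. For a vertex $s$ and a set $T$, let $\mathrm{KFVD}(s,T)$ be the value returned by the recursive call on $D-R(s)$ with the potentials of the vertices in $R^+(s)\cup T$ lowered to $\tfrac14$, plus $|N^+(s)|$. The algorithm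 executes the first step that applies: 1. If some $x$ has $N^-(x)=\emptyset$, return $\mathrm{KFVD}(D-x,\varphi)$. 2. If some $x$ has $N^+(x)=\emptyset$, return $\mathrm{KFVD}(D-R(x),\varphi)$. 3. If $U=\emptyset$, return $|V(D)|$. 4. If some $x\in U$ has $\psi(x)\ge 3.75$, return the minimum of $\mathrm{KFVD}(x,\emptyset)$ and $\mathrm{KFVD}(D,\varphi')$, where $\varphi'$ is $\varphi$ with the potential of $x$ lowered to $\tfrac14$. 5. Otherwise pick $x\in U$ maximizing $|N(x)\cap U|$. - If $\mathcal S_x=\emptyset$, return the minimum of $\mathrm{KFVD}(x,\emptyset)$ and of $\mathrm{KFVD}(s,\emptyset)$ over all $s\in\mathcal C_x$. - If $\mathcal S_x\ne\emptyset$ and $N(x)\cap U\neq\emptyset$, pick $y\in\mathcal S_x$ and let $B=R^+(y)$; run through the elements $s$ of $R^+(y)$, and whenever $s$ is still in $B$ and $N^+(s)\subseteq N^+(t)$ for some $t\in B$, $t\ne s$, remove one such $t$ from $B$. With $B=\{s_1,\dots,s_r\}$, return the minimum of $\mathrm{KFVD}(x,\emptyset)$ and of $\mathrm{KFVD}(s_i,\{s_j:j<i\})$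 over $1\le i\le r$. - If $\mathcal S_x\ne\emptyset$ and $N(x)\cap U=\emptyset$, pick $y\in\mathcal S_x$ and, if $R^+(y)\neq\emptyset$, some $s\in R^+(y)$; return the minimum of $\mathrm{KFVD}(x,\emptyset)$ and (if $s$ exists) $\mathrm{KFVD}(s,\emptyset)$. All choices are resolved by taking the first suitable vertex in the order in which the vertices are stored. Theorem. There are constants $C$ and $k$ such that for every $n\ge 0$ and every digraph $D$ on $n$ vertices, Algorithm KFVD, started on $D$ with all potentials equal to $1$, terminates after at most $C(n+1)^k\cdot 1.4549^n$ elementary steps (adjacency queries, comparisons of vertices, list-cell visits, loop iterations, procedure calls, arithmetic on counters), that is, in time $\mathcal O^*(1.4549^n)$, and returns the minimum size of a set $S\subseteq V(D)$ such that $D-S$ is knot-free. -/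

import Mathlib

/-! ## Knots and knot-free vertex deletion -/

namespace Digraph

variable {V : Type}

/-- `G.Reach u v`: there is a directed path (possibly of length zero) from `u` to `v`. -/
def Reach (G : Digraph V) (u v : V) : Prop :=
  Relation.ReflTransGen G.Adj u v

/-- `K` is a strongly connected component: the class of some vertex under mutual reachability. -/
def IsStrongComponent (G : Digraph V) (K : Set V) : Prop :=
  ∃ v, K = {w | G.Reach v w ∧ G.Reach w v}

/-- A knot: a strongly connected component with at least two vertices and no arc leaving it. -/
def IsKnot (G : Digraph V) (K : Set V) : Prop :=
  G.IsStrongComponent K ∧ K.Nontrivial ∧ ∀ u ∈ K, ∀ v, G.Adj u v → v ∈ K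

def KnotFree (G : Digraph V) : Prop :=
  ∀ K : Set V, ¬ G.IsKnot K

/-- The digraph `G - S`, i.e. the subgraph induced on the complement of `S`. -/
def deleteVertices (G : Digraph V) (S : Finset V) : Digraph {v : V // v ∉ S} where
  Adj u v := G.Adj u v

/-- `S` is a knot-free vertex deletion set of `G`. -/
def IsKnotFreeDeletionSet (G : Digraph V) (S : Finset V) : Prop :=
  (G.deleteVertices S).KnotFree

end Digraph

namespace KFVD

/-! ## Programs with a step counter

A program is a state transformer on the number of elementary steps executed so far; the value
`none` stands for a computation that does not terminate.  One `tick` is charged for every adjacency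
query, every comparison of two vertices, every list cell that is visited, every iteration of a loop
and every recursive call, and it also pays for the bounded number of additions and comparisons of
counters and of list-cell constructions that go with it. -/

abbrev Prog (α : Type) : Type := StateT ℕ Option α

def tick : Prog Unit := modify (· + 1)

variable {V : Type}

/-! ### List procedures -/

def filterP (p : V → Prog Bool) : List V → Prog (List V)
  | [] => do
    tick
    return []
  | a :: l => do
    tick
    let b ← p a
    let r ← filterP p l
    return if b then a :: r else r

def findP (p : V → Prog Bool) : List V → Prog (Option V)
  | [] => do
    tick
    return none
  | a :: l => do
    tick
    let b ← p a
    if b then return some a else findP p l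

def anyP (p : V → Prog Bool) (l : List V) : Prog Bool := do
  let r ← findP p l
  return r.isSome

def allP (p : V → Prog Bool) (l : List V) : Prog Bool := do
  let r ← findP (fun a => do let b ← p a; return !b) l
  return r.isNone

def lengthP : List V → Prog ℕ
  | [] => do
    tick
    return 0
  | _ :: l => do
    tick
    let k ← lengthP l
    return k + 1

def appendP : List V → List V → Prog (List V)
  | [], l' => do
    tick
    return l'
  | a :: l, l' => do
    tick
    let r ← appendP l l'
    return a :: r

/-- The first element of `a :: l` at which `f` is maximal (`fa` is the value of `f` at `a`),
the earlier elements having been discarded. -/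
def argmaxFrom (f : V → Prog ℕ) (a : V) (fa : ℕ) : List V → Prog V
  | [] => do
    tick
    return a
  | b :: l => do
    tick
    let fb ← f b
    if fa < fb then argmaxFrom f b fb l else argmaxFrom f a fa l

section Vertices

variable [DecidableEq V]

def sameP (u v : V) : Prog Bool := do
  tick
  return decide (u = v)

def memP (v : V) (l : List V) : Prog Bool :=
  anyP (fun a => sameP v a) l

/-- The elements of `l` that are not in `l'`. -/
def diffP (l l' : List V) : Prog (List V) :=
  filterP (fun a => do let b ← memP a l'; return !b) l

/-- The elements of `l` that are in `l'`. -/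
def interP (l l' : List V) : Prog (List V) :=
  filterP (fun a => memP a l') l

end Vertices

/-! ### Instances

An instance `(D, φ)`: `D` is the subgraph of the input digraph induced on the listed vertices,
`und` lists the undecided vertices (`φ = 1`) and `semi` the semi-decided ones (`φ = 1/4`). -/

structure Inst (V : Type) where
  und : List V
  semi : List V

variable [DecidableEq V] (G : Digraph V) [DecidableRel G.Adj]

/-- Adjacency query.  Loops are ignored: they play no role for knots. -/
def arcP (u v : V) : Prog Bool := do
  tick
  return decide (u ≠ v ∧ G.Adj u v)

/-- `V(D)`. -/
def vertsP (I : Inst V) : Prog (List V) :=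
  appendP I.und I.semi

/-- `N⁺(v)`. -/
def outP (I : Inst V) (v : V) : Prog (List V) := do
  let vs ← vertsP I
  filterP (fun w => arcP G v w) vs

/-- `N⁻(v)`. -/
def inP (I : Inst V) (v : V) : Prog (List V) := do
  let vs ← vertsP I
  filterP (fun w => arcP G w v) vs

/-- `N(v) ∩ U`: the undecided in- and out-neighbours of `v`. -/
def undNbrsP (I : Inst V) (v : V) : Prog (List V) :=
  filterP (fun w => do
    let a ← arcP G v w
    if a then return true else arcP G w v) I.und

/-- `k` rounds of backward search inside `avail`, starting from the set `R`: in each round, keep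
the vertices of `avail` that are in the current set or have an arc into it. -/
def growP (avail : List V) : ℕ → List V → Prog (List V)
  | 0, R => do
    tick
    return R
  | k + 1, R => do
    tick
    let R' ← filterP (fun u => anyP (fun w => do
      let e ← sameP u w
      if e then return true else arcP G u w) R) avail
    growP avail k R'

/-- `R⁻(v)`: the vertices that reach `v` in `D - N⁺(v)`. -/
def inReachP (I : Inst V) (v : V) : Prog (List V) := do
  let vs ← vertsP I
  let out ← outP G I v
  let avail ← diffP vs out
  let k ← lengthP vs
  growP G avail k [v]

/-- `R(v) = N⁺(v) ∪ R⁻(v)`. -/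
def bigRP (I : Inst V) (v : V) : Prog (List V) := do
  let out ← outP G I v
  let rm ← inReachP G I v
  appendP out rm

/-- `R⁺(v)`: the undecided vertices `u` with `v ∈ R⁻(u)`. -/
def outReachP (I : Inst V) (v : V) : Prog (List V) :=
  filterP (fun u => do
    let rm ← inReachP G I u
    memP v rm) I.und

/-- Four times the drop function, `4 ψ(x) = 4 φ(R(x)) + 3 |R⁺(x) \ R(x)|`, where
`4 φ(R(x)) = 4 |R(x) ∩ U| + |R(x) \ U|`. -/
def dropP (I : Inst V) (x : V) : Prog ℕ := do
  let r ← bigRP G I x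
  let ru ← interP I.und r
  let rs ← interP I.semi r
  let rp ← outReachP G I x
  let rp' ← diffP rp r
  let a ← lengthP ru
  let b ← lengthP rs
  let c ← lengthP rp'
  tick
  return 4 * a + b + 3 * c

/-- The surviving set `S_x`: the `u ∈ N⁺(x)` whose only undecided in-neighbour is `x`. -/
def survivingP (I : Inst V) (x : V) : Prog (List V) := do
  let out ← outP G I x
  filterP (fun u => allP (fun w => do
    let e ← sameP w x
    if e then return true else
      let a ← arcP G w u
      return !a) I.und) out

/-- The candidate sink set `C_x`: the union of the sets `R⁺(y)`, `y ∈ N⁺(x)`. -/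
def candidatesP (I : Inst V) (x : V) : Prog (List V) := do
  let out ← outP G I x
  filterP (fun u => do
    let rm ← inReachP G I u
    anyP (fun y => memP y rm) out) I.und

/-- `D - X`, with the same potentials. -/
def deleteP (I : Inst V) (X : List V) : Prog (Inst V) := do
  let u ← diffP I.und X
  let s ← diffP I.semi X
  return ⟨u, s⟩

/-- Lower the potential of the vertices of `X` to `1/4`. -/
def lowerP (I : Inst V) (X : List V) : Prog (Inst V) := do
  let u ← diffP I.und X
  let m ← interP I.und X
  let s ← appendP m I.semi
  return ⟨u, s⟩

/-- `update(D, φ, s, NS)`, with the sink `s` provided: delete `R(s)`, and lower the potential of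
the vertices of `R⁺(s)` (taken in `D`) and of `NS`. -/
def updateSinkP (I : Inst V) (s : V) (NS : List V) : Prog (Inst V) := do
  let r ← bigRP G I s
  let rp ← outReachP G I s
  let I₁ ← deleteP I r
  let I₂ ← lowerP I₁ rp
  lowerP I₂ NS

/-- `update(D, φ, -, NS)`, with no sink provided. -/
def updateNonsinkP (I : Inst V) (NS : List V) : Prog (Inst V) :=
  lowerP I NS

/-- The loop that thins out `B_x`: run through the list, and for each `s` that is still in `B`
remove from `B` some `t ≠ s` with `N⁺(s) ⊆ N⁺(t)`, if there is one. -/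
def pruneP (I : Inst V) : List V → List V → Prog (List V)
  | [], B => do
    tick
    return B
  | s :: l, B => do
    tick
    let alive ← memP s B
    if alive then
      let os ← outP G I s
      let t ← findP (fun t => do
        let e ← sameP s t
        if e then return false else
          let ot ← outP G I t
          allP (fun w => memP w ot) os) B
      match t with
      | some t => do
        let B' ← diffP B [t]
        pruneP I l B'
      | none => pruneP I l B
    else pruneP I l B

/-- `|N⁺(s)|`. -/
def outDegP (I : Inst V) (s : V) : Prog ℕ := do
  let out ← outP G I s
  lengthP out

/-- Algorithm KFVD.  "Exists" and "pick" are resolved by the first suitable vertex in the order of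
the lists. -/
def kfvd (I : Inst V) : Prog ℕ := do
  tick
  let vs ← vertsP I
  -- a source: delete it
  let src ← findP (fun v => do let l ← inP G I v; return l.isEmpty) vs
  match src with
  | some x => do
    let I' ← deleteP I [x]
    kfvd I'
  | none => do
  -- a sink: delete `R(x)`
  let snk ← findP (fun v => do let l ← outP G I v; return l.isEmpty) vs
  match snk with
  | some x => do
    let r ← bigRP G I x
    let I' ← deleteP I r
    kfvd I'
  | none => do
  match I.und with
  -- no undecided vertex is left
  | [] => lengthP vs
  | x₀ :: und' => do
  -- Subroutine 1: some undecided `x` has `ψ(x) ≥ 3.75`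
  let big ← findP (fun v => do let k ← dropP G I v; tick; return decide (15 ≤ k)) I.und
  match big with
  | some x => do
    let I₁ ← updateSinkP G I x []
    let I₂ ← updateNonsinkP I [x]
    let d ← outDegP G I x
    let a ← kfvd I₁
    let b ← kfvd I₂
    tick
    return min (a + d) b
  | none => do
  -- pick `x` maximizing `|N(x) ∩ U|`
  let nb := fun v => do let l ← undNbrsP G I v; lengthP l
  let n₀ ← nb x₀
  let x ← argmaxFrom nb x₀ n₀ und'
  let Ix ← updateSinkP G I x []
  let dx ← outDegP G I x
  let ax ← kfvd Ix
  tick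
  let surv ← survivingP G I x
  match surv with
  | [] => do
    -- Subroutine 2: branch on `x` and on every candidate sink
    let C ← candidatesP G I x
    C.foldlM (fun m s => do
      tick
      let Is ← updateSinkP G I s []
      let d ← outDegP G I s
      let a ← kfvd Is
      return min m (a + d)) (ax + dx)
  | y :: _ => do
    let B₀ ← outReachP G I y
    let n ← nb x
    if 1 ≤ n then do
      -- Subroutine 3: branch on `x` and on the first vertex of `B_x` that becomes a sink
      let B ← pruneP G I B₀ B₀
      let res ← B.foldlM (fun (m : ℕ × List V) s => do
        tick
        let Is ← updateSinkP G I s m.2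
        let d ← outDegP G I s
        let a ← kfvd Is
        return (min m.1 (a + d), s :: m.2)) (ax + dx, [])
      return res.1
    else
      -- Subroutine 4: branch on `x` and on one vertex of `R⁺(y)`
      match B₀ with
      | [] => return ax + dx
      | s :: _ => do
        let Is ← updateSinkP G I s []
        let d ← outDegP G I s
        let a ← kfvd Is
        tick
        return min (ax + dx) (a + d)
  partial_fixpoint

/-- Algorithm KFVD on a digraph with vertex set `{0, …, n-1}`: all potentials are `1` initially. -/
def solve {n : ℕ} (G : Digraph (Fin n)) [DecidableRel G.Adj] : Prog ℕ :=
  kfvd G ⟨List.finRange n, []⟩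

end KFVD

/-!
A solution is described by its sinks: a digraph is knot-free if and only if every vertex reaches a
sink. If `S` is a minimum solution, the out-neighbours of the sinks of `D - S` lie in `S`, and every
vertex of `S` is such an out-neighbour, since otherwise it could be put back. Hence making `s` a
sink costs exactly `|N⁺(s)|` and settles `R(s)`, and no sink of `D - S` lies in `R⁻` of another one,
so that lowering the potentials in `R⁺(s)` loses no minimum solution.

The size of the search tree is bounded by measure and conquer. The measure is four times the total
potential, except that an undecided vertex `v` which interacts with no other one does not count as
soon as `ψ(v) < 3.75`: the algorithm makes it a sink without branching, so a step that isolates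
undecided vertices is progress, as if it had removed them. Every branching of the algorithm, with
drops `d₁, d₂, …` of the measure, then satisfies `∑ b ^ (-dᵢ) ≤ 1` for `b = 1.098267`, and
`b ^ 4 ≤ 1.4549`.
-/

namespace KFVD

/-! ### Sinks of minimum solutions -/

section Solutions

variable {V : Type*} {G : Digraph V}

/-- The arcs of `G` other than loops, that is, the arcs seen by `arcP`. -/
def Arc (G : Digraph V) (u v : V) : Prop :=
  u ≠ v ∧ G.Adj u v

/-- `Reaches G X u v`: there is a directed path from `u` to `v` in the subgraph induced on `X`. -/
def Reaches (G : Digraph V) (X : Finset V) (u v : V) : Prop :=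
  u ∈ X ∧ Relation.ReflTransGen (fun p q => Arc G p q ∧ q ∈ X) u v

/-- `z` is a sink of the subgraph induced on `X`. -/
def IsSink (G : Digraph V) (X : Finset V) (z : V) : Prop :=
  z ∈ X ∧ ∀ w ∈ X, ¬ Arc G z w

/-- No arc of the subgraph induced on `X` leaves its vertex set `Y`. -/
structure OutClosed (G : Digraph V) (X Y : Finset V) : Prop where
  subset : Y ⊆ X
  mem_of_arc {p q : V} : p ∈ Y → q ∈ X → Arc G p q → q ∈ Y

/-- The subgraph induced on `X` is knot-free, in the form in which the algorithm uses it: every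
vertex reaches a sink. -/
def KnotFreeOn (G : Digraph V) (X : Finset V) : Prop :=
  ∀ u ∈ X, ∃ z, IsSink G X z ∧ Reaches G X u z

variable {X Y : Finset V} {u v w z : V}

theorem Arc.ne (h : Arc G u v) : u ≠ v := h.1

theorem not_arc_self (u : V) : ¬ Arc G u u := fun h => h.1 rfl

namespace Reaches

theorem refl (hu : u ∈ X) : Reaches G X u u := ⟨hu, .refl⟩

theorem head (hu : u ∈ X) (a : Arc G u v) (h : Reaches G X v w) : Reaches G X u w :=
  ⟨hu, .head ⟨a, h.1⟩ h.2⟩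

theorem trans (h : Reaches G X u v) (h' : Reaches G X v w) : Reaches G X u w :=
  ⟨h.1, h.2.trans h'.2⟩

theorem mem_left (h : Reaches G X u v) : u ∈ X := h.1

theorem mem_right (h : Reaches G X u v) : v ∈ X := by
  obtain rfl | ⟨_, _, _, hv⟩ := h.2.cases_tail
  · exact h.1
  · exact hv

theorem mono (hXY : X ⊆ Y) (h : Reaches G X u v) : Reaches G Y u v :=
  ⟨hXY h.1, Relation.ReflTransGen.mono (fun _ _ hq => ⟨hq.1, hXY hq.2⟩) _ _ h.2⟩

theorem head_induction_on {P : ∀ p, Reaches G X p v → Prop} (h : Reaches G X u v)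
    (refl : ∀ hv : v ∈ X, P v (.refl hv))
    (head : ∀ p q (hp : p ∈ X) (a : Arc G p q) (h : Reaches G X q v), P q h → P p (.head hp a h)) :
    P u h := by
  obtain ⟨hu, h⟩ := h
  induction h using Relation.ReflTransGen.head_induction_on with
  | refl => exact refl hu
  | head a h ih => exact head _ _ hu a.1 ⟨a.2, h⟩ (ih a.2)

theorem exists_exit {A : Set V} (h : Reaches G X u v) (hu : u ∈ A) (hv : v ∉ A) :
    ∃ p ∈ A, ∃ q ∉ A, Arc G p q ∧ Reaches G X q v := by
  induction h using head_induction_on with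
  | refl _ => exact absurd hu hv
  | head p q _ a h ih =>
    by_cases hq : q ∈ A
    · exact ih hq
    · exact ⟨p, hu, q, hq, a, h⟩

theorem eq_of_isSink (h : Reaches G X u v) (hu : IsSink G X u) : u = v := by
  obtain rfl | ⟨w, ⟨a, hw⟩, _⟩ := h.2.cases_head
  · rfl
  · exact absurd a (hu.2 w hw)

end Reaches

namespace OutClosed

theorem reaches (h : OutClosed G X Y) (hr : Reaches G X u v) (hu : u ∈ Y) : Reaches G Y u v := by
  induction hr using Reaches.head_induction_on with
  | refl _ => exact .refl hu
  | head p q _ a hq ih => exact .head hu a (ih (h.mem_of_arc hu hq.mem_left a))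

theorem isSink_iff (h : OutClosed G X Y) : IsSink G Y z ↔ z ∈ Y ∧ IsSink G X z :=
  ⟨fun hz => ⟨hz.1, h.subset hz.1, fun w hw a => hz.2 w (h.mem_of_arc hz.1 hw a) a⟩,
    fun hz => ⟨hz.1, fun w hw => hz.2.2 w (h.subset hw)⟩⟩

theorem knotFreeOn (h : OutClosed G X Y) (hX : KnotFreeOn G X) : KnotFreeOn G Y := fun u hu => by
  obtain ⟨z, hz, hr⟩ := hX u (h.subset hu)
  have hr' := h.reaches hr hu
  exact ⟨z, h.isSink_iff.2 ⟨hr'.mem_right, hz⟩, hr'⟩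

end OutClosed

theorem KnotFreeOn.extend (h : KnotFreeOn G X) (hXY : X ⊆ Y)
    (hnew : ∀ u ∈ Y, u ∉ X → ∃ z, IsSink G Y z ∧ Reaches G Y u z) : KnotFreeOn G Y := fun u hu => by
  by_cases huX : u ∈ X
  · obtain ⟨z, hz, hr⟩ := h u huX
    by_cases hzY : IsSink G Y z
    · exact ⟨z, hzY, hr.mono hXY⟩
    · obtain ⟨w, hw, a⟩ : ∃ w ∈ Y, Arc G z w := by simpa [IsSink, hXY hz.1] using hzY
      obtain ⟨z', hz', hr'⟩ := hnew w hw fun hwX => hz.2 w hwX a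
      exact ⟨z', hz', (hr.mono hXY).trans (.head (hXY hz.1) a hr')⟩
  · exact hnew u hu huX

open scoped Classical in
/-- `N⁺(v)` in the subgraph induced on `W`. -/
noncomputable def outs (G : Digraph V) (W : Finset V) (v : V) : Finset V :=
  W.filter (Arc G v)

theorem mem_outs {W : Finset V} : w ∈ outs G W v ↔ w ∈ W ∧ Arc G v w := by
  simp [outs]

theorem outs_subset {W : Finset V} : outs G W v ⊆ W := fun _ h => (mem_outs.1 h).1

variable [DecidableEq V] {W W' S S' U U' : Finset V} {p q s t x y : V}

/-- `InReach G W v u`: the vertex `u` belongs to `R⁻(v)` in the subgraph induced on `W`. -/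
def InReach (G : Digraph V) (W : Finset V) (v u : V) : Prop :=
  Reaches G (W \ outs G W v) u v

open scoped Classical in
/-- `R(v)` in the subgraph induced on `W`. -/
noncomputable def bigR (G : Digraph V) (W : Finset V) (v : V) : Finset V :=
  W.filter fun u => Arc G v u ∨ InReach G W v u

theorem mem_bigR : u ∈ bigR G W v ↔ u ∈ W ∧ (Arc G v u ∨ InReach G W v u) := by
  simp [bigR]

theorem mem_sdiff_outs : u ∈ W \ outs G W v ↔ u ∈ W ∧ ¬ Arc G v u := by
  simp only [Finset.mem_sdiff, mem_outs, not_and]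
  exact and_congr_right fun hu => ⟨fun h => h hu, fun h _ => h⟩

namespace InReach

theorem mem (h : InReach G W v u) : u ∈ W := (mem_sdiff_outs.1 h.mem_left).1

theorem not_arc (h : InReach G W v u) : ¬ Arc G v u := (mem_sdiff_outs.1 h.mem_left).2

theorem self (h : v ∈ W) : InReach G W v v := .refl (mem_sdiff_outs.2 ⟨h, not_arc_self v⟩)

theorem mem_bigR (h : InReach G W v u) : u ∈ bigR G W v := KFVD.mem_bigR.2 ⟨h.mem, .inr h⟩

theorem head (hu : u ∈ W) (hn : ¬ Arc G v u) (a : Arc G u w) (h : InReach G W v w) :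
    InReach G W v u :=
  Reaches.head (mem_sdiff_outs.2 ⟨hu, hn⟩) a h

theorem pred_mem_bigR (hu : u ∈ W) (a : Arc G u w) (h : InReach G W v w) : u ∈ bigR G W v := by
  by_cases hn : Arc G v u
  · exact KFVD.mem_bigR.2 ⟨hu, .inl hn⟩
  · exact (h.head hu hn a).mem_bigR

theorem mono (hW : W' ⊆ W) (h : InReach G W' v u) : InReach G W v u :=
  Reaches.mono (fun _ hq => mem_sdiff_outs.2 ((mem_sdiff_outs.1 hq).imp_left (@hW _))) h

theorem induction_on {P : ∀ p, InReach G W v p → Prop} (h : InReach G W v u)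
    (self : ∀ hv : v ∈ W, P v (.self hv))
    (head : ∀ p q (hp : p ∈ W) (hn : ¬ Arc G v p) (a : Arc G p q) (h : InReach G W v q),
      P q h → P p (.head hp hn a h)) : P u h :=
  Reaches.head_induction_on h (fun hv => self (mem_sdiff_outs.1 hv).1) fun p q hp =>
    head p q (mem_sdiff_outs.1 hp).1 (mem_sdiff_outs.1 hp).2

end InReach

theorem bigR_subset : bigR G W v ⊆ W := fun _ h => (mem_bigR.1 h).1

theorem arc_mem_bigR (hw : w ∈ W) (a : Arc G v w) : w ∈ bigR G W v := mem_bigR.2 ⟨hw, .inl a⟩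

theorem outs_subset_bigR : outs G W v ⊆ bigR G W v := fun _ h =>
  arc_mem_bigR (mem_outs.1 h).1 (mem_outs.1 h).2

theorem self_mem_bigR (h : v ∈ W) : v ∈ bigR G W v := (InReach.self h).mem_bigR

theorem pred_mem_bigR (hv : v ∈ W) (hu : u ∈ W) (a : Arc G u v) : u ∈ bigR G W v :=
  (InReach.self hv).pred_mem_bigR hu a

theorem bigR_mono (hW : W' ⊆ W) : bigR G W' v ⊆ bigR G W v := fun _ hu =>
  mem_bigR.2 ((mem_bigR.1 hu).imp (@hW _) (Or.imp_right (InReach.mono hW)))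

theorem Reaches.inReach (h : Reaches G (W \ S) u z) (hz : IsSink G (W \ S) z) : InReach G W z u :=
  Reaches.mono (fun q hq => mem_sdiff_outs.2 ⟨(Finset.mem_sdiff.1 hq).1, hz.2 q hq⟩) h

/-- `S` is a knot-free vertex deletion set of the subgraph induced on `W`. -/
def Sol (G : Digraph V) (W S : Finset V) : Prop :=
  S ⊆ W ∧ KnotFreeOn G (W \ S)

/-- `S` is a knot-free vertex deletion set of minimum size. -/
def MinSol (G : Digraph V) (W S : Finset V) : Prop :=
  Sol G W S ∧ ∀ S', Sol G W S' → S.card ≤ S'.card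

theorem mem_sdiff_erase (hp : p ∈ W) : q ∈ W \ S.erase p ↔ q = p ∨ q ∈ W \ S := by
  rw [Finset.sdiff_erase hp, Finset.mem_insert]

theorem sdiff_subset_sdiff_erase : W \ S ⊆ W \ S.erase p :=
  Finset.sdiff_subset_sdiff le_rfl (Finset.erase_subset _ _)

namespace IsSink

theorem sdiff_erase (hp : p ∈ W) (hz : IsSink G (W \ S) z) (hzp : ¬ Arc G z p) :
    IsSink G (W \ S.erase p) z := by
  refine ⟨sdiff_subset_sdiff_erase hz.1, fun w hw => ?_⟩
  obtain rfl | hw := (mem_sdiff_erase hp).1 hw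
  · exact hzp
  · exact hz.2 w hw

theorem outs_subset (h : IsSink G (W \ S) s) : outs G W s ⊆ S := fun w hw => by
  by_contra hn
  exact h.2 w (Finset.mem_sdiff.2 ⟨(mem_outs.1 hw).1, hn⟩) (mem_outs.1 hw).2

end IsSink

theorem Sol.erase (h : Sol G W S) (hp : p ∈ S) (hz : IsSink G (W \ S.erase p) z)
    (hpz : Reaches G (W \ S.erase p) p z) : Sol G W (S.erase p) := by
  refine ⟨(Finset.erase_subset _ _).trans h.1, h.2.extend sdiff_subset_sdiff_erase
    fun u hu hu' => ?_⟩
  obtain rfl := ((mem_sdiff_erase (h.1 hp)).1 hu).resolve_right hu'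
  exact ⟨z, hz, hpz⟩

namespace MinSol

theorem not_reaches (h : MinSol G W S) (hp : p ∈ S) (hz : IsSink G (W \ S.erase p) z) :
    ¬ Reaches G (W \ S.erase p) p z := fun hpz =>
  (Finset.card_erase_lt_of_mem hp).not_ge (h.2 _ (h.1.erase hp hz hpz))

theorem exists_arc_notMem (h : MinSol G W S) (hp : p ∈ S) : ∃ w ∈ W \ S, Arc G p w := by
  by_contra! hn
  have hpm : p ∈ W \ S.erase p := (mem_sdiff_erase (h.1.1 hp)).2 (.inl rfl)
  refine h.not_reaches hp ⟨hpm, fun w hw => ?_⟩ (.refl hpm)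
  obtain rfl | hw := (mem_sdiff_erase (h.1.1 hp)).1 hw
  · exact not_arc_self _
  · exact hn w hw

theorem exists_isSink_arc (h : MinSol G W S) (hp : p ∈ S) :
    ∃ z, IsSink G (W \ S) z ∧ Arc G z p := by
  obtain ⟨w, hw, a⟩ := h.exists_arc_notMem hp
  obtain ⟨z, hz, hr⟩ := h.1.2 w hw
  refine ⟨z, hz, by_contra fun hzp => ?_⟩
  exact h.not_reaches hp (hz.sdiff_erase (h.1.1 hp) hzp)
    (.head ((mem_sdiff_erase (h.1.1 hp)).2 (.inl rfl)) a (hr.mono sdiff_subset_sdiff_erase))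

theorem reaches_of_inReach (h : MinSol G W S) (hu : IsSink G (W \ S) u) (hs : InReach G W u s) :
    Reaches G (W \ S) s u := by
  induction hs using InReach.induction_on with
  | self _ => exact .refl hu.1
  | head p q hp hn a _ ih =>
    have hpS : p ∉ S := fun hpS => h.not_reaches hpS (hu.sdiff_erase hp hn)
      (.head ((mem_sdiff_erase hp).2 (.inl rfl)) a (ih.mono sdiff_subset_sdiff_erase))
    exact .head (Finset.mem_sdiff.2 ⟨hp, hpS⟩) a ih

theorem sink_eq (h : MinSol G W S) (hs : IsSink G (W \ S) s) (hu : IsSink G (W \ S) u)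
    (hsu : InReach G W u s) : s = u :=
  (h.reaches_of_inReach hu hsu).eq_of_isSink hs

theorem isSink_of_outs_subset (h : MinSol G W S) (hs : s ∈ W) (ho : outs G W s ⊆ S) :
    IsSink G (W \ S) s := by
  have hns : ∀ w ∈ W \ S, ¬ Arc G s w := fun w hw a =>
    (Finset.mem_sdiff.1 hw).2 (ho (mem_outs.2 ⟨(Finset.mem_sdiff.1 hw).1, a⟩))
  refine ⟨Finset.mem_sdiff.2 ⟨hs, fun hsS => ?_⟩, hns⟩
  obtain ⟨w, hw, a⟩ := h.exists_arc_notMem hsS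
  exact hns w hw a

theorem isSink_of_isSink (h : MinSol G W S) (hs : IsSink G W s) : IsSink G (W \ S) s :=
  h.isSink_of_outs_subset hs.1 fun w hw => absurd (mem_outs.1 hw).2 (hs.2 w (mem_outs.1 hw).1)

theorem isSink_of_outs_subset_outs (h : MinSol G W S) (ht : IsSink G (W \ S) t) (hs : s ∈ W)
    (hst : outs G W s ⊆ outs G W t) : IsSink G (W \ S) s :=
  h.isSink_of_outs_subset hs (hst.trans ht.outs_subset)

end MinSol

/-! ### Making a vertex a sink -/

theorem disjoint_outs_of_subset_sdiff_bigR (h : S ⊆ W \ bigR G W s) : Disjoint S (outs G W s) :=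
  Finset.disjoint_of_subset_left h
    (Finset.disjoint_of_subset_right outs_subset_bigR Finset.sdiff_disjoint)

theorem Sol.lift (hs : s ∈ W) (h : Sol G (W \ bigR G W s) S') : Sol G W (S' ∪ outs G W s) := by
  have mem_rest {q} : q ∈ W \ (S' ∪ outs G W s) ↔ q ∈ W ∧ q ∉ S' ∧ ¬ Arc G s q := by
    simp only [Finset.mem_sdiff, Finset.mem_union, mem_outs]
    tauto
  have mem_of_inReach {q} (hq : InReach G W s q) : q ∈ W \ (S' ∪ outs G W s) :=
    mem_rest.2 ⟨hq.mem, fun hS => (Finset.mem_sdiff.1 (h.1 hS)).2 hq.mem_bigR, hq.not_arc⟩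
  have hsink : IsSink G (W \ (S' ∪ outs G W s)) s :=
    ⟨mem_of_inReach (.self hs), fun w hw => (mem_rest.1 hw).2.2⟩
  refine ⟨Finset.union_subset (h.1.trans Finset.sdiff_subset) outs_subset,
    h.2.extend (fun q hq => ?_) fun u hu hu' => ⟨s, hsink, ?_⟩⟩
  · rw [Finset.mem_sdiff, Finset.mem_sdiff] at hq
    exact mem_rest.2 ⟨hq.1.1, hq.2, fun a => hq.1.2 (arc_mem_bigR hq.1.1 a)⟩
  · obtain ⟨huW, huS, hus⟩ := mem_rest.1 hu
    have huR : InReach G W s u := by simpa [huW, huS, mem_bigR, hus] using hu'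
    induction huR using InReach.induction_on with
    | self _ => exact .refl hsink.1
    | head p q _ _ a hq ih =>
      have hqr := mem_rest.1 (mem_of_inReach hq)
      exact .head hu a (ih (mem_of_inReach hq) (by simp [hq.mem_bigR]) hqr.1 hqr.2.1 hqr.2.2)

theorem sdiff_sdiff_sdiff_right (A B C : Finset V) : (A \ C) \ (B \ C) = (A \ B) \ C := by
  ext q
  simp only [Finset.mem_sdiff]
  tauto

theorem IsSink.outClosed_sdiff_bigR (hs : IsSink G (W \ S) s) :
    OutClosed G (W \ S) ((W \ bigR G W s) \ (S \ bigR G W s)) := by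
  rw [sdiff_sdiff_sdiff_right]
  refine ⟨Finset.sdiff_subset, fun {p q} hp hq a => Finset.mem_sdiff.2 ⟨hq, fun hqR => ?_⟩⟩
  obtain ⟨hpS, hpR⟩ := Finset.mem_sdiff.1 hp
  obtain hsq | hi := (mem_bigR.1 hqR).2
  · exact hs.2 q hq hsq
  · exact hpR (hi.pred_mem_bigR (Finset.mem_sdiff.1 hpS).1 a)

theorem Sol.restrict (h : Sol G W S) (hs : IsSink G (W \ S) s) :
    Sol G (W \ bigR G W s) (S \ bigR G W s) :=
  ⟨Finset.sdiff_subset_sdiff h.1 le_rfl, hs.outClosed_sdiff_bigR.knotFreeOn h.2⟩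

theorem card_sdiff_bigR_add_card_outs_le (hSW : S ⊆ W) (hs : IsSink G (W \ S) s) :
    (S \ bigR G W s).card + (outs G W s).card ≤ S.card := by
  rw [← Finset.card_union_of_disjoint
    (disjoint_outs_of_subset_sdiff_bigR (Finset.sdiff_subset_sdiff hSW le_rfl))]
  exact Finset.card_le_card (Finset.union_subset Finset.sdiff_subset hs.outs_subset)

theorem MinSol.restrict (h : MinSol G W S) (hs : IsSink G (W \ S) s) :
    MinSol G (W \ bigR G W s) (S \ bigR G W s) := by
  refine ⟨h.1.restrict hs, fun S' hS' => ?_⟩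
  have hlift := h.2 _ (hS'.lift (Finset.mem_sdiff.1 hs.1).1)
  rw [Finset.card_union_of_disjoint (disjoint_outs_of_subset_sdiff_bigR hS'.1)] at hlift
  have := card_sdiff_bigR_add_card_outs_le h.1.1 hs
  omega

/-! ### Solutions compatible with the undecided set -/

/-- `S` is a minimum solution all of whose sinks are undecided or sinks already: the solutions that
the algorithm may still find once the potentials outside `U` have been lowered. -/
def Compatible (G : Digraph V) (W U S : Finset V) : Prop :=
  MinSol G W S ∧ ∀ z, IsSink G (W \ S) z → z ∈ U ∨ IsSink G W z

namespace Compatible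

theorem restrict (h : Compatible G W U S) (hs : IsSink G (W \ S) s)
    (hU' : ∀ z ∈ U, IsSink G (W \ S) z → z ∉ bigR G W s → ¬ InReach G W z s → z ∈ U') :
    Compatible G (W \ bigR G W s) U' (S \ bigR G W s) := by
  refine ⟨h.1.restrict hs, fun z hz => ?_⟩
  obtain ⟨hzmem, hzS⟩ := hs.outClosed_sdiff_bigR.isSink_iff.1 hz
  have hzR : z ∉ bigR G W s := (Finset.mem_sdiff.1 (Finset.mem_sdiff.1 hzmem).1).2
  obtain hU | hW := h.2 z hzS
  · refine .inl (hU' z hU hzS hzR fun hi => ?_)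
    obtain rfl := h.1.sink_eq hs hzS hi
    exact hzR (self_mem_bigR hi.mem)
  · exact .inr ⟨Finset.mem_sdiff.2 ⟨hW.1, hzR⟩, fun w hw => hW.2 w (Finset.mem_sdiff.1 hw).1⟩

theorem erase_undecided (h : Compatible G W U S) (hx : ¬ IsSink G (W \ S) x) :
    Compatible G W (U.erase x) S :=
  ⟨h.1, fun z hz => (h.2 z hz).imp_left
    fun hU => Finset.mem_erase.2 ⟨fun e => hx (e ▸ hz), hU⟩⟩

end Compatible

theorem outClosed_erase_source (hx : ∀ w ∈ W, ¬ Arc G w x) :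
    OutClosed G (W \ S) ((W \ S).erase x) where
  subset := Finset.erase_subset _ _
  mem_of_arc hp hq a := Finset.mem_erase.2 ⟨fun e =>
    hx _ (Finset.mem_sdiff.1 (Finset.mem_erase.1 hp).2).1 (e ▸ a), hq⟩

theorem Sol.insert_source (hx : ∀ w ∈ W, ¬ Arc G w x) (h : Sol G (W.erase x) S) : Sol G W S := by
  have hclosed := outClosed_erase_source (S := S) hx
  obtain ⟨hSW, hfree⟩ := h
  rw [Finset.erase_sdiff_comm] at hfree
  refine ⟨hSW.trans (Finset.erase_subset _ _), hfree.extend hclosed.subset fun u hu hu' => ?_⟩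
  by_cases hn : ∃ w ∈ W \ S, Arc G u w
  · obtain ⟨w, hw, a⟩ := hn
    have hux : u = x := by simpa [hu] using hu'
    obtain ⟨z, hz, hr⟩ := hfree w (Finset.mem_erase.2 ⟨hux ▸ a.ne.symm, hw⟩)
    exact ⟨z, (hclosed.isSink_iff.1 hz).2, .head hu a (hr.mono hclosed.subset)⟩
  · push Not at hn
    exact ⟨u, ⟨hu, hn⟩, .refl hu⟩

theorem Compatible.erase_source (hx : ∀ w ∈ W, ¬ Arc G w x) (h : Compatible G W U S) :
    Compatible G (W.erase x) (U.erase x) (S.erase x) := by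
  have hclosed := outClosed_erase_source (S := S) hx
  have heq : W.erase x \ S.erase x = (W \ S).erase x := by
    simpa only [Finset.sdiff_singleton_eq_erase] using sdiff_sdiff_sdiff_right W S {x}
  refine ⟨⟨⟨Finset.erase_subset_erase _ h.1.1.1, ?_⟩, fun S' hS' => ?_⟩, fun z hz => ?_⟩
  · rw [heq]
    exact hclosed.knotFreeOn h.1.1.2
  · exact (Finset.card_le_card (Finset.erase_subset _ _)).trans (h.1.2 _ (hS'.insert_source hx))
  · rw [heq, hclosed.isSink_iff, Finset.mem_erase] at hz
    exact (h.2 z hz.2).imp (fun hU => Finset.mem_erase.2 ⟨hz.1.1, hU⟩) fun hW =>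
      ⟨Finset.mem_erase.2 ⟨hz.1.1, hW.1⟩, fun w hw => hW.2 w (Finset.mem_erase.1 hw).2⟩

namespace Compatible

theorem mem_of_isSink (h : Compatible G W U S) (hW : ∀ x ∈ W, ¬ IsSink G W x)
    (hz : IsSink G (W \ S) z) : z ∈ U :=
  (h.2 z hz).resolve_right fun h' => hW z h'.1 h'

theorem eq_of_undecided_empty (h : Compatible G W ∅ S) (hW : ∀ x ∈ W, ¬ IsSink G W x) : S = W := by
  refine h.1.1.1.antisymm fun u hu => by_contra fun hn => ?_
  obtain ⟨z, hz, _⟩ := h.1.1.2 u (Finset.mem_sdiff.2 ⟨hu, hn⟩)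
  exact Finset.notMem_empty z (h.mem_of_isSink hW hz)

theorem exists_sink_of_notMem (h : Compatible G W U S) (hW : ∀ x ∈ W, ¬ IsSink G W x)
    (hy : y ∈ W \ S) : ∃ z ∈ U, IsSink G (W \ S) z ∧ InReach G W z y := by
  obtain ⟨z, hz, hr⟩ := h.1.1.2 y hy
  exact ⟨z, h.mem_of_isSink hW hz, hz, hr.inReach hz⟩

theorem exists_candidate (h : Compatible G W U S) (hW : ∀ x ∈ W, ¬ IsSink G W x) (hx : x ∈ W)
    (hxs : ¬ IsSink G (W \ S) x) :
    ∃ z ∈ U, IsSink G (W \ S) z ∧ ∃ y ∈ outs G W x, InReach G W z y := by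
  obtain ⟨y, hy, hyS⟩ : ∃ y ∈ outs G W x, y ∉ S := by
    by_contra! hn
    exact hxs (h.1.isSink_of_outs_subset hx hn)
  obtain ⟨z, hzU, hz, hzy⟩ :=
    h.exists_sink_of_notMem hW (Finset.mem_sdiff.2 ⟨(mem_outs.1 hy).1, hyS⟩)
  exact ⟨z, hzU, hz, y, hy, hzy⟩

theorem exists_sink_of_surviving (h : Compatible G W U S) (hW : ∀ x ∈ W, ¬ IsSink G W x)
    (hxs : ¬ IsSink G (W \ S) x) (hyW : y ∈ W) (hy : ∀ u ∈ U, Arc G u y → u = x) :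
    ∃ z ∈ U, IsSink G (W \ S) z ∧ InReach G W z y := by
  refine h.exists_sink_of_notMem hW (Finset.mem_sdiff.2 ⟨hyW, fun hyS => ?_⟩)
  obtain ⟨z, hz, a⟩ := h.1.exists_isSink_arc hyS
  exact hxs (hy z (h.mem_of_isSink hW hz) a ▸ hz)

theorem notMem_of_independent (h : Compatible G W U S) (hW : ∀ x ∈ W, ¬ IsSink G W x)
    (hind : ∀ u ∈ U, ∀ w ∈ U, ¬ Arc G u w) (hs : s ∈ U) : s ∉ S := fun hsS => by
  obtain ⟨z, hz, a⟩ := h.1.exists_isSink_arc hsS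
  exact hind z (h.mem_of_isSink hW hz) s hs a

end Compatible

end Solutions

/-! ### The measure -/

section Measure

variable {V : Type*} {G : Digraph V} [DecidableEq V]
variable {W W' U U' T F : Finset V} {s v w x : V}

open scoped Classical in
/-- The undecided vertices `w` with `w ∈ R(v)` or `v ∈ R(w)`. -/
noncomputable def interacting (G : Digraph V) (W U : Finset V) (v : V) : Finset V :=
  U.filter fun w => w ∈ bigR G W v ∨ v ∈ bigR G W w

open scoped Classical in
/-- The undecided vertices that interact with no other undecided vertex and whose set `R(v)` is so
small that `4 ψ(v) = 3 + |R(v)| < 15`. They carry no measure, as the algorithm does not branch on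
them. -/
noncomputable def freeVerts (G : Digraph V) (W U : Finset V) : Finset V :=
  U.filter fun v => (bigR G W v).card ≤ 11 ∧ interacting G W U v ⊆ {v}

/-- Four times the sum of the potentials of the vertices that are not free. -/
noncomputable def measure (G : Digraph V) (W U : Finset V) : ℕ :=
  3 * (U \ freeVerts G W U).card + (W \ freeVerts G W U).card

theorem mem_interacting :
    w ∈ interacting G W U v ↔ w ∈ U ∧ (w ∈ bigR G W v ∨ v ∈ bigR G W w) := by
  simp [interacting]

theorem mem_freeVerts : v ∈ freeVerts G W U ↔
    v ∈ U ∧ (bigR G W v).card ≤ 11 ∧ interacting G W U v ⊆ {v} := by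
  simp [freeVerts]

theorem freeVerts_subset : freeVerts G W U ⊆ U := fun _ h => (mem_freeVerts.1 h).1

theorem interacting_subset : interacting G W U v ⊆ U := fun _ h => (mem_interacting.1 h).1

theorem self_mem_interacting (hU : U ⊆ W) (h : v ∈ U) : v ∈ interacting G W U v :=
  mem_interacting.2 ⟨h, .inl (self_mem_bigR (hU h))⟩

theorem interacting_mono (hW : W' ⊆ W) (hU : U' ⊆ U) :
    interacting G W' U' v ⊆ interacting G W U v := fun w hw => by
  rw [mem_interacting] at hw ⊢
  exact ⟨hU hw.1, hw.2.imp (@bigR_mono _ _ _ _ _ _ hW _) (@bigR_mono _ _ _ _ _ _ hW _)⟩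

theorem freeVerts_mono (hW : W' ⊆ W) (hU : U' ⊆ U) (h : v ∈ freeVerts G W U) (hv : v ∈ U') :
    v ∈ freeVerts G W' U' := by
  rw [mem_freeVerts] at h ⊢
  exact ⟨hv, (Finset.card_le_card (bigR_mono hW)).trans h.2.1,
    (interacting_mono hW hU).trans h.2.2⟩

theorem mem_interacting_comm (hv : v ∈ U) (h : w ∈ interacting G W U v) :
    v ∈ interacting G W U w := by
  rw [mem_interacting] at h ⊢
  exact ⟨hv, h.2.symm⟩

theorem notMem_freeVerts (h : w ∈ interacting G W U v) (hne : w ≠ v) :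
    v ∉ freeVerts G W U := fun hf => hne (by simpa using (mem_freeVerts.1 hf).2.2 h)

theorem mem_interacting_iff (hU : U ⊆ W) (hv : v ∈ W) : w ∈ interacting G W U v ↔
    w ∈ U ∧ (w ∈ bigR G W v ∨ InReach G W w v) := by
  rw [mem_interacting]
  refine and_congr_right fun hw => ⟨fun h => h.elim .inl fun h => ?_, Or.imp_right (·.mem_bigR)⟩
  exact (mem_bigR.1 h).2.imp (pred_mem_bigR hv (hU hw)) id

theorem measure_mono (hW : W' ⊆ W) (hU : U' ⊆ U)
    (hF : ∀ v ∈ freeVerts G W U, v ∈ W' → v ∈ U') (hUW : U' ⊆ W') :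
    measure G W' U' ≤ measure G W U := by
  have key {v} (hv : v ∈ W') (hn : v ∉ freeVerts G W' U') : v ∉ freeVerts G W U := fun hf =>
    hn (freeVerts_mono hW hU hf (hF v hf hv))
  unfold measure
  gcongr 3 * (Finset.card ?_) + Finset.card ?_ <;> intro v hv <;> rw [Finset.mem_sdiff] at hv ⊢
  · exact ⟨hU hv.1, key (hUW hv.1) hv.2⟩
  · exact ⟨hW hv.1, key hv.1 hv.2⟩

theorem measure_add_card_freeVerts (hU : U ⊆ W) :
    measure G W U + 4 * (freeVerts G W U).card = 3 * U.card + W.card := by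
  have hUF := Finset.card_sdiff_add_card_eq_card (freeVerts_subset (G := G) (W := W) (U := U))
  have hWF := Finset.card_sdiff_add_card_eq_card
    ((freeVerts_subset (G := G) (W := W) (U := U)).trans hU)
  unfold measure
  omega

theorem measure_erase_add_three_le (hU : U ⊆ W) (hx : x ∈ U) (hxf : x ∉ freeVerts G W U) :
    measure G W (U.erase x) + 3 ≤ measure G W U := by
  have hadd := measure_add_card_freeVerts (G := G) hU
  have hadd' := measure_add_card_freeVerts (G := G) ((Finset.erase_subset x U).trans hU)
  have hcard := Finset.card_erase_add_one hx
  have hfree : (freeVerts G W U).card ≤ (freeVerts G W (U.erase x)).card :=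
    Finset.card_le_card fun v hv => freeVerts_mono le_rfl (Finset.erase_subset _ _) hv
      (Finset.mem_erase.2 ⟨fun e => hxf (e ▸ hv), freeVerts_subset hv⟩)
  omega

/-- The undecided set after `s` is made a sink and the potentials of `T` are lowered. -/
noncomputable def undAfter (G : Digraph V) (W U : Finset V) (s : V) (T : Finset V) : Finset V :=
  U \ (interacting G W U s ∪ T)

/-- The measure of the instance in which `s` is made a sink and the potentials of `T` are
lowered. -/
noncomputable def measureAfter (G : Digraph V) (W U : Finset V) (s : V) (T : Finset V) : ℕ :=
  measure G (W \ bigR G W s) (undAfter G W U s T)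

theorem mem_undAfter : v ∈ undAfter G W U s T ↔ v ∈ U ∧ v ∉ interacting G W U s ∧ v ∉ T := by
  simp [undAfter]

theorem undAfter_subset : undAfter G W U s T ⊆ U := Finset.sdiff_subset

theorem undAfter_subset_sdiff (hU : U ⊆ W) : undAfter G W U s T ⊆ W \ bigR G W s := fun v hv => by
  rw [mem_undAfter] at hv
  exact Finset.mem_sdiff.2 ⟨hU hv.1, fun h => hv.2.1 (mem_interacting.2 ⟨hv.1, .inl h⟩)⟩

theorem mem_undAfter_of_mem_freeVerts (hs : s ∈ U) (hT : ∀ t ∈ T, t ∉ freeVerts G W U)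
    (hv : v ∈ freeVerts G W U) (hvs : v ≠ s) : v ∈ undAfter G W U s T :=
  mem_undAfter.2 ⟨freeVerts_subset hv,
    fun hi => notMem_freeVerts (mem_interacting_comm hs hi) hvs.symm hv, fun ht => hT v ht hv⟩

theorem measureAfter_le (hU : U ⊆ W) (hs : s ∈ U) :
    measureAfter G W U s ∅ ≤ measure G W U :=
  measure_mono Finset.sdiff_subset undAfter_subset
    (fun _ hv hvW => mem_undAfter_of_mem_freeVerts hs (by simp) hv fun e =>
      (Finset.mem_sdiff.1 hvW).2 (e.symm ▸ self_mem_bigR (hU hs)))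
    (undAfter_subset_sdiff hU)

theorem measureAfter_add_le (hU : U ⊆ W) (hs : s ∈ U) (hsf : s ∉ freeVerts G W U) (hT : T ⊆ U)
    (hTf : ∀ t ∈ T, t ∉ freeVerts G W U) (hF : ∀ v ∈ F, v ∉ freeVerts G W U ∧
      v ∈ freeVerts G (W \ bigR G W s) (undAfter G W U s T)) :
    measureAfter G W U s T +
      (3 * (interacting G W U s ∪ T).card + (bigR G W s).card + 4 * F.card) ≤
        measure G W U := by
  have hadd := measure_add_card_freeVerts (G := G) hU
  have hadd' := measure_add_card_freeVerts (G := G)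
    (undAfter_subset_sdiff (G := G) (s := s) (T := T) hU)
  have hUcard : (undAfter G W U s T).card + (interacting G W U s ∪ T).card = U.card :=
    Finset.card_sdiff_add_card_eq_card (Finset.union_subset interacting_subset hT)
  have hWcard : (W \ bigR G W s).card + (bigR G W s).card = W.card :=
    Finset.card_sdiff_add_card_eq_card bigR_subset
  have hfree : (freeVerts G W U).card + F.card ≤
      (freeVerts G (W \ bigR G W s) (undAfter G W U s T)).card := by
    rw [← Finset.card_union_of_disjoint (Finset.disjoint_right.2 fun v hv => (hF v hv).1)]
    refine Finset.card_le_card (Finset.union_subset (fun v hv => ?_) fun v hv => (hF v hv).2)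
    exact freeVerts_mono Finset.sdiff_subset undAfter_subset hv
      (mem_undAfter_of_mem_freeVerts hs hTf hv fun e => hsf (e ▸ hv))
  unfold measureAfter
  omega

theorem mem_freeVerts_after (hv : v ∈ U) (hcard : (bigR G W v).card ≤ 11)
    (hvs : v ∉ interacting G W U s)
    (hint : ∀ w ∈ interacting G W U v, w ≠ v → w ∈ interacting G W U s) :
    v ∈ freeVerts G (W \ bigR G W s) (undAfter G W U s ∅) := by
  rw [mem_freeVerts]
  refine ⟨mem_undAfter.2 ⟨hv, hvs, by simp⟩,
    (Finset.card_le_card (bigR_mono Finset.sdiff_subset)).trans hcard, fun w hw => ?_⟩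
  by_contra hne
  exact (mem_undAfter.1 (interacting_subset hw)).2.1
    (hint w (interacting_mono Finset.sdiff_subset undAfter_subset hw) (by simpa using hne))

end Measure

section Base

/-- The base of the exponential bound per quarter unit of potential. It is chosen so that every
branching of the algorithm satisfies `∑ base ^ (-dᵢ) ≤ 1` for its drops `dᵢ` of the measure, while
the fourth power stays below `1.4549`. -/
noncomputable def base : ℝ := 1.098267

theorem base_pos : 0 < base := by norm_num [base]

theorem one_le_base : 1 ≤ base := by norm_num [base]

theorem base_pow_four_le : base ^ 4 ≤ 1.4549 := by norm_num [base]

variable {a b c m m₁ m₂ m₃ M : ℕ}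

theorem base_pow_le (h : m + a ≤ M) : base ^ m ≤ base ^ M * (base ^ a)⁻¹ := by
  rw [← div_eq_mul_inv, le_div_iff₀ (pow_pos base_pos a), ← pow_add]
  exact pow_le_pow_right₀ one_le_base h

theorem base_pow_add_le (h₁ : m₁ + a ≤ M) (h₂ : m₂ + b ≤ M) (h : (base ^ a)⁻¹ + (base ^ b)⁻¹ ≤ 1) :
    base ^ m₁ + base ^ m₂ ≤ base ^ M := by
  have := mul_le_mul_of_nonneg_left h (pow_pos base_pos M).le
  linarith [base_pow_le h₁, base_pow_le h₂]

theorem base_pow_add_three_le (h₁ : m₁ + a ≤ M) (h₂ : m₂ + b ≤ M) (h₃ : m₃ + c ≤ M)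
    (h : (base ^ a)⁻¹ + (base ^ b)⁻¹ + (base ^ c)⁻¹ ≤ 1) :
    base ^ m₁ + base ^ m₂ + base ^ m₃ ≤ base ^ M := by
  have := mul_le_mul_of_nonneg_left h (pow_pos base_pos M).le
  linarith [base_pow_le h₁, base_pow_le h₂, base_pow_le h₃]

theorem base_pow_add_sum_le {ι : Type*} {C : Finset ι} {f : ι → ℕ} (hm : m + a ≤ M)
    (hf : ∀ i ∈ C, f i + b ≤ M) (h : (base ^ a)⁻¹ + C.card * (base ^ b)⁻¹ ≤ 1) :
    base ^ m + ∑ i ∈ C, base ^ f i ≤ base ^ M := by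
  have hsum : ∑ i ∈ C, base ^ f i ≤ C.card * (base ^ M * (base ^ b)⁻¹) := by
    simpa using Finset.sum_le_card_nsmul C _ _ fun i hi => base_pow_le (hf i hi)
  have := mul_le_mul_of_nonneg_left h (pow_pos base_pos M).le
  linarith [base_pow_le hm]

end Base

section Branching

variable {V : Type*} {G : Digraph V} [DecidableEq V]
variable {W U S : Finset V} {p q s s₁ s₂ t u v w x y y' z : V}

omit [DecidableEq V] in
theorem length_le_card {A : Finset V} {L : List V} (hL : L.Nodup) (h : ∀ v ∈ L, v ∈ A) :
    L.length ≤ A.card := by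
  simpa using (hL.subperm fun v hv => Finset.mem_toList.2 (h v hv)).length_le

theorem base_pow_measureAfter_add_erase_le (hU : U ⊆ W) (hx : x ∈ U)
    (hdrop : 15 ≤ 3 * (interacting G W U x).card + (bigR G W x).card) :
    base ^ measureAfter G W U x ∅ + base ^ measure G W (U.erase x) ≤ base ^ measure G W U := by
  have hxf : x ∉ freeVerts G W U := fun hf => by
    obtain ⟨-, hR, hI⟩ := mem_freeVerts.1 hf
    have := Finset.card_le_card hI
    rw [Finset.card_singleton] at this
    omega
  have hafter := measureAfter_add_le (F := ∅) (T := ∅) hU hx hxf (by simp) (by simp) (by simp)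
  rw [Finset.union_empty, Finset.card_empty] at hafter
  exact base_pow_add_le (a := 15) (b := 3) (by omega) (measure_erase_add_three_le hU hx hxf)
    (by norm_num [base])

/-- An instance to which neither a reduction nor the branching on a vertex with `ψ(v) ≥ 3.75`
applies. The three summands of `4 ψ(v)` are collected as `3 |I| + |R(v)|`, where `I` is the set of
vertices interacting with `v`. -/
structure Reduced (G : Digraph V) (W U : Finset V) : Prop where
  subset : U ⊆ W
  exists_succ : ∀ x ∈ W, ∃ w ∈ W, Arc G x w
  drop_le : ∀ v ∈ U, 3 * (interacting G W U v).card + (bigR G W v).card ≤ 14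

open scoped Classical in
/-- The undecided neighbours `N(v) ∩ U`. -/
noncomputable def undNbrs (G : Digraph V) (U : Finset V) (v : V) : Finset V :=
  U.filter fun w => Arc G v w ∨ Arc G w v

omit [DecidableEq V] in
theorem mem_undNbrs : w ∈ undNbrs G U v ↔ w ∈ U ∧ (Arc G v w ∨ Arc G w v) := by
  simp [undNbrs]

omit [DecidableEq V] in
theorem self_notMem_undNbrs : v ∉ undNbrs G U v := by
  simp [mem_undNbrs, not_arc_self]

theorem undNbrs_subset_bigR (hU : U ⊆ W) (hv : v ∈ W) : undNbrs G U v ⊆ bigR G W v :=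
  fun w hw => by
    rw [mem_undNbrs] at hw
    exact hw.2.elim (arc_mem_bigR (hU hw.1)) (pred_mem_bigR hv (hU hw.1))

theorem card_undNbrs_lt (hU : U ⊆ W) (hv : v ∈ W) :
    (undNbrs G U v).card < (bigR G W v).card :=
  Finset.card_lt_card ⟨undNbrs_subset_bigR hU hv,
    fun h => self_notMem_undNbrs (h (self_mem_bigR hv))⟩

namespace Reduced

theorem not_isSink (h : Reduced G W U) : ∀ x ∈ W, ¬ IsSink G W x := fun x hx hs => by
  obtain ⟨w, hw, a⟩ := h.exists_succ x hx
  exact hs.2 w hw a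

theorem card_bigR_le (h : Reduced G W U) (hv : v ∈ U) : (bigR G W v).card ≤ 11 := by
  have := h.drop_le v hv
  have := Finset.card_pos.2 ⟨v, self_mem_interacting (G := G) h.subset hv⟩
  omega

theorem measureAfter_add_le (h : Reduced G W U) (hs : s ∈ U) (hw : w ∈ interacting G W U s)
    (hws : w ≠ s) :
    measureAfter G W U s ∅ + (3 * (interacting G W U s).card + (bigR G W s).card) ≤
      measure G W U := by
  simpa using KFVD.measureAfter_add_le (F := ∅) (T := ∅) h.subset hs (notMem_freeVerts hw hws)
    (by simp) (by simp) (by simp)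

theorem measureAfter_add_four_le (h : Reduced G W U) (hs : s ∈ U)
    (hw : w ∈ interacting G W U s) (hws : w ≠ s) (hv : v ∈ U) (hvs : v ∉ interacting G W U s)
    (hq : q ∈ interacting G W U v) (hqv : q ≠ v)
    (hint : ∀ w ∈ interacting G W U v, w ≠ v → w ∈ interacting G W U s) :
    measureAfter G W U s ∅ + (3 * (interacting G W U s).card + (bigR G W s).card + 4) ≤
      measure G W U := by
  simpa using KFVD.measureAfter_add_le (F := {v}) (T := ∅) h.subset hs (notMem_freeVerts hw hws)
    (by simp) (by simp) (by
      simpa using ⟨notMem_freeVerts hq hqv,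
        mem_freeVerts_after hv (h.card_bigR_le hv) hvs hint⟩)

theorem measureAfter_singleton_add_le (h : Reduced G W U) (hs : s ∈ U)
    (hw : w ∈ interacting G W U s) (hws : w ≠ s) (ht : t ∈ U) (hq : q ∈ interacting G W U t)
    (hqt : q ≠ t) :
    measureAfter G W U s {t} + (3 * (insert t (interacting G W U s)).card + (bigR G W s).card) ≤
      measure G W U := by
  have := KFVD.measureAfter_add_le (F := ∅) (T := {t}) h.subset hs (notMem_freeVerts hw hws)
    (by simpa using ht) (by simpa using notMem_freeVerts hq hqt) (by simp)
  rwa [Finset.union_comm, ← Finset.insert_eq, Finset.card_empty] at this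

theorem interacting_eq_insert (h : Reduced G W U) {C : Finset V} (hv : v ∈ U)
    (hC : ∀ s ∈ C, s ∈ interacting G W U v) (hvC : v ∉ C) (hcard : C.card = 3) :
    interacting G W U v = insert v C := by
  refine (Finset.eq_of_subset_of_card_le
    (Finset.insert_subset (self_mem_interacting h.subset hv) hC) ?_).symm
  have := h.drop_le v hv
  rw [Finset.card_insert_of_notMem hvC]
  omega

theorem bigR_eq_pair (h : Reduced G W U) (hv : v ∈ U) (hw : w ∈ bigR G W v) (hvw : v ≠ w)
    (hI : 4 ≤ (interacting G W U v).card) : bigR G W v = {v, w} := by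
  refine (Finset.eq_of_subset_of_card_le (Finset.insert_subset (self_mem_bigR (h.subset hv))
    (Finset.singleton_subset_iff.2 hw)) ?_).symm
  have := h.drop_le v hv
  rw [Finset.card_pair hvw]
  omega

end Reduced

/-- The vertex `s` is a candidate to be made a sink when `x` is not: it lies in `R⁺(y)` for the
out-neighbour `y` of `x`. -/
structure Candidate (G : Digraph V) (W U : Finset V) (x y s : V) : Prop where
  mem_outs : y ∈ outs G W x
  mem : s ∈ U
  inReach : InReach G W s y

namespace Candidate

theorem arc (h : Candidate G W U x y s) : Arc G x y := (KFVD.mem_outs.1 h.mem_outs).2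

theorem ne (h : Candidate G W U x y s) : x ≠ s := fun e => h.inReach.not_arc (e ▸ h.arc)

theorem mem_bigR (h : Candidate G W U x y s) (hx : x ∈ W) : x ∈ bigR G W s :=
  h.inReach.pred_mem_bigR hx h.arc

theorem mem_interacting (h : Candidate G W U x y s) (hU : U ⊆ W) (hx : x ∈ U) :
    x ∈ interacting G W U s :=
  KFVD.mem_interacting.2 ⟨hx, .inl (h.mem_bigR (hU hx))⟩

theorem mem_interacting_left (h : Candidate G W U x y s) (hU : U ⊆ W) (hx : x ∈ U) :
    s ∈ interacting G W U x :=
  mem_interacting_comm h.mem (h.mem_interacting hU hx)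

theorem measureAfter_left_add_le (h : Candidate G W U x y s) (hR : Reduced G W U) (hx : x ∈ U) :
    measureAfter G W U x ∅ + (3 * (interacting G W U x).card + (bigR G W x).card) ≤
      measure G W U :=
  hR.measureAfter_add_le hx (h.mem_interacting_left hR.subset hx) h.ne.symm

theorem measureAfter_add_le (h : Candidate G W U x y s) (hR : Reduced G W U) (hx : x ∈ U) :
    measureAfter G W U s ∅ + (3 * (interacting G W U s).card + (bigR G W s).card) ≤
      measure G W U :=
  hR.measureAfter_add_le h.mem (h.mem_interacting hR.subset hx) h.ne

theorem two_le_card_bigR_left (h : Candidate G W U x y s) (hx : x ∈ W) :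
    2 ≤ (bigR G W x).card :=
  Finset.one_lt_card.2 ⟨x, self_mem_bigR hx, y, outs_subset_bigR h.mem_outs, h.arc.ne⟩

theorem base_pow_add_le (h : Candidate G W U x y s) (hR : Reduced G W U) (hx : x ∈ U) :
    base ^ measureAfter G W U x ∅ + base ^ measureAfter G W U s ∅ ≤ base ^ measure G W U := by
  have hdrop := h.measureAfter_left_add_le hR hx
  have hdrop' := h.measureAfter_add_le hR hx
  have hxs := h.mem_interacting hR.subset hx
  have hI : 1 < (interacting G W U x).card := Finset.one_lt_card.2
    ⟨x, self_mem_interacting hR.subset hx, s, h.mem_interacting_left hR.subset hx, h.ne⟩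
  have hI' : 1 < (interacting G W U s).card := Finset.one_lt_card.2
    ⟨s, self_mem_interacting hR.subset h.mem, x, hxs, h.ne.symm⟩
  have hR' : 1 < (bigR G W s).card := Finset.one_lt_card.2
    ⟨s, self_mem_bigR (hR.subset h.mem), x, h.mem_bigR (hR.subset hx), h.ne.symm⟩
  have := h.two_le_card_bigR_left (hR.subset hx)
  exact KFVD.base_pow_add_le (a := 8) (b := 8) (by omega) (by omega) (by norm_num [base])

theorem exists_exit (h : Candidate G W U x y s) (hsy : s ≠ y) :
    ∃ r ∈ W, r ≠ x ∧ r ≠ y ∧ (Arc G x r ∨ Arc G y r) := by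
  obtain ⟨p, hp, r, hr, a, hrs⟩ :=
    Reaches.exists_exit (A := {x, y}) h.inReach (by simp) (by simp [h.ne.symm, hsy])
  simp only [Set.mem_insert_iff, Set.mem_singleton_iff, not_or] at hp hr
  refine ⟨r, InReach.mem hrs, hr.1, hr.2, ?_⟩
  rcases hp with rfl | rfl
  exacts [.inl a, .inr a]

end Candidate

theorem card_candidates_lt (hU : U ⊆ W) (hx : x ∈ U) {C : Finset V}
    (hC : ∀ s ∈ C, ∃ y, Candidate G W U x y s) : C.card < (interacting G W U x).card := by
  refine Finset.card_lt_card ⟨fun s hs => ?_, fun h => ?_⟩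
  · obtain ⟨y, hy⟩ := hC s hs
    exact hy.mem_interacting_left hU hx
  · obtain ⟨y, hy⟩ := hC x (h (self_mem_interacting hU hx))
    exact hy.ne rfl

/-! ### Branching when every out-neighbour has a second undecided in-neighbour -/

section NoSurvivor

variable (hR : Reduced G W U) (hx : x ∈ U)
  (hmax : ∀ v ∈ U, (undNbrs G U v).card ≤ (undNbrs G U x).card)
  (hS : ∀ y ∈ outs G W x, ∃ u ∈ U, u ≠ x ∧ Arc G u y)

include hR hx

theorem Candidate.three_le_card_interacting (h : Candidate G W U x y s) (hu : u ∈ U)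
    (hux : u ≠ x) (a : Arc G u y) :
    u ∈ interacting G W U s ∧ 3 ≤ (interacting G W U s).card := by
  have huI : u ∈ interacting G W U s :=
    KFVD.mem_interacting.2 ⟨hu, .inl (h.inReach.pred_mem_bigR (hR.subset hu) a)⟩
  have hus : s ≠ u := fun e => h.inReach.not_arc (e ▸ a)
  exact ⟨huI, Finset.two_lt_card.2 ⟨s, self_mem_interacting hR.subset h.mem,
    x, h.mem_interacting hR.subset hx, u, huI, h.ne.symm, hus, hux.symm⟩⟩

include hS

theorem Candidate.measureAfter_add_twelve_le (h : Candidate G W U x y s) :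
    measureAfter G W U s ∅ + 12 ≤ measure G W U := by
  obtain ⟨u, hu, hux, a⟩ := hS y h.mem_outs
  obtain ⟨-, hI⟩ := h.three_le_card_interacting hR hx hu hux a
  have hus : s ≠ u := fun e => h.inReach.not_arc (e ▸ a)
  have hbig : 2 < (bigR G W s).card := Finset.two_lt_card.2 ⟨s, self_mem_bigR (hR.subset h.mem),
    x, h.mem_bigR (hR.subset hx), u, h.inReach.pred_mem_bigR (hR.subset hu) a, h.ne.symm, hus,
    hux.symm⟩
  have := h.measureAfter_add_le hR hx
  omega

theorem Candidate.measureAfter_add_fourteen_le (h : Candidate G W U x y s)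
    (hind : ∀ u ∈ U, ∀ w ∈ U, ¬ Arc G u w) : measureAfter G W U s ∅ + 14 ≤ measure G W U := by
  obtain ⟨u, hu, hux, a⟩ := hS y h.mem_outs
  obtain ⟨-, hI⟩ := h.three_le_card_interacting hR hx hu hux a
  obtain ⟨n, hn, an⟩ := hR.exists_succ s (hR.subset h.mem)
  have hy : y ∉ U := hind x hx y |>.mt (· h.arc)
  have hnU : n ∉ U := fun hnU => hind s h.mem n hnU an
  have hus : s ≠ u := fun e => h.inReach.not_arc (e ▸ a)
  have hny : n ≠ y := fun e => h.inReach.not_arc (e ▸ an)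
  have hbig : [s, x, u, y, n].length ≤ (bigR G W s).card := by
    have := h.mem
    have := h.ne
    refine length_le_card (by grind) ?_
    simpa using ⟨self_mem_bigR (hR.subset h.mem), h.mem_bigR (hR.subset hx),
      h.inReach.pred_mem_bigR (hR.subset hu) a, h.inReach.mem_bigR, arc_mem_bigR hn an⟩
  have := h.measureAfter_add_le hR hx
  simp only [List.length_cons] at hbig
  omega

theorem measureAfter_add_eighteen_le {C : Finset V}
    (hC : ∀ s ∈ C, Candidate G W U x y s) (hcard : C.card = 3) :
    measureAfter G W U x ∅ + 18 ≤ measure G W U := by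
  have hyx {s} (hs : s ∈ C) : s ∈ interacting G W U x := (hC s hs).mem_interacting_left hR.subset hx
  have hIx := hR.interacting_eq_insert hx (@hyx) (fun h => (hC x h).ne rfl) hcard
  obtain ⟨s, hs⟩ := Finset.card_pos.1 (by omega : 0 < C.card)
  obtain ⟨u, hu, hux, a⟩ := hS y (hC s hs).mem_outs
  have huC : u ∉ C := fun h => (hC u h).inReach.not_arc a
  -- `u` interacts with the candidates only, hence becomes free when `x` is made a sink
  have hIu := hR.interacting_eq_insert hu (fun t ht => mem_interacting_comm (hC t ht).mem
    ((hC t ht).three_le_card_interacting hR hx hu hux a).1) huC hcard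
  have := (hC s hs).two_le_card_bigR_left (hR.subset hx)
  have hcard' : (interacting G W U x).card = 4 := by
    rw [hIx, Finset.card_insert_of_notMem fun h => (hC x h).ne rfl, hcard]
  have := hR.measureAfter_add_four_le hx (hyx hs) (hC s hs).ne.symm hu (by simp [hIx, hux, huC])
    (q := s) (by simp [hIu, hs]) (fun e => huC (e ▸ hs)) fun w hw hwu => hyx
      (by simpa [hIu, hwu] using hw)
  omega

include hmax

theorem independent_of_card_bigR_le_two (hy : y ∈ outs G W x) (hcard : (bigR G W x).card ≤ 2) :
    ∀ u ∈ U, ∀ w ∈ U, ¬ Arc G u w := by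
  obtain ⟨hyW, a⟩ := mem_outs.1 hy
  have hlt := card_undNbrs_lt (G := G) hR.subset (hR.subset hx)
  have hyU : y ∉ U := fun hyU => by
    obtain ⟨u, hu, hux, a'⟩ := hS y hy
    have : 1 < (undNbrs G U y).card := Finset.one_lt_card.2
      ⟨u, mem_undNbrs.2 ⟨hu, .inr a'⟩, x, mem_undNbrs.2 ⟨hx, .inr a⟩, hux⟩
    have := hmax y hyU
    omega
  have hempty : undNbrs G U x = ∅ := by
    by_contra! hne
    obtain ⟨v, hv⟩ := hne
    have : 2 < (bigR G W x).card := Finset.two_lt_card.2 ⟨x, self_mem_bigR (hR.subset hx),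
      y, arc_mem_bigR hyW a, v, undNbrs_subset_bigR hR.subset (hR.subset hx) hv, a.ne,
      fun e => self_notMem_undNbrs (e ▸ hv), fun e => hyU (e ▸ (mem_undNbrs.1 hv).1)⟩
    omega
  intro u hu w hw a'
  have : undNbrs G U u = ∅ := by simpa [hempty] using hmax u hu
  exact Finset.notMem_empty w (this ▸ mem_undNbrs.2 ⟨hw, .inl a'⟩)

theorem base_pow_add_sum_le_of_card_eq_two {C : Finset V}
    (hC : ∀ s ∈ C, ∃ y, Candidate G W U x y s) (hcard : C.card = 2) :
    base ^ measureAfter G W U x ∅ + ∑ s ∈ C, base ^ measureAfter G W U s ∅ ≤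
      base ^ measure G W U := by
  obtain ⟨s, hs⟩ := Finset.card_pos.1 (by omega : 0 < C.card)
  obtain ⟨y, h⟩ := hC s hs
  have hI := card_candidates_lt hR.subset hx hC
  have hdrop := h.measureAfter_left_add_le hR hx
  by_cases hbig : (bigR G W x).card ≤ 2
  · have hind := independent_of_card_bigR_le_two hR hx hmax hS h.mem_outs hbig
    have := h.two_le_card_bigR_left (hR.subset hx)
    exact base_pow_add_sum_le (a := 11) (b := 14) (by omega) (fun t ht =>
      (hC t ht).elim fun _ h => h.measureAfter_add_fourteen_le hR hx hS hind)
      (by norm_num [base, hcard])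
  · exact base_pow_add_sum_le (a := 12) (b := 12) (by omega) (fun t ht =>
      (hC t ht).elim fun _ h => h.measureAfter_add_twelve_le hR hx hS)
      (by norm_num [base, hcard])

theorem base_pow_add_sum_le_of_card_eq_three {C : Finset V}
    (hC : ∀ s ∈ C, ∃ y, Candidate G W U x y s) (hcard : C.card = 3) :
    base ^ measureAfter G W U x ∅ + ∑ s ∈ C, base ^ measureAfter G W U s ∅ ≤
      base ^ measure G W U := by
  obtain ⟨s, hs⟩ := Finset.card_pos.1 (by omega : 0 < C.card)
  obtain ⟨y, h⟩ := hC s hs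
  have hI := card_candidates_lt hR.subset hx hC
  have hdrop := hR.drop_le x hx
  have hxy := hR.bigR_eq_pair hx (outs_subset_bigR h.mem_outs) h.arc.ne (by omega)
  have hC' : ∀ t ∈ C, Candidate G W U x y t := fun t ht => by
    obtain ⟨y', h'⟩ := hC t ht
    have hy' : y' ∈ ({x, y} : Finset V) := hxy ▸ outs_subset_bigR h'.mem_outs
    rwa [← (by simpa [h'.arc.ne.symm] using hy' : y' = y)]
  have hind := independent_of_card_bigR_le_two hR hx hmax hS h.mem_outs (by omega)
  exact base_pow_add_sum_le (a := 18) (b := 14)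
    (measureAfter_add_eighteen_le hR hx hS hC' hcard)
    (fun t ht => (hC' t ht).measureAfter_add_fourteen_le hR hx hS hind) (by norm_num [base, hcard])

theorem base_pow_measureAfter_add_sum_le {C : Finset V}
    (hC : ∀ s ∈ C, ∃ y, Candidate G W U x y s) :
    base ^ measureAfter G W U x ∅ + ∑ s ∈ C, base ^ measureAfter G W U s ∅ ≤
      base ^ measure G W U := by
  have hcard : C.card ≤ 3 := by
    have := card_candidates_lt hR.subset hx hC
    have := hR.drop_le x hx
    omega
  interval_cases hn : C.card
  · rw [Finset.card_eq_zero.1 hn, Finset.sum_empty, add_zero]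
    exact pow_le_pow_right₀ one_le_base (measureAfter_le hR.subset hx)
  · obtain ⟨s, rfl⟩ := Finset.card_eq_one.1 hn
    obtain ⟨y, h⟩ := hC s (Finset.mem_singleton_self s)
    simpa using h.base_pow_add_le hR hx
  · exact base_pow_add_sum_le_of_card_eq_two hR hx hmax hS hC hn
  · exact base_pow_add_sum_le_of_card_eq_three hR hx hmax hS hC hn

end NoSurvivor

/-! ### Branching when some out-neighbour has no other undecided in-neighbour -/

section Survivor

variable (hR : Reduced G W U) (hx : x ∈ U)

include hR hx

theorem card_candidates_le_two {C : Finset V} (hne : (undNbrs G U x).Nonempty)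
    (hy : y ∈ outs G W x) (hC : ∀ s, s ∈ C ↔ Candidate G W U x y s) : C.card ≤ 2 := by
  by_contra! hcard
  obtain ⟨hyW, axy⟩ := mem_outs.1 hy
  have hxW := hR.subset hx
  have hIx := card_candidates_lt hR.subset hx fun s hs => ⟨y, (hC s).1 hs⟩
  have hRx := hR.bigR_eq_pair hx (outs_subset_bigR hy) axy.ne (by omega)
  have hyU : y ∈ U := by
    obtain ⟨v, hv⟩ := hne
    have hvR := undNbrs_subset_bigR hR.subset hxW hv
    rw [hRx, Finset.mem_insert, Finset.mem_singleton] at hvR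
    exact hvR.resolve_left (fun e => self_notMem_undNbrs (e ▸ hv)) ▸ (mem_undNbrs.1 hv).1
  have hxRy := pred_mem_bigR hyW hxW axy
  have hxC : x ∉ C := fun h => ((hC x).1 h).ne rfl
  have hIy : insert x C ⊆ interacting G W U y :=
    Finset.insert_subset (mem_interacting.2 ⟨hx, .inl hxRy⟩) fun s hs =>
      mem_interacting.2 ⟨((hC s).1 hs).mem, .inr ((hC s).1 hs).inReach.mem_bigR⟩
  have hIy := Finset.card_le_card hIy
  rw [Finset.card_insert_of_notMem hxC] at hIy
  have hRy := hR.bigR_eq_pair hyU hxRy axy.ne.symm (by omega)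
  obtain ⟨s, hs, hsy⟩ := Finset.exists_mem_ne (by omega : 1 < C.card) y
  obtain ⟨r, hr, hrx, hry, a | a⟩ := ((hC s).1 hs).exists_exit hsy
  · simpa [hRx, hrx, hry] using arc_mem_bigR hr a
  · simpa [hRy, hrx, hry] using arc_mem_bigR hr a

theorem measureAfter_left_add_twelve_le (hne : (undNbrs G U x).Nonempty) (hyU : y ∉ U)
    (h₁ : Candidate G W U x y s₁) (h₂ : Candidate G W U x y s₂) (h12 : s₁ ≠ s₂) :
    measureAfter G W U x ∅ + 12 ≤ measure G W U := by
  have hxW := hR.subset hx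
  obtain ⟨v, hv⟩ := hne
  have hI : 2 < (interacting G W U x).card := Finset.two_lt_card.2
    ⟨x, self_mem_interacting hR.subset hx, s₁, h₁.mem_interacting_left hR.subset hx,
      s₂, h₂.mem_interacting_left hR.subset hx, h₁.ne, h₂.ne, h12⟩
  have hbig : 2 < (bigR G W x).card := Finset.two_lt_card.2
    ⟨x, self_mem_bigR hxW, y, outs_subset_bigR h₁.mem_outs,
      v, undNbrs_subset_bigR hR.subset hxW hv, h₁.arc.ne, fun e => self_notMem_undNbrs (e ▸ hv),
      fun e => hyU (e ▸ (mem_undNbrs.1 hv).1)⟩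
  have := h₁.measureAfter_left_add_le hR hx
  omega

theorem Candidate.three_le_card_bigR (h : Candidate G W U x y s) (hsy : s ≠ y) :
    3 ≤ (bigR G W s).card :=
  Finset.two_lt_card.2 ⟨s, self_mem_bigR (hR.subset h.mem), x, h.mem_bigR (hR.subset hx),
    y, h.inReach.mem_bigR, h.ne.symm, hsy, h.arc.ne⟩

theorem Candidate.measureAfter_singleton_add_le (h₁ : Candidate G W U x y s₁)
    (h₂ : Candidate G W U x y s₂) :
    measureAfter G W U s₂ {s₁} +
        (3 * (insert s₁ (interacting G W U s₂)).card + (bigR G W s₂).card) ≤ measure G W U :=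
  hR.measureAfter_singleton_add_le h₂.mem (h₂.mem_interacting hR.subset hx) h₂.ne h₁.mem
    (h₁.mem_interacting hR.subset hx) h₁.ne

-- The first candidate leaves `s₂` free unless `s₂` interacts with a vertex other than `s₁`, `x`;
-- the latter makes the second branch more effective.
theorem measureAfter_candidates_add_le (hyU : y ∉ U) (h₁ : Candidate G W U x y s₁)
    (h₂ : Candidate G W U x y s₂) (h12 : s₁ ≠ s₂) :
    ∃ b c, measureAfter G W U s₁ ∅ + b ≤ measure G W U ∧
      measureAfter G W U s₂ {s₁} + c ≤ measure G W U ∧ ((b, c) = (12, 12) ∨ (b, c) = (9, 15)) := by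
  have hx₁ := h₁.mem_interacting hR.subset hx
  have hx₂ := h₂.mem_interacting hR.subset hx
  have hs₁ := self_mem_interacting (G := G) hR.subset h₁.mem
  have hs₂ := self_mem_interacting (G := G) hR.subset h₂.mem
  have hI₁ : 1 < (interacting G W U s₁).card := Finset.one_lt_card.2 ⟨s₁, hs₁, x, hx₁, h₁.ne.symm⟩
  have hI₂ : 2 < (insert s₁ (interacting G W U s₂)).card := Finset.two_lt_card.2
    ⟨s₁, by simp, x, by simp [hx₂], s₂, by simp [hs₂], h₁.ne.symm, h12, h₂.ne⟩
  have hR₁ := h₁.three_le_card_bigR hR hx fun e => hyU (e ▸ h₁.mem)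
  have hR₂ := h₂.three_le_card_bigR hR hx fun e => hyU (e ▸ h₂.mem)
  have hdrop₁ := h₁.measureAfter_add_le hR hx
  have hdrop₂ := h₁.measureAfter_singleton_add_le hR hx h₂
  by_cases h21 : s₂ ∈ interacting G W U s₁
  · have : 2 < (interacting G W U s₁).card := Finset.two_lt_card.2
      ⟨s₁, hs₁, x, hx₁, s₂, h21, h₁.ne.symm, h12, h₂.ne⟩
    exact ⟨12, 12, by omega, by omega, .inl rfl⟩
  by_cases hw : ∃ w ∈ interacting G W U s₂, w ≠ x ∧ w ≠ s₁ ∧ w ≠ s₂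
  · obtain ⟨w, hw, hwx, hw₁, hw₂⟩ := hw
    have : [s₁, x, s₂, w].length ≤ (insert s₁ (interacting G W U s₂)).card := by
      have := h₁.ne
      have := h₂.ne
      exact length_le_card (by grind) (by simp [hx₂, hs₂, hw])
    rw [List.length_cons, List.length_cons, List.length_cons, List.length_singleton] at this
    exact ⟨9, 15, by omega, by omega, .inr rfl⟩
  · push Not at hw
    have := hR.measureAfter_add_four_le h₁.mem hx₁ h₁.ne h₂.mem h21 hx₂ h₂.ne fun w hw' hw₂ => by
      by_cases hwx : w = x
      · exact hwx ▸ hx₁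
      · exact (not_imp_comm.1 (hw w hw' hwx) hw₂) ▸ hs₁
    exact ⟨12, 12, by omega, by omega, .inl rfl⟩

theorem base_pow_add_le_of_decided (hne : (undNbrs G U x).Nonempty) (hyU : y ∉ U)
    (h₁ : Candidate G W U x y s₁) (h₂ : Candidate G W U x y s₂) (h12 : s₁ ≠ s₂) :
    base ^ measureAfter G W U x ∅ + base ^ measureAfter G W U s₁ ∅ +
      base ^ measureAfter G W U s₂ {s₁} ≤ base ^ measure G W U := by
  have h₀ := measureAfter_left_add_twelve_le hR hx hne hyU h₁ h₂ h12
  obtain ⟨b, c, hb, hc, hbc | hbc⟩ := measureAfter_candidates_add_le hR hx hyU h₁ h₂ h12 <;>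
  · obtain ⟨rfl, rfl⟩ := Prod.mk.inj hbc
    exact base_pow_add_three_le h₀ hb hc (by norm_num [base])

section UndecidedNeighbour

variable (hyU : y ∈ U) (h : Candidate G W U x y s) (hsy : s ≠ y)

include hyU h hsy

theorem three_le_card_interacting_of_undecided : 3 ≤ (interacting G W U x).card ∧
    3 ≤ (interacting G W U y).card ∧ 3 ≤ (interacting G W U s).card := by
  have hyx : y ∈ interacting G W U x :=
    mem_interacting.2 ⟨hyU, .inl (outs_subset_bigR h.mem_outs)⟩
  have hys : y ∈ interacting G W U s := mem_interacting.2 ⟨hyU, .inl h.inReach.mem_bigR⟩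
  have hxs := h.mem_interacting hR.subset hx
  refine ⟨Finset.two_lt_card.2 ⟨x, self_mem_interacting hR.subset hx, y, hyx, s,
      mem_interacting_comm h.mem hxs, h.arc.ne, h.ne, hsy.symm⟩,
    Finset.two_lt_card.2 ⟨x, mem_interacting_comm hx hyx, y, self_mem_interacting hR.subset hyU, s,
      mem_interacting_comm h.mem hys, h.arc.ne, h.ne, hsy.symm⟩,
    Finset.two_lt_card.2 ⟨x, hxs, y, hys, s, self_mem_interacting hR.subset h.mem, h.arc.ne, h.ne,
      hsy.symm⟩⟩

theorem card_bigR_of_exists_out (hq : q ∈ outs G W s) (hqx : q ≠ x) :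
    4 ≤ (bigR G W s).card ∧ (3 ≤ (bigR G W x).card ∨ 3 ≤ (bigR G W y).card) := by
  have asq := (mem_outs.1 hq).2
  have hxW := hR.subset hx
  refine ⟨?_, ?_⟩
  · have hqy : q ≠ y := fun e => h.inReach.not_arc (e ▸ asq)
    have hsx := h.ne
    have hxy := h.arc.ne
    have hsq := asq.ne
    exact length_le_card (L := [s, x, y, q]) (by grind) (by
      simp [self_mem_bigR (hR.subset h.mem), h.mem_bigR hxW, h.inReach.mem_bigR,
        outs_subset_bigR hq])
  · obtain ⟨r, hr, hrx, hry, a | a⟩ := h.exists_exit hsy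
    · exact .inl (Finset.two_lt_card.2 ⟨x, self_mem_bigR hxW, y, outs_subset_bigR h.mem_outs,
        r, arc_mem_bigR hr a, h.arc.ne, hrx.symm, hry.symm⟩)
    · exact .inr (Finset.two_lt_card.2 ⟨y, self_mem_bigR (hR.subset hyU),
        x, pred_mem_bigR (hR.subset hyU) hxW h.arc, r, arc_mem_bigR hr a, h.arc.ne.symm, hry.symm,
        hrx.symm⟩)

theorem card_bigR_of_outs_subset (hout : outs G W s ⊆ {x})
    (hdom : ¬ outs G W s ⊆ outs G W y) :
    3 ≤ (bigR G W x).card ∧ 3 ≤ (bigR G W y).card := by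
  have hxW := hR.subset hx
  obtain ⟨q, hqs, hqy⟩ := Finset.not_subset.1 hdom
  obtain rfl := Finset.mem_singleton.1 (hout hqs)
  obtain ⟨r, hr, a⟩ := hR.exists_succ y (hR.subset hyU)
  refine ⟨Finset.two_lt_card.2 ⟨q, self_mem_bigR hxW, y, outs_subset_bigR h.mem_outs,
      s, pred_mem_bigR hxW (hR.subset h.mem) (mem_outs.1 hqs).2, h.arc.ne, h.ne, hsy.symm⟩,
    Finset.two_lt_card.2 ⟨y, self_mem_bigR (hR.subset hyU),
      q, pred_mem_bigR (hR.subset hyU) hxW h.arc, r, arc_mem_bigR hr a, h.arc.ne.symm, a.ne,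
      fun e => hqy (mem_outs.2 ⟨hxW, e ▸ a⟩)⟩⟩

theorem base_pow_add_le_of_undecided (hdom : ¬ outs G W s ⊆ outs G W y) {m₁ m₂ : ℕ}
    (hm₁ : m₁ + (3 * (interacting G W U y).card + (bigR G W y).card) ≤ measure G W U)
    (hm₂ : m₂ + (3 * (interacting G W U s).card + (bigR G W s).card) ≤ measure G W U) :
    base ^ measureAfter G W U x ∅ + base ^ m₁ + base ^ m₂ ≤ base ^ measure G W U := by
  obtain ⟨hIx, hIy, hIs⟩ := three_le_card_interacting_of_undecided hR hx hyU h hsy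
  have hdrop := h.measureAfter_left_add_le hR hx
  have hRx := h.two_le_card_bigR_left (hR.subset hx)
  have hRy : 1 < (bigR G W y).card := Finset.one_lt_card.2 ⟨y, self_mem_bigR (hR.subset hyU),
    x, pred_mem_bigR (hR.subset hyU) (hR.subset hx) h.arc, h.arc.ne.symm⟩
  have hRs := h.three_le_card_bigR hR hx hsy
  by_cases hout : outs G W s ⊆ {x}
  · obtain ⟨hRx', hRy'⟩ := card_bigR_of_outs_subset hR hx hyU h hsy hout hdom
    exact base_pow_add_three_le (a := 12) (b := 12) (c := 12) (by omega) (by omega) (by omega)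
      (by norm_num [base])
  · obtain ⟨q, hq, hqx⟩ := Finset.not_subset.1 hout
    obtain ⟨hRs', hRx' | hRy'⟩ := card_bigR_of_exists_out hR hx hyU h hsy hq (by simpa using hqx)
    · exact base_pow_add_three_le (a := 12) (b := 11) (c := 13) (by omega) (by omega) (by omega)
        (by norm_num [base])
    · exact base_pow_add_three_le (a := 11) (b := 12) (c := 13) (by omega) (by omega) (by omega)
        (by norm_num [base])

end UndecidedNeighbour

theorem base_pow_add_le_of_survivor (hne : (undNbrs G U x).Nonempty)
    (hpair : y ∈ U → y = s₁ ∨ y = s₂) (h₁ : Candidate G W U x y s₁)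
    (h₂ : Candidate G W U x y s₂) (h12 : s₁ ≠ s₂)
    (hd₁ : ¬ outs G W s₁ ⊆ outs G W s₂) (hd₂ : ¬ outs G W s₂ ⊆ outs G W s₁) :
    base ^ measureAfter G W U x ∅ + base ^ measureAfter G W U s₁ ∅ +
      base ^ measureAfter G W U s₂ {s₁} ≤ base ^ measure G W U := by
  by_cases hyU : y ∈ U
  · have hdrop₁ := h₁.measureAfter_add_le hR hx
    have hdrop₂ := h₁.measureAfter_singleton_add_le hR hx h₂
    have := Finset.card_le_card (Finset.subset_insert s₁ (interacting G W U s₂))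
    rcases hpair hyU with rfl | rfl
    · exact base_pow_add_le_of_undecided hR hx hyU h₂ h12.symm hd₂ hdrop₁ (by omega)
    · rw [add_right_comm]
      exact base_pow_add_le_of_undecided hR hx hyU h₁ h12 hd₁ (by omega) hdrop₁
  · exact base_pow_add_le_of_decided hR hx hne hyU h₁ h₂ h12

end Survivor

/-! ### Independent undecided vertices -/

theorem InReach.inReach_or_arc (h : InReach G W s v) (hz : InReach G W z s) (hsz : ¬ Arc G s z)
    (hsz' : ¬ InReach G W s z) : InReach G W z v ∨ Arc G z v := by
  have hzW : z ∈ W := (mem_sdiff_outs.1 hz.mem_right).1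
  induction h using InReach.induction_on with
  | self _ => exact .inl hz
  | head u w hu _ a hw ih =>
    by_cases hzu : Arc G z u
    · exact .inr hzu
    · exact .inl ((ih.resolve_right fun azw => hsz' (hw.head hzW hsz azw)).head hu hzu a)

section Independent

variable (hR : Reduced G W U) (hx : x ∈ U) (hind : ∀ u ∈ U, ∀ w ∈ U, ¬ Arc G u w)
  (h : Candidate G W U x y s)

include hR hx hind h

theorem eq_or_eq_of_mem_bigR (hy : ∀ u ∈ U, Arc G u y → u = x) (ht : t ∈ U)
    (htR : t ∈ bigR G W s) : t = x ∨ t = s := by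
  by_contra! hn
  obtain ⟨p, hp, asp⟩ := hR.exists_succ s (hR.subset h.mem)
  have hts : InReach G W s t := (mem_bigR.1 htR).2.resolve_left (hind s h.mem t ht)
  obtain ⟨d, atd, hdi⟩ : ∃ d, Arc G t d ∧ InReach G W s d := by
    obtain ⟨t', ht', d, -, atd, hds⟩ := Reaches.exists_exit (A := {t}) hts rfl hn.2.symm
    exact ⟨d, Set.mem_singleton_iff.1 ht' ▸ atd, hds⟩
  have hI : 2 < (interacting G W U s).card := Finset.two_lt_card.2
    ⟨s, self_mem_interacting hR.subset h.mem, x, h.mem_interacting hR.subset hx,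
      t, mem_interacting.2 ⟨ht, .inl htR⟩, h.ne.symm, hn.2.symm, hn.1.symm⟩
  have hbig : [x, s, t, y, p, d].length ≤ (bigR G W s).card := by
    refine length_le_card ?_ (by
      simp [h.mem_bigR (hR.subset hx), self_mem_bigR (hR.subset h.mem), htR, h.inReach.mem_bigR,
        arc_mem_bigR hp asp, hdi.mem_bigR])
    have hsU := h.mem
    have hyU : y ∉ U := fun hyU => hind x hx y hyU h.arc
    have hpU : p ∉ U := fun hpU => hind s h.mem p hpU asp
    have hdU : d ∉ U := fun hdU => hind t ht d hdU atd
    have hpy : p ≠ y := fun e => h.inReach.not_arc (e ▸ asp)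
    have hdy : d ≠ y := fun e => hn.1 (hy t ht (e ▸ atd))
    have hdp : d ≠ p := fun e => hdi.not_arc (e ▸ asp)
    have hne {v w : V} (hv : v ∈ U) (hw : w ∉ U) : v ≠ w := ne_of_mem_of_not_mem hv hw
    simp [h.ne, hn.1.symm, hn.2.symm, hne hx, hne hsU, hne ht, hyU, hpU, hdU, hpy.symm,
      hdy.symm, hdp.symm]
  have := hR.drop_le s h.mem
  simp only [List.length_cons] at hbig
  omega

theorem not_inReach_of_independent (hz : z ∈ U) (hzx : z ≠ x) (hzs : z ≠ s) (hp : Arc G s p)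
    (hzp : InReach G W z p) : ¬ InReach G W z y := fun hzy => by
  obtain ⟨n, hn, azn⟩ := hR.exists_succ z (hR.subset hz)
  have hxR := (hzy.head (hR.subset hx) (hind z hz x hx) h.arc).mem_bigR
  have hsR := (hzp.head (hR.subset h.mem) (hind z hz s h.mem) hp).mem_bigR
  have hI : 2 < (interacting G W U z).card := Finset.two_lt_card.2
    ⟨z, self_mem_interacting hR.subset hz, x, mem_interacting.2 ⟨hx, .inl hxR⟩,
      s, mem_interacting.2 ⟨h.mem, .inl hsR⟩, hzx, hzs, h.ne⟩
  have hbig : [z, x, s, y, p, n].length ≤ (bigR G W z).card := by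
    refine length_le_card ?_ (by
      simp [hxR, self_mem_bigR (hR.subset hz), hsR, hzy.mem_bigR, hzp.mem_bigR,
        arc_mem_bigR hn azn])
    have hsU := h.mem
    have hyU : y ∉ U := fun hyU => hind x hx y hyU h.arc
    have hpU : p ∉ U := fun hpU => hind s h.mem p hpU hp
    have hnU : n ∉ U := fun hnU => hind z hz n hnU azn
    have hpy : p ≠ y := fun e => h.inReach.not_arc (e ▸ hp)
    have hny : n ≠ y := fun e => hzy.not_arc (e ▸ azn)
    have hnp : n ≠ p := fun e => hzp.not_arc (e ▸ azn)
    have hne {v w : V} (hv : v ∈ U) (hw : w ∉ U) : v ≠ w := ne_of_mem_of_not_mem hv hw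
    simp [h.ne, hzx, hzs, hne hz, hne hx, hne hsU, hyU, hpU, hnU, hpy.symm, hny.symm, hnp.symm]
  have := hR.drop_le z hz
  simp only [List.length_cons] at hbig
  omega

-- If `s` survives without being a sink, it leads to a sink `z ∉ {x, s}`; as `z` does not interact
-- with `s` from inside `R(s)`, the whole of `R⁻(s)`, in particular `y`, then reaches `z`.
theorem Compatible.isSink_of_independent (hy : ∀ u ∈ U, Arc G u y → u = x)
    (hS : Compatible G W U S) (hxS : ¬ IsSink G (W \ S) x) : IsSink G (W \ S) s := by
  have hsW := hR.subset h.mem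
  by_contra hsS
  obtain ⟨p, hp, asp⟩ : ∃ p ∈ W \ S, Arc G s p := by
    by_contra! hn
    exact hsS ⟨Finset.mem_sdiff.2 ⟨hsW, hS.notMem_of_independent hR.not_isSink hind h.mem⟩, hn⟩
  obtain ⟨z, hz, hpz⟩ := hS.1.1.2 p hp
  have hzp : InReach G W z p := hpz.inReach hz
  have hzU := hS.mem_of_isSink hR.not_isSink hz
  have hzx : z ≠ x := fun e => hxS (e ▸ hz)
  have hzs : z ≠ s := fun e => hsS (e ▸ hz)
  have hsz : ¬ InReach G W s z := fun hi =>
    (eq_or_eq_of_mem_bigR hR hx hind h hy hzU hi.mem_bigR).elim hzx hzs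
  have hzs' : InReach G W z s := hzp.head hsW (hind z hzU s h.mem) asp
  exact not_inReach_of_independent hR hx hind h hzU hzx hzs asp hzp
    ((h.inReach.inReach_or_arc hzs' (hind s h.mem z hzU) hsz).resolve_right
      fun a => hzx (hy z hzU a))

end Independent
end Branching

/-! ### Costs of programs -/

section Programs

variable {α β : Type} {V : Type}

/-- The program `p` terminates with value `a` after at most `c` steps. -/
def Computes (p : Prog α) (a : α) (c : ℕ) : Prop :=
  ∀ t, ∃ t', p.run t = some (a, t') ∧ t' ≤ t + c

namespace Computes

theorem pure (a : α) (c : ℕ) : Computes (Pure.pure a : Prog α) a c := fun t =>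
  ⟨t, rfl, Nat.le_add_right _ _⟩

theorem tick : Computes KFVD.tick () 1 := fun t => ⟨t + 1, rfl, le_rfl⟩

theorem bind {p : Prog α} {f : α → Prog β} {a : α} {b : β} {c d : ℕ} (hp : Computes p a c)
    (hf : Computes (f a) b d) : Computes (p >>= f) b (c + d) := fun t => by
  obtain ⟨t', h, ht⟩ := hp t
  obtain ⟨t'', h', ht'⟩ := hf t'
  refine ⟨t'', ?_, by omega⟩
  rw [StateT.run_bind, h]
  exact h'

theorem mono {p : Prog α} {a : α} {c d : ℕ} (hp : Computes p a c) (h : c ≤ d) :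
    Computes p a d := fun t => by
  obtain ⟨t', h', ht⟩ := hp t
  exact ⟨t', h', by omega⟩

theorem bind_pure {p : Prog α} {f : α → β} {a : α} {c : ℕ} (hp : Computes p a c) :
    Computes (p >>= fun a => Pure.pure (f a)) (f a) c :=
  bind (f := fun a => Pure.pure (f a)) hp (pure (f a) 0)

theorem bind_le {p : Prog α} {f : α → Prog β} {a : α} {b : β} {c d e : ℕ} (hp : Computes p a c)
    (hf : Computes (f a) b d) (h : c + d ≤ e) : Computes (p >>= f) b e :=
  (bind hp hf).mono h

theorem bind_pow {p : Prog α} {f : α → Prog β} {a : α} {b : β} {B i j : ℕ} (k : ℕ) (hB : 2 ≤ B)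
    (hp : Computes p a (B ^ i)) (hf : Computes (f a) b (B ^ j)) (hi : i < k) (hj : j < k) :
    Computes (p >>= f) b (B ^ k) := by
  refine (bind hp hf).mono ?_
  obtain ⟨k, rfl⟩ : ∃ l, k = l + 1 := ⟨k - 1, by omega⟩
  have h1 : B ^ i ≤ B ^ k := Nat.pow_le_pow_right (by omega) (by omega)
  have h2 : B ^ j ≤ B ^ k := Nat.pow_le_pow_right (by omega) (by omega)
  rw [pow_succ]
  have h3 := Nat.mul_le_mul_left (B ^ k) hB
  omega

theorem pow_mono {p : Prog α} {a : α} {B i : ℕ} (k : ℕ) (hB : 2 ≤ B) (hp : Computes p a (B ^ i))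
    (hik : i ≤ k) : Computes p a (B ^ k) :=
  hp.mono (Nat.pow_le_pow_right (by omega) hik)

theorem tick_pow {B : ℕ} (k : ℕ) (hB : 2 ≤ B) : Computes KFVD.tick () (B ^ k) :=
  tick.mono (Nat.one_le_pow _ _ (by omega))

end Computes

theorem loop_cost {B k n : ℕ} (hB : 2 ≤ B) (hn : n + 1 ≤ B) :
    n * (B ^ k + 1) + 1 ≤ B ^ (k + 2) := by
  have h1 : 1 ≤ B ^ k := Nat.one_le_pow _ _ (by omega)
  have h2 : B ^ (k + 2) = B * (B * B ^ k) := by ring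
  have h3 : B ^ k + 1 ≤ B * B ^ k := by nlinarith
  rw [h2]
  calc n * (B ^ k + 1) + 1 ≤ (n + 1) * (B ^ k + 1) := by nlinarith
    _ ≤ B * (B * B ^ k) := Nat.mul_le_mul hn h3

theorem computes_filterP {p : V → Prog Bool} {q : V → Bool} {c : ℕ} {l : List V}
    (h : ∀ a ∈ l, Computes (p a) (q a) c) :
    Computes (filterP p l) (l.filter q) (l.length * (c + 1) + 1) := by
  induction l with
  | nil => exact Computes.bind_le (e := _ + 1) .tick (.pure [] 0) (by omega)
  | cons a l ih =>
    rw [List.filter_cons, filterP]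
    refine Computes.bind_le .tick (.bind (h a (by simp))
      (.bind_pure (f := fun r => if q a then a :: r else r) (ih fun b hb => h b (by simp [hb])))) ?_
    simp only [List.length_cons, add_mul]
    omega

theorem computes_findP {p : V → Prog Bool} {q : V → Bool} {c : ℕ} {l : List V}
    (h : ∀ a ∈ l, Computes (p a) (q a) c) :
    Computes (findP p l) (l.find? q) (l.length * (c + 1) + 1) := by
  induction l with
  | nil => exact Computes.bind_le (e := _ + 1) .tick (.pure none 0) (by omega)
  | cons a l ih =>
    have key : Computes (if q a then (pure (some a) : Prog (Option V)) else findP p l)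
        ((a :: l).find? q) (l.length * (c + 1) + 1) := by
      cases hq : q a
      · simpa [hq] using ih fun b hb => h b (by simp [hb])
      · simpa [hq] using Computes.pure (some a) _
    rw [findP]
    refine Computes.bind_le .tick (.bind (h a (by simp)) key) ?_
    simp only [List.length_cons, add_mul]
    omega

section Pow

variable {B k : ℕ} {l : List V}

theorem computes_filterP_pow {p : V → Prog Bool} {q : V → Bool} (hB : 2 ≤ B) (hl : l.length + 1 ≤ B)
    (h : ∀ a ∈ l, Computes (p a) (q a) (B ^ k)) :
    Computes (filterP p l) (l.filter q) (B ^ (k + 2)) :=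
  (computes_filterP h).mono (loop_cost hB hl)

theorem computes_findP_pow {p : V → Prog Bool} {q : V → Bool} (hB : 2 ≤ B) (hl : l.length + 1 ≤ B)
    (h : ∀ a ∈ l, Computes (p a) (q a) (B ^ k)) :
    Computes (findP p l) (l.find? q) (B ^ (k + 2)) :=
  (computes_findP h).mono (loop_cost hB hl)

theorem computes_anyP_pow {p : V → Prog Bool} {q : V → Bool} (hB : 2 ≤ B) (hl : l.length + 1 ≤ B)
    (h : ∀ a ∈ l, Computes (p a) (q a) (B ^ k)) :
    Computes (anyP p l) (l.any q) (B ^ (k + 2)) := by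
  have := (computes_findP_pow hB hl h).bind_pure (f := Option.isSome)
  rwa [List.isSome_find?] at this

theorem computes_allP_pow {p : V → Prog Bool} {q : V → Bool} (hB : 2 ≤ B) (hl : l.length + 1 ≤ B)
    (h : ∀ a ∈ l, Computes (p a) (q a) (B ^ k)) :
    Computes (allP p l) (l.all q) (B ^ (k + 2)) := by
  have := (computes_findP_pow (q := fun a => !q a) hB hl fun a ha =>
    (h a ha).bind_pure (f := not)).bind_pure (f := Option.isNone)
  rw [← Option.not_isSome, List.isSome_find?, List.not_any_eq_all_not] at this
  simp only [Bool.not_not] at this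
  exact this

theorem computes_lengthP (l : List V) : Computes (lengthP l) l.length (l.length + 1) := by
  induction l with
  | nil => exact Computes.bind_le (e := 1) .tick (.pure 0 0) (by omega)
  | cons a l ih =>
    exact Computes.bind_le .tick (.bind_pure (f := (· + 1)) ih)
      (by rw [List.length_cons]; omega)

theorem computes_lengthP_pow (hl : l.length + 1 ≤ B) : Computes (lengthP l) l.length (B ^ 1) :=
  (computes_lengthP l).mono (by rwa [pow_one])

theorem computes_appendP (l l' : List V) :
    Computes (appendP l l') (l ++ l') (l.length + 1) := by
  induction l with
  | nil => exact Computes.bind_le (e := 1) .tick (.pure l' 0) (by omega)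
  | cons a l ih =>
    exact Computes.bind_le .tick (.bind_pure (f := fun r => a :: r) ih)
      (by rw [List.length_cons]; omega)

theorem computes_appendP_pow {l' : List V} (hl : l.length + 1 ≤ B) :
    Computes (appendP l l') (l ++ l') (B ^ 1) :=
  (computes_appendP l l').mono (by rwa [pow_one])

theorem argmax_cons_cons (g : V → ℕ) (a b : V) (l : List V) :
    (a :: b :: l).argmax g = if g a < g b then (b :: l).argmax g else (a :: l).argmax g := by
  split_ifs with h <;> simp [List.argmax, List.argAux, h]

theorem computes_argmaxFrom {f : V → Prog ℕ} {g : V → ℕ} {c : ℕ} {a x : V}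
    (h : ∀ b ∈ l, Computes (f b) (g b) c) (hx : x ∈ (a :: l).argmax g) :
    Computes (argmaxFrom f a (g a) l) x (l.length * (c + 1) + 1) := by
  induction l generalizing a with
  | nil =>
    obtain rfl : a = x := by simpa using hx
    exact Computes.bind_le (e := _ + 1) .tick (.pure a 0) (by omega)
  | cons b l ih =>
    have key : Computes (if g a < g b then argmaxFrom f b (g b) l else argmaxFrom f a (g a) l) x
        (l.length * (c + 1) + 1) := by
      rw [argmax_cons_cons] at hx
      split_ifs at hx ⊢ <;> exact ih (fun d hd => h d (by simp [hd])) hx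
    rw [argmaxFrom]
    refine Computes.bind_le .tick (.bind (h b (by simp)) key) ?_
    simp only [List.length_cons, add_mul]
    omega

theorem computes_argmaxFrom_pow {f : V → Prog ℕ} {g : V → ℕ} {a x : V} (hB : 2 ≤ B)
    (hl : l.length + 1 ≤ B) (h : ∀ b ∈ l, Computes (f b) (g b) (B ^ k))
    (hx : x ∈ (a :: l).argmax g) : Computes (argmaxFrom f a (g a) l) x (B ^ (k + 2)) :=
  (computes_argmaxFrom h hx).mono (loop_cost hB hl)

variable [DecidableEq V]

theorem computes_sameP_pow (hB : 2 ≤ B) (u v : V) : Computes (sameP u v) (decide (u = v)) (B ^ 0) :=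
  Computes.bind_pure (f := fun _ => decide (u = v)) (.tick_pow 0 hB)

theorem computes_memP_pow (hB : 2 ≤ B) (hl : l.length + 1 ≤ B) (v : V) :
    Computes (memP v l) (decide (v ∈ l)) (B ^ 2) := by
  have h : decide (v ∈ l) = l.any fun a => decide (v = a) := by
    rw [Bool.eq_iff_iff]
    simp
  rw [h]
  exact computes_anyP_pow hB hl fun a _ => computes_sameP_pow hB v a

theorem computes_diffP_pow {l' : List V} (hB : 2 ≤ B) (hl : l.length + 1 ≤ B)
    (hl' : l'.length + 1 ≤ B) :
    Computes (diffP l l') (l.filter (· ∉ l')) (B ^ 4) := by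
  simp only [decide_not]
  exact computes_filterP_pow (l := l) hB hl fun a _ =>
    (computes_memP_pow hB hl' a).bind_pure (f := not)

theorem computes_interP_pow {l' : List V} (hB : 2 ≤ B) (hl : l.length + 1 ≤ B)
    (hl' : l'.length + 1 ≤ B) :
    Computes (interP l l') (l.filter (· ∈ l')) (B ^ 4) :=
  computes_filterP_pow (l := l) hB hl fun a _ => computes_memP_pow hB hl' a

end Pow

end Programs

/-! ### Instances and their procedures -/

namespace Inst

section Basic

variable {V : Type} {I : Inst V} {B : ℕ}

/-- The vertices of an instance, in the order in which `vertsP` lists them. -/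
def verts (I : Inst V) : List V := I.und ++ I.semi

/-- `I` is stored without repetitions, and `B` is large enough as the base of the cost bounds. -/
structure Fits (I : Inst V) (B : ℕ) : Prop where
  nodup : I.verts.Nodup
  size : 2 * I.verts.length + 2 ≤ B

theorem length_verts : I.verts.length = I.und.length + I.semi.length := List.length_append

namespace Fits

theorem two_le (h : I.Fits B) : 2 ≤ B := by
  have := h.size
  omega

theorem verts_lt (h : I.Fits B) : I.verts.length + 1 ≤ B := by
  have := h.size
  omega

theorem und_lt (h : I.Fits B) : I.und.length + 1 ≤ B := by
  have := h.verts_lt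
  rw [length_verts] at this
  omega

theorem semi_lt (h : I.Fits B) : I.semi.length + 1 ≤ B := by
  have := h.verts_lt
  rw [length_verts] at this
  omega

theorem nil_lt (h : I.Fits B) : ([] : List V).length + 1 ≤ B := by
  have := h.two_le
  rw [List.length_nil]
  omega

theorem und_nodup (h : I.Fits B) : I.und.Nodup := h.nodup.of_append_left

end Fits

end Basic

variable {V : Type} [DecidableEq V] {I : Inst V} {X : List V} {B : ℕ} {v : V}

/-- The vertex set of the digraph of an instance. -/
def vertSet (I : Inst V) : Finset V := I.verts.toFinset

/-- The set `U` of an instance. -/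
def undSet (I : Inst V) : Finset V := I.und.toFinset

/-- The instance computed by `deleteP`. -/
def delete (I : Inst V) (X : List V) : Inst V :=
  ⟨I.und.filter (· ∉ X), I.semi.filter (· ∉ X)⟩

/-- The instance computed by `lowerP`. -/
def lower (I : Inst V) (X : List V) : Inst V :=
  ⟨I.und.filter (· ∉ X), I.und.filter (· ∈ X) ++ I.semi⟩

theorem mem_vertSet : v ∈ I.vertSet ↔ v ∈ I.verts := List.mem_toFinset

theorem mem_undSet : v ∈ I.undSet ↔ v ∈ I.und := List.mem_toFinset

theorem undSet_subset : I.undSet ⊆ I.vertSet := fun _ hv =>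
  mem_vertSet.2 (List.mem_append_left _ (mem_undSet.1 hv))

theorem mem_vertSet_of_mem_und (hv : v ∈ I.und) : v ∈ I.vertSet :=
  undSet_subset (mem_undSet.2 hv)

theorem verts_delete : (I.delete X).verts = I.verts.filter (· ∉ X) := by
  simp [verts, delete]

theorem vertSet_delete : (I.delete X).vertSet = I.vertSet \ X.toFinset := by
  ext v
  simp [mem_vertSet, verts_delete]

theorem undSet_delete : (I.delete X).undSet = I.undSet \ X.toFinset := by
  ext v
  simp [mem_undSet, delete]

theorem verts_lower_perm : (I.lower X).verts.Perm I.verts := by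
  have h := List.filter_append_perm (fun v => decide (v ∉ X)) I.und
  simp only [decide_not, Bool.not_not] at h
  simpa [verts, lower] using h.append_right I.semi

theorem vertSet_lower : (I.lower X).vertSet = I.vertSet := by
  ext v
  simp only [mem_vertSet, verts_lower_perm.mem_iff]

theorem undSet_lower : (I.lower X).undSet = I.undSet \ X.toFinset := by
  ext v
  simp [mem_undSet, lower]

theorem Fits.delete (h : I.Fits B) (X : List V) : (I.delete X).Fits B := by
  refine ⟨?_, ?_⟩ <;> rw [verts_delete]
  · exact h.nodup.filter _
  · have := List.length_filter_le (fun v => decide (v ∉ X)) I.verts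
    have := h.size
    omega

theorem Fits.lower (h : I.Fits B) (X : List V) : (I.lower X).Fits B :=
  ⟨verts_lower_perm.nodup_iff.2 h.nodup, by rw [verts_lower_perm.length_eq]; exact h.size⟩

end Inst

section Procedures

theorem length_filter_lt {V : Type} {B : ℕ} {l : List V} (p : V → Bool) (h : l.length + 1 ≤ B) :
    (l.filter p).length + 1 ≤ B :=
  (Nat.succ_le_succ (List.length_filter_le p l)).trans h

theorem computes_or_pow {p r : Prog Bool} {a b : Bool} {B i : ℕ} (hB : 2 ≤ B)
    (hp : Computes p a (B ^ i)) (hr : Computes r b (B ^ i)) :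
    Computes (do let e ← p; if e then return true else r) (a || b) (B ^ (i + 1)) := by
  refine .bind_pow (i + 1) hB hp (j := i) ?_ (by omega) (by omega)
  cases a
  · simpa using hr
  · simpa using Computes.pure true _

theorem computes_vertsP_pow {V : Type} {I : Inst V} {B : ℕ} (h : I.Fits B) :
    Computes (vertsP I) I.verts (B ^ 1) :=
  computes_appendP_pow h.und_lt

variable {V : Type} [DecidableEq V] {G : Digraph V} [DecidableRel G.Adj]
variable {I : Inst V} {B : ℕ} {s t u v w x : V} {l L T X : List V}

instance : DecidableRel (Arc G) := fun u v => inferInstanceAs (Decidable (u ≠ v ∧ G.Adj u v))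

theorem computes_arcP_pow (hB : 2 ≤ B) (u v : V) :
    Computes (arcP G u v) (decide (Arc G u v)) (B ^ 0) :=
  .bind_pure (f := fun _ => decide (Arc G u v)) (.tick_pow 0 hB)

/-- The list computed for `N⁺(v)`. -/
def outList (G : Digraph V) [DecidableRel G.Adj] (I : Inst V) (v : V) : List V :=
  I.verts.filter fun w => decide (Arc G v w)

theorem mem_outList : w ∈ outList G I v ↔ w ∈ outs G I.vertSet v := by
  simp [outList, mem_outs, Inst.mem_vertSet]

theorem toFinset_outList : (outList G I v).toFinset = outs G I.vertSet v := by
  ext w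
  simp [mem_outList]

theorem length_outList (h : I.Fits B) : (outList G I v).length = (outs G I.vertSet v).card := by
  rw [← toFinset_outList]
  exact (List.toFinset_card_of_nodup (h.nodup.filter _)).symm

theorem outList_lt (h : I.Fits B) : (outList G I v).length + 1 ≤ B :=
  length_filter_lt _ h.verts_lt

theorem computes_outP_pow (h : I.Fits B) (v : V) :
    Computes (outP G I v) (outList G I v) (B ^ 3) :=
  .bind_pow 3 h.two_le (computes_vertsP_pow h)
    (computes_filterP_pow h.two_le h.verts_lt fun w _ => computes_arcP_pow h.two_le v w)
    (by omega) (by omega)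

theorem computes_outDegP_pow (h : I.Fits B) (s : V) :
    Computes (outDegP G I s) (outs G I.vertSet s).card (B ^ 4) := by
  rw [← length_outList h]
  exact .bind_pow 4 h.two_le (computes_outP_pow h s) (computes_lengthP_pow (outList_lt h))
    (by omega) (by omega)

theorem computes_inP_pow (h : I.Fits B) (v : V) :
    Computes (inP G I v) (I.verts.filter fun w => decide (Arc G w v)) (B ^ 3) :=
  .bind_pow 3 h.two_le (computes_vertsP_pow h)
    (computes_filterP_pow h.two_le h.verts_lt fun w _ => computes_arcP_pow h.two_le w v)
    (by omega) (by omega)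

theorem computes_undNbrsP_pow (h : I.Fits B) (v : V) : Computes (undNbrsP G I v)
    (I.und.filter fun w => decide (Arc G v w) || decide (Arc G w v)) (B ^ 3) :=
  computes_filterP_pow h.two_le h.und_lt fun w _ =>
    computes_or_pow h.two_le (computes_arcP_pow h.two_le v w) (computes_arcP_pow h.two_le w v)

theorem computes_undDegree_pow (h : I.Fits B) (v : V) :
    Computes (do let l ← undNbrsP G I v; lengthP l) (undNbrs G I.undSet v).card (B ^ 4) := by
  have e : undNbrs G I.undSet v =
      (I.und.filter fun w => decide (Arc G v w) || decide (Arc G w v)).toFinset := by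
    ext w
    simp [mem_undNbrs, Inst.mem_undSet]
  rw [e, List.toFinset_card_of_nodup (h.und_nodup.filter _)]
  exact .bind_pow 4 h.two_le (computes_undNbrsP_pow h v)
    (computes_lengthP_pow (length_filter_lt _ h.und_lt)) (by omega) (by omega)

section Grow

variable {avail R : List V}

/-- One round of the backward search of `growP`. -/
def growStep (G : Digraph V) [DecidableRel G.Adj] (avail R : List V) : List V :=
  avail.filter fun u => R.any fun w => decide (u = w) || decide (Arc G u w)

/-- The list computed by `growP`. -/
def growList (G : Digraph V) [DecidableRel G.Adj] (avail : List V) : ℕ → List V → List V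
  | 0, R => R
  | k + 1, R => growList G avail k (growStep G avail R)

theorem mem_growStep : u ∈ growStep G avail R ↔ u ∈ avail ∧ ∃ w ∈ R, u = w ∨ Arc G u w := by
  simp [growStep]

theorem reaches_of_mem_growStep (hR : ∀ u ∈ R, Reaches G avail.toFinset u v)
    (hu : u ∈ growStep G avail R) : Reaches G avail.toFinset u v := by
  obtain ⟨ha, w, hw, rfl | a⟩ := mem_growStep.1 hu
  · exact hR u hw
  · exact (hR w hw).head (List.mem_toFinset.2 ha) a

theorem reaches_of_mem_growList {k : ℕ} (hR : ∀ u ∈ R, Reaches G avail.toFinset u v)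
    (hu : u ∈ growList G avail k R) : Reaches G avail.toFinset u v := by
  induction k generalizing R with
  | zero => exact hR u hu
  | succ k ih => exact ih (fun _ => reaches_of_mem_growStep hR) hu

theorem mem_growStep_of_mem (hR : ∀ u ∈ R, u ∈ avail) (hu : u ∈ R) : u ∈ growStep G avail R :=
  mem_growStep.2 ⟨hR u hu, u, hu, .inl rfl⟩

theorem mem_growList_of_mem {k : ℕ} (hR : ∀ u ∈ R, u ∈ avail) (hu : u ∈ R) :
    u ∈ growList G avail k R := by
  induction k generalizing R with
  | zero => exact hu
  | succ _ ih => exact ih (fun _ hw => (mem_growStep.1 hw).1) (mem_growStep_of_mem hR hu)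

theorem mem_of_growStep_subset (hv : v ∈ R) (hR : growStep G avail R ⊆ R)
    (hu : Reaches G avail.toFinset u v) : u ∈ R := by
  induction hu using Reaches.head_induction_on with
  | refl _ => exact hv
  | head p q hp a _ ih => exact hR (mem_growStep.2 ⟨List.mem_toFinset.1 hp, q, ih, .inr a⟩)

theorem mem_growList_of_reaches {k : ℕ} (hv : v ∈ R) (hR : ∀ u ∈ R, u ∈ avail)
    (hk : avail.toFinset.card ≤ R.toFinset.card + k) (hu : Reaches G avail.toFinset u v) :
    u ∈ growList G avail k R := by
  induction k generalizing R with
  | zero =>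
    have hsub : R.toFinset ⊆ avail.toFinset := fun w hw =>
      List.mem_toFinset.2 (hR w (List.mem_toFinset.1 hw))
    exact List.mem_toFinset.1 (Finset.eq_of_subset_of_card_le hsub hk ▸ hu.mem_left)
  | succ k ih =>
    by_cases hstable : growStep G avail R ⊆ R
    · exact mem_growList_of_mem hR (mem_of_growStep_subset hv hstable hu)
    · refine ih (mem_growStep_of_mem hR hv) (fun _ hw => (mem_growStep.1 hw).1) ?_
      have : R.toFinset.card < (growStep G avail R).toFinset.card :=
        Finset.card_lt_card ⟨fun w hw => List.mem_toFinset.2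
          (mem_growStep_of_mem hR (List.mem_toFinset.1 hw)), fun h => hstable fun w hw =>
            List.mem_toFinset.1 (h (List.mem_toFinset.2 hw))⟩
      omega

theorem length_growList_le {k n : ℕ} (ha : avail.length ≤ n) (hR : R.length ≤ n) :
    (growList G avail k R).length ≤ n := by
  induction k generalizing R with
  | zero => exact hR
  | succ _ ih => exact ih ((List.length_filter_le _ _).trans ha)

theorem computes_growP (hB : 2 ≤ B) (ha : avail.length + 1 ≤ B) (k : ℕ) (hR : R.length + 1 ≤ B) :
    Computes (growP G avail k R) (growList G avail k R) (k * (B ^ 5 + 1) + 1) := by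
  induction k generalizing R with
  | zero => exact .bind_le (e := _ + 1) .tick (.pure R 0) (by omega)
  | succ k ih =>
    rw [growP]
    refine .bind_le .tick (.bind (a := growStep G avail R) (c := B ^ 5) ?_
      (ih (length_filter_lt _ ha))) (by rw [add_mul]; omega)
    exact computes_filterP_pow hB ha fun u _ => computes_anyP_pow hB hR fun w _ =>
      computes_or_pow hB (computes_sameP_pow hB u w) (computes_arcP_pow hB u w)

end Grow

/-- The list computed for `R⁻(v)`. -/
def inReachList (G : Digraph V) [DecidableRel G.Adj] (I : Inst V) (v : V) : List V :=
  growList G (I.verts.filter (· ∉ outList G I v)) I.verts.length [v]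

theorem mem_inReachList (hv : v ∈ I.vertSet) :
    u ∈ inReachList G I v ↔ InReach G I.vertSet v u := by
  have havail : (I.verts.filter (· ∉ outList G I v)).toFinset = I.vertSet \ outs G I.vertSet v := by
    ext u
    simp [mem_outList, Inst.mem_vertSet]
  have hself : Reaches G (I.verts.filter (· ∉ outList G I v)).toFinset v v := by
    rw [havail]
    exact InReach.self hv
  rw [InReach, ← havail]
  refine ⟨reaches_of_mem_growList (by simpa using hself),
    mem_growList_of_reaches (by simp) (by simpa using hself.mem_left) ?_⟩
  exact ((List.toFinset_card_le _).trans (List.length_filter_le _ _)).trans (Nat.le_add_left _ _)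

theorem length_inReachList_le : (inReachList G I v).length ≤ I.verts.length + 1 :=
  length_growList_le ((List.length_filter_le _ _).trans (Nat.le_succ _)) (Nat.le_add_left _ _)

theorem inReachList_lt (h : I.Fits B) : (inReachList G I v).length + 1 ≤ B := by
  have := length_inReachList_le (G := G) (I := I) (v := v)
  have := h.size
  omega

theorem computes_inReachP_pow (h : I.Fits B) (v : V) :
    Computes (inReachP G I v) (inReachList G I v) (B ^ 11) := by
  have hB := h.two_le
  refine .bind_pow 11 hB (computes_vertsP_pow h) (j := 10) ?_ (by omega) (by omega)
  refine .bind_pow 10 hB (computes_outP_pow h v) (j := 9) ?_ (by omega) (by omega)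
  refine .bind_pow 9 hB (computes_diffP_pow hB h.verts_lt (outList_lt h)) (j := 8) ?_
    (by omega) (by omega)
  refine .bind_pow 8 hB (computes_lengthP_pow h.verts_lt) (j := 7) ?_ (by omega) (by omega)
  exact (computes_growP hB (length_filter_lt _ h.verts_lt) _ (R := [v]) hB).mono
    (loop_cost hB h.verts_lt)

/-- The list computed for `R(v)`. -/
def bigRList (G : Digraph V) [DecidableRel G.Adj] (I : Inst V) (v : V) : List V :=
  outList G I v ++ inReachList G I v

theorem mem_bigRList (hv : v ∈ I.vertSet) : u ∈ bigRList G I v ↔ u ∈ bigR G I.vertSet v := by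
  rw [bigRList, List.mem_append, mem_outList, mem_inReachList hv, mem_outs, mem_bigR]
  exact ⟨fun h => h.elim (fun h => ⟨h.1, .inl h.2⟩) fun h => ⟨h.mem, .inr h⟩,
    fun h => h.2.imp (fun a => ⟨h.1, a⟩) id⟩

theorem toFinset_bigRList (hv : v ∈ I.vertSet) :
    (bigRList G I v).toFinset = bigR G I.vertSet v := by
  ext u
  rw [List.mem_toFinset, mem_bigRList hv]

theorem bigRList_lt (h : I.Fits B) : (bigRList G I v).length + 1 ≤ B := by
  have : (outList G I v).length ≤ I.verts.length := List.length_filter_le _ _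
  have := length_inReachList_le (G := G) (I := I) (v := v)
  have := h.size
  rw [bigRList, List.length_append]
  omega

theorem computes_bigRP_pow (h : I.Fits B) (v : V) :
    Computes (bigRP G I v) (bigRList G I v) (B ^ 13) := by
  refine .bind_pow 13 h.two_le (computes_outP_pow h v) (j := 12) ?_ (by omega) (by omega)
  exact .bind_pow 12 h.two_le (computes_inReachP_pow h v) (computes_appendP_pow (outList_lt h))
    (by omega) (by omega)

/-- The list computed for `R⁺(v)`. -/
def outReachList (G : Digraph V) [DecidableRel G.Adj] (I : Inst V) (v : V) : List V :=
  I.und.filter fun u => decide (v ∈ inReachList G I u)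

theorem mem_outReachList : u ∈ outReachList G I v ↔ u ∈ I.undSet ∧ InReach G I.vertSet u v := by
  rw [outReachList, List.mem_filter, decide_eq_true_eq, Inst.mem_undSet]
  exact and_congr_right fun hu => mem_inReachList (Inst.mem_vertSet_of_mem_und hu)

theorem outReachList_lt (h : I.Fits B) : (outReachList G I v).length + 1 ≤ B :=
  length_filter_lt _ h.und_lt

theorem computes_outReachP_pow (h : I.Fits B) (v : V) :
    Computes (outReachP G I v) (outReachList G I v) (B ^ 14) :=
  computes_filterP_pow h.two_le h.und_lt fun u _ =>
    .bind_pow 12 h.two_le (computes_inReachP_pow h u)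
      (computes_memP_pow h.two_le (inReachList_lt h) v) (by omega) (by omega)

theorem card_bigR_eq (h : I.Fits B) (hx : x ∈ I.vertSet) : (bigR G I.vertSet x).card =
    (I.und.filter (· ∈ bigRList G I x)).length + (I.semi.filter (· ∈ bigRList G I x)).length := by
  have hn : (I.verts.filter (· ∈ bigRList G I x)).Nodup := h.nodup.filter _
  rw [← List.length_append, ← List.filter_append, ← Inst.verts, ← List.toFinset_card_of_nodup hn]
  congr 1
  ext v
  simp only [List.mem_toFinset, List.mem_filter, decide_eq_true_eq, mem_bigRList hx]
  exact ⟨fun h => ⟨Inst.mem_vertSet.1 (bigR_subset h), h⟩, fun h => h.2⟩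

theorem card_interacting_eq (h : I.Fits B) (hx : x ∈ I.vertSet) :
    (interacting G I.vertSet I.undSet x).card = (I.und.filter (· ∈ bigRList G I x)).length +
      ((outReachList G I x).filter (· ∉ bigRList G I x)).length := by
  have hn : ((outReachList G I x).filter (· ∉ bigRList G I x)).Nodup :=
    (h.und_nodup.filter _).filter _
  rw [← List.toFinset_card_of_nodup (h.und_nodup.filter _), ← List.toFinset_card_of_nodup hn,
    ← Finset.card_union_of_disjoint]
  · congr 1
    ext v
    simp only [mem_interacting_iff Inst.undSet_subset hx, Finset.mem_union, List.mem_toFinset,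
      List.mem_filter, decide_eq_true_eq, mem_bigRList hx, mem_outReachList, Inst.mem_undSet]
    tauto
  · rw [Finset.disjoint_left]
    intro v hv hv'
    simp only [List.mem_toFinset, List.mem_filter, decide_eq_true_eq] at hv hv'
    exact hv'.2 hv.2

theorem computes_dropP_pow (h : I.Fits B) (hx : x ∈ I.vertSet) : Computes (dropP G I x)
    (3 * (interacting G I.vertSet I.undSet x).card + (bigR G I.vertSet x).card) (B ^ 18) := by
  have hB := h.two_le
  set r := bigRList G I x
  have hrB : r.length + 1 ≤ B := bigRList_lt h
  have e : 3 * (interacting G I.vertSet I.undSet x).card + (bigR G I.vertSet x).card =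
      4 * (I.und.filter (· ∈ r)).length + (I.semi.filter (· ∈ r)).length +
        3 * ((outReachList G I x).filter (· ∉ r)).length := by
    rw [card_interacting_eq h hx, card_bigR_eq h hx]
    ring
  rw [e]
  refine .bind_pow 18 hB (computes_bigRP_pow h x) (j := 17) ?_ (by omega) (by omega)
  refine .bind_pow 17 hB (computes_interP_pow hB h.und_lt hrB) (j := 16) ?_ (by omega) (by omega)
  refine .bind_pow 16 hB (computes_interP_pow hB h.semi_lt hrB) (j := 15) ?_ (by omega) (by omega)
  refine .bind_pow 15 hB (computes_outReachP_pow h x) (j := 14) ?_ (by omega) (by omega)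
  refine .bind_pow 14 hB (computes_diffP_pow hB (outReachList_lt h) hrB) (j := 13) ?_
    (by omega) (by omega)
  refine .bind_pow 13 hB (computes_lengthP_pow (length_filter_lt _ h.und_lt)) (j := 12) ?_
    (by omega) (by omega)
  refine .bind_pow 12 hB (computes_lengthP_pow (length_filter_lt _ h.semi_lt)) (j := 11) ?_
    (by omega) (by omega)
  refine .bind_pow 11 hB (computes_lengthP_pow (length_filter_lt _ (outReachList_lt h))) (j := 10)
    ?_ (by omega) (by omega)
  exact .bind_pow 10 hB (.tick_pow 0 hB) (.pure _ (B ^ 0)) (by omega) (by omega)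

/-- The list computed for the surviving set. -/
def survivingList (G : Digraph V) [DecidableRel G.Adj] (I : Inst V) (x : V) : List V :=
  (outList G I x).filter fun u => I.und.all fun w => decide (w = x) || !decide (Arc G w u)

theorem mem_survivingList : u ∈ survivingList G I x ↔
    u ∈ outs G I.vertSet x ∧ ∀ w ∈ I.undSet, Arc G w u → w = x := by
  simp only [survivingList, List.mem_filter, mem_outList, List.all_eq_true, Bool.or_eq_true,
    decide_eq_true_eq, Bool.not_eq_true', decide_eq_false_iff_not, Inst.mem_undSet]
  exact and_congr_right fun _ => forall₂_congr fun w _ => by tauto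

theorem computes_survivingP_pow (h : I.Fits B) (x : V) :
    Computes (survivingP G I x) (survivingList G I x) (B ^ 6) := by
  have hB := h.two_le
  refine .bind_pow 6 hB (computes_outP_pow h x) (j := 5) ?_ (by omega) (by omega)
  exact computes_filterP_pow hB (outList_lt h) fun u _ =>
    computes_allP_pow hB h.und_lt fun w _ =>
      computes_or_pow hB (computes_sameP_pow hB w x)
        (.bind_pure (f := not) (computes_arcP_pow hB w u))

/-- The list computed for the candidate sinks. -/
def candidateList (G : Digraph V) [DecidableRel G.Adj] (I : Inst V) (x : V) : List V :=
  I.und.filter fun u => (outList G I x).any fun y => decide (y ∈ inReachList G I u)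

theorem mem_candidateList : s ∈ candidateList G I x ↔
    ∃ y, Candidate G I.vertSet I.undSet x y s := by
  simp only [candidateList, List.mem_filter, List.any_eq_true, decide_eq_true_eq]
  constructor
  · rintro ⟨hs, y, hy, hr⟩
    exact ⟨y, mem_outList.1 hy, Inst.mem_undSet.2 hs,
      (mem_inReachList (Inst.mem_vertSet_of_mem_und hs)).1 hr⟩
  · rintro ⟨y, h⟩
    exact ⟨Inst.mem_undSet.1 h.mem, y, mem_outList.2 h.mem_outs,
      (mem_inReachList (Inst.undSet_subset h.mem)).2 h.inReach⟩

theorem computes_candidatesP_pow (h : I.Fits B) (x : V) :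
    Computes (candidatesP G I x) (candidateList G I x) (B ^ 15) := by
  have hB := h.two_le
  refine .bind_pow 15 hB (computes_outP_pow h x) (j := 14) ?_ (by omega) (by omega)
  exact computes_filterP_pow hB h.und_lt fun u _ =>
    .bind_pow 12 hB (computes_inReachP_pow h u)
      (computes_anyP_pow hB (outList_lt h) fun y _ => computes_memP_pow hB (inReachList_lt h) y)
      (by omega) (by omega)

theorem computes_deleteP_pow (h : I.Fits B) (hX : X.length + 1 ≤ B) :
    Computes (deleteP I X) (I.delete X) (B ^ 6) := by
  have hB := h.two_le
  refine .bind_pow 6 hB (computes_diffP_pow hB h.und_lt hX) (j := 5) ?_ (by omega) (by omega)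
  exact .bind_pow 5 hB (computes_diffP_pow hB h.semi_lt hX) (.pure _ (B ^ 0)) (by omega) (by omega)

theorem computes_lowerP_pow (h : I.Fits B) (hX : X.length + 1 ≤ B) :
    Computes (lowerP I X) (I.lower X) (B ^ 7) := by
  have hB := h.two_le
  refine .bind_pow 7 hB (computes_diffP_pow hB h.und_lt hX) (j := 6) ?_ (by omega) (by omega)
  refine .bind_pow 6 hB (computes_interP_pow hB h.und_lt hX) (j := 5) ?_ (by omega) (by omega)
  exact .bind_pow 5 hB (computes_appendP_pow (length_filter_lt _ h.und_lt)) (.pure _ (B ^ 0))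
    (by omega) (by omega)

/-- The instance computed by `updateSinkP`: `s` is made a sink, and `T` is lowered. -/
def afterSink (G : Digraph V) [DecidableRel G.Adj] (I : Inst V) (s : V) (T : List V) : Inst V :=
  ((I.delete (bigRList G I s)).lower (outReachList G I s)).lower T

theorem fits_afterSink (h : I.Fits B) (s : V) (T : List V) : (afterSink G I s T).Fits B :=
  ((h.delete _).lower _).lower _

theorem vertSet_afterSink (hs : s ∈ I.vertSet) :
    (afterSink G I s T).vertSet = I.vertSet \ bigR G I.vertSet s := by
  simp only [afterSink, Inst.vertSet_lower, Inst.vertSet_delete, toFinset_bigRList hs]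

theorem undSet_afterSink (hs : s ∈ I.vertSet) :
    (afterSink G I s T).undSet = undAfter G I.vertSet I.undSet s T.toFinset := by
  ext v
  simp only [afterSink, Inst.undSet_lower, Inst.undSet_delete, toFinset_bigRList hs, undAfter,
    Finset.mem_sdiff, Finset.mem_union, mem_interacting_iff Inst.undSet_subset hs,
    List.mem_toFinset, mem_outReachList]
  tauto

theorem computes_updateSinkP_pow (h : I.Fits B) (s : V) (hT : T.length + 1 ≤ B) :
    Computes (updateSinkP G I s T) (afterSink G I s T) (B ^ 16) := by
  have hB := h.two_le
  refine .bind_pow 16 hB (computes_bigRP_pow h s) (j := 15) ?_ (by omega) (by omega)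
  refine .bind_pow 15 hB (computes_outReachP_pow h s) (j := 9) ?_ (by omega) (by omega)
  refine .bind_pow 9 hB (computes_deleteP_pow h (bigRList_lt h)) (j := 8) ?_ (by omega) (by omega)
  exact .bind_pow 8 hB (computes_lowerP_pow (h.delete _) (outReachList_lt h))
    (computes_lowerP_pow ((h.delete _).lower _) hT) (by omega) (by omega)

/-- The vertex that one iteration of `pruneP` removes: the first `t ≠ s` in `L` with
`N⁺(s) ⊆ N⁺(t)`. -/
def findDominated (G : Digraph V) [DecidableRel G.Adj] (I : Inst V) (s : V) (L : List V) :
    Option V :=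
  L.find? fun t => !decide (s = t) && (outList G I s).all fun w => decide (w ∈ outList G I t)

/-- One iteration of `pruneP`. -/
def pruneStep (G : Digraph V) [DecidableRel G.Adj] (I : Inst V) (L : List V) (s : V) : List V :=
  if s ∈ L then L.filter (· ∉ findDominated G I s L) else L

/-- The list computed by `pruneP`. -/
def pruneList (G : Digraph V) [DecidableRel G.Adj] (I : Inst V) (l L : List V) : List V :=
  l.foldl (pruneStep G I) L

theorem findDominated_prop : (!decide (s = t) &&
      (outList G I s).all fun w => decide (w ∈ outList G I t)) = true ↔
    t ≠ s ∧ outs G I.vertSet s ⊆ outs G I.vertSet t := by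
  simp only [Bool.and_eq_true, Bool.not_eq_true', decide_eq_false_iff_not, List.all_eq_true,
    decide_eq_true_eq, mem_outList]
  exact and_congr_left' ne_comm

theorem mem_of_findDominated_eq_some (h : findDominated G I s L = some t) : t ∈ L :=
  List.mem_of_find?_eq_some h

theorem outs_subset_of_findDominated_eq_some (h : findDominated G I s L = some t) :
    t ≠ s ∧ outs G I.vertSet s ⊆ outs G I.vertSet t :=
  findDominated_prop.1 (by simpa only using List.find?_some h)

theorem pruneStep_sublist : (pruneStep G I L s).Sublist L := by
  rw [pruneStep]
  split_ifs
  exacts [List.filter_sublist, .refl L]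

theorem not_outs_subset_of_pruneStep_eq (h : pruneStep G I L s = L) (hs : s ∈ L) (ht : t ∈ L)
    (hts : t ≠ s) : ¬ outs G I.vertSet s ⊆ outs G I.vertSet t := fun hst => by
  rw [pruneStep, if_pos hs, List.filter_eq_self] at h
  cases hfind : findDominated G I s L with
  | none => exact List.find?_eq_none.1 hfind t ht (findDominated_prop.2 ⟨hts, hst⟩)
  | some t' => simpa [hfind] using h t' (mem_of_findDominated_eq_some hfind)

theorem exists_mem_pruneStep {Q : V → Prop}
    (hQ : ∀ s ∈ L, ∀ t ∈ L, outs G I.vertSet s ⊆ outs G I.vertSet t → Q t → Q s)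
    (h : ∃ t ∈ L, Q t) : ∃ t ∈ pruneStep G I L s, Q t := by
  obtain ⟨t, ht, hqt⟩ := h
  rw [pruneStep]
  split_ifs with hs
  · by_cases hfind : findDominated G I s L = some t
    · obtain ⟨hts, hst⟩ := outs_subset_of_findDominated_eq_some hfind
      exact ⟨s, by simpa [hfind, hs] using hts, hQ s hs t ht hst hqt⟩
    · exact ⟨t, by simpa [ht] using hfind, hqt⟩
  · exact ⟨t, ht, hqt⟩

theorem pruneList_sublist : (pruneList G I l L).Sublist L := by
  induction l generalizing L with
  | nil => exact .refl L
  | cons s l ih => exact ih.trans pruneStep_sublist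

theorem exists_mem_pruneList {Q : V → Prop}
    (hQ : ∀ s ∈ L, ∀ t ∈ L, outs G I.vertSet s ⊆ outs G I.vertSet t → Q t → Q s)
    (h : ∃ t ∈ L, Q t) : ∃ t ∈ pruneList G I l L, Q t := by
  induction l generalizing L with
  | nil => exact h
  | cons s _ ih =>
    have hsub : ∀ t ∈ pruneStep G I L s, t ∈ L := fun _ => pruneStep_sublist.mem
    exact ih (fun a ha b hb => hQ a (hsub a ha) b (hsub b hb)) (exists_mem_pruneStep hQ h)

theorem not_outs_subset_of_pruneList_eq (h : pruneList G I l L = L) (hsl : s ∈ l) (hs : s ∈ L)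
    (ht : t ∈ L) (hts : t ≠ s) : ¬ outs G I.vertSet s ⊆ outs G I.vertSet t := by
  induction l with
  | nil => simp at hsl
  | cons a l ih =>
    have hstep : pruneStep G I L a = L := pruneStep_sublist.antisymm
      (by nth_rewrite 1 [← h]; exact pruneList_sublist (l := l))
    rcases List.mem_cons.1 hsl with rfl | hsl
    · exact not_outs_subset_of_pruneStep_eq hstep hs ht hts
    · exact ih (by nth_rewrite 1 [← hstep]; exact h) hsl

theorem computes_findDominated_pow (h : I.Fits B) (hL : L.length + 1 ≤ B) (s : V) :
    Computes (findP (fun t => do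
        let e ← sameP s t
        if e then return false else
          let ot ← outP G I t
          allP (fun w => memP w ot) (outList G I s)) L) (findDominated G I s L) (B ^ 8) := by
  have hB := h.two_le
  refine computes_findP_pow (k := 6) hB hL fun t _ => ?_
  refine .bind_pow 6 hB (computes_sameP_pow hB s t) (j := 5) ?_ (by omega) (by omega)
  by_cases e : s = t
  · simpa [e] using Computes.pure false _
  · simp only [e, decide_false, Bool.not_false, Bool.true_and, Bool.false_eq_true, if_false]
    exact .bind_pow 5 hB (computes_outP_pow h t) (computes_allP_pow hB (outList_lt h) fun w _ =>
      computes_memP_pow hB (outList_lt h) w) (by omega) (by omega)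

theorem pow_two_add_pow_add_pow_le (hB : 2 ≤ B) : B ^ 2 + (B ^ 3 + (B ^ 8 + B ^ 4)) ≤ B ^ 10 := by
  have h₂ : B ^ 2 ≤ B ^ 8 := Nat.pow_le_pow_right (by omega) (by omega)
  have h₃ : B ^ 3 ≤ B ^ 8 := Nat.pow_le_pow_right (by omega) (by omega)
  have h₄ : B ^ 4 ≤ B ^ 8 := Nat.pow_le_pow_right (by omega) (by omega)
  have h₁₀ := Nat.mul_le_mul_right (B ^ 8) (Nat.pow_le_pow_left hB 2)
  rw [← pow_add, show 2 + 8 = 10 from rfl] at h₁₀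
  omega

theorem computes_pruneP_cons (h : I.Fits B) (hL : L.length + 1 ≤ B) {c : ℕ}
    (hl : Computes (pruneP G I l (pruneStep G I L s)) (pruneList G I l (pruneStep G I L s)) c) :
    Computes (pruneP G I (s :: l) L) (pruneList G I (s :: l) L) (B ^ 10 + 1 + c) := by
  have hB := h.two_le
  have hpow := pow_two_add_pow_add_pow_le hB
  rw [pruneP]
  change Computes _ (pruneList G I l (pruneStep G I L s)) _
  refine .bind_le .tick (.bind (d := B ^ 3 + (B ^ 8 + B ^ 4) + c) (computes_memP_pow hB hL s) ?_)
    (by omega)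
  by_cases hs : s ∈ L
  · simp only [hs, decide_true, if_true]
    refine .bind_le (computes_outP_pow h s)
      (.bind (d := B ^ 4 + c) (computes_findDominated_pow h hL s) ?_) (by omega)
    cases hfind : findDominated G I s L with
    | none =>
      rw [show pruneStep G I L s = L by simp [pruneStep, hfind]] at hl ⊢
      exact hl.mono (Nat.le_add_left _ _)
    | some t =>
      rw [show pruneStep G I L s = L.filter (· ∉ [t]) by simp [pruneStep, hs, hfind, eq_comm]]
        at hl ⊢
      exact .bind (computes_diffP_pow hB hL (l' := [t]) hB) hl
  · rw [show pruneStep G I L s = L by simp [pruneStep, hs]] at hl ⊢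
    simp only [hs, decide_false, Bool.false_eq_true, if_false]
    exact hl.mono (by omega)

theorem computes_pruneP (h : I.Fits B) (l : List V) (hL : L.length + 1 ≤ B) :
    Computes (pruneP G I l L) (pruneList G I l L) (l.length * (B ^ 10 + 1) + 1) := by
  induction l generalizing L with
  | nil => exact .bind_le (e := _ + 1) .tick (.pure L 0) (by omega)
  | cons s l ih =>
    refine (computes_pruneP_cons h hL (ih ?_)).mono (by rw [List.length_cons, add_mul]; omega)
    exact (Nat.succ_le_succ pruneStep_sublist.length_le).trans hL

theorem computes_pruneP_pow (h : I.Fits B) (hl : l.length + 1 ≤ B) (hL : L.length + 1 ≤ B) :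
    Computes (pruneP G I l L) (pruneList G I l L) (B ^ 12) :=
  (computes_pruneP h l hL).mono (loop_cost h.two_le hl)

end Procedures

section Recursion

/-! ### The recursion -/

/-- `p` returns a value with property `P` after at most `b` steps. -/
def RunsWithin {α : Type} (p : Prog α) (P : α → Prop) (b : ℝ) : Prop :=
  ∃ a c, Computes p a c ∧ P a ∧ (c : ℝ) ≤ b

/-- The bound on the time that one call of `kfvd` spends outside its recursive calls, up to a
constant factor. -/
def nodeCost (B : ℕ) : ℕ := B ^ 24

/-- The bound on the running time for an instance of weight less than `m` and measure `M`: a path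
of the search tree has at most `m` nodes, and every level has at most `base ^ M` of them. -/
noncomputable def timeBound (B m M : ℕ) : ℝ := 64 * nodeCost B * m * base ^ M

section Running

variable {α β : Type} {p : Prog α} {f : α → Prog β} {P : α → Prop} {Q : β → Prop} {a : α}
variable {B i m M : ℕ} {b b' : ℝ}

namespace RunsWithin

theorem pure (hP : P a) (hb : 0 ≤ b) : RunsWithin (Pure.pure a) P b :=
  ⟨a, 0, .pure a 0, hP, by simpa using hb⟩

theorem mono {P' : α → Prop} (h : RunsWithin p P b) (hP : ∀ a, P a → P' a) (hb : b ≤ b') :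
    RunsWithin p P' b' := by
  obtain ⟨a, c, hc, ha, hcb⟩ := h
  exact ⟨a, c, hc, hP a ha, hcb.trans hb⟩

theorem bind (hp : RunsWithin p P b') (hf : ∀ a, P a → RunsWithin (f a) Q (b - b')) :
    RunsWithin (p >>= f) Q b := by
  obtain ⟨a, c, hc, ha, hcb⟩ := hp
  obtain ⟨v, d, hd, hv, hdb⟩ := hf a ha
  refine ⟨v, c + d, hc.bind hd, hv, ?_⟩
  push_cast
  linarith

theorem bind_computes (hp : Computes p a (B ^ i)) (hB : 2 ≤ B)
    (hf : RunsWithin (f a) Q (b - nodeCost B)) (hi : i ≤ 24 := by omega) :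
    RunsWithin (p >>= f) Q b :=
  .bind (P := (· = a)) ⟨a, _, hp.pow_mono 24 hB hi, rfl, le_rfl⟩ fun _ h => by rwa [h]

theorem bind_tick {f : Unit → Prog β} (hB : 2 ≤ B)
    (hf : RunsWithin (f ()) Q (b - nodeCost B)) : RunsWithin (tick >>= f) Q b :=
  .bind_computes (.tick_pow 0 hB) hB hf

end RunsWithin

theorem timeBound_nonneg : 0 ≤ timeBound B m M := by
  have := base_pos
  unfold timeBound
  positivity

theorem timeBound_mono {M' : ℕ} (h : M' ≤ M) : timeBound B m M' ≤ timeBound B m M :=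
  mul_le_mul_of_nonneg_left (pow_le_pow_right₀ one_le_base h) (by positivity)

theorem timeBound_add_le_succ : timeBound B m M + 64 * nodeCost B ≤ timeBound B (m + 1) M := by
  have : 64 * (nodeCost B : ℝ) * 1 ≤ 64 * nodeCost B * base ^ M :=
    mul_le_mul_of_nonneg_left (one_le_pow₀ one_le_base) (by positivity)
  unfold timeBound
  push_cast
  linarith

theorem sum_timeBound_le {l : List ℕ} (h : (l.map (base ^ ·)).sum ≤ base ^ M) :
    (l.map (timeBound B m)).sum ≤ timeBound B m M := by
  have hmul : (l.map (timeBound B m)).sum = 64 * nodeCost B * m * (l.map (base ^ ·)).sum := by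
    simp only [← List.sum_map_mul_left]
    rfl
  rw [hmul]
  exact mul_le_mul_of_nonneg_left h (by positivity)

end Running

variable {V : Type} [DecidableEq V]

/-- `k` is the size of a solution for `I`, or larger, and no larger than any minimum solution that
satisfies `Q` and in which only undecided vertices become sinks. -/
def AnswersOn (G : Digraph V) (I : Inst V) (Q : Finset V → Prop) (k : ℕ) : Prop :=
  (∃ S, Sol G I.vertSet S ∧ S.card ≤ k) ∧
    ∀ S, Compatible G I.vertSet I.undSet S → Q S → k ≤ S.card

/-- The specification of `kfvd`. If every minimum solution has a semi-decided sink, the answer need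
only be at least the minimum size. -/
def Answers (G : Digraph V) (I : Inst V) : ℕ → Prop := AnswersOn G I fun _ => True

/-- The solutions for which the branch `KFVD(s, T)` is responsible. -/
def FirstSink (G : Digraph V) (W : Finset V) (s : V) (T : List V) (S : Finset V) : Prop :=
  IsSink G (W \ S) s ∧ ∀ t ∈ T, ¬ IsSink G (W \ S) t

section Answers

variable {G : Digraph V} {I : Inst V} {Q Q' : Finset V → Prop} {k k' : ℕ}

theorem AnswersOn.mono (h : AnswersOn G I Q k)
    (hQ : ∀ S, Compatible G I.vertSet I.undSet S → Q' S → Q S) : AnswersOn G I Q' k :=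
  ⟨h.1, fun S hS hSQ => h.2 S hS (hQ S hS hSQ)⟩

theorem AnswersOn.min (h : AnswersOn G I Q k) (h' : AnswersOn G I Q' k') :
    AnswersOn G I (fun S => Q S ∨ Q' S) (min k k') := by
  refine ⟨?_, fun S hS hSQ => hSQ.elim (fun hSQ => min_le_of_left_le (h.2 S hS hSQ))
    fun hSQ => min_le_of_right_le (h'.2 S hS hSQ)⟩
  rcases min_choice k k' with e | e <;> rw [e]
  exacts [h.1, h'.1]

theorem AnswersOn.answers (h : AnswersOn G I Q k)
    (hQ : ∀ S, Compatible G I.vertSet I.undSet S → Q S) : Answers G I k :=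
  h.mono fun S hS _ => hQ S hS

theorem firstSink_nil {W S : Finset V} {s : V} :
    FirstSink G W s [] S ↔ IsSink G (W \ S) s := by
  simp [FirstSink]

end Answers

/-- Four times the sum of the potentials. -/
def Inst.weight (I : Inst V) : ℕ := 3 * I.undSet.card + I.vertSet.card

section Weight

variable {I I' : Inst V} {x : V}

theorem weight_lt_of_notMem_vertSet (hW : I'.vertSet ⊆ I.vertSet) (hU : I'.undSet ⊆ I.undSet)
    (hx : x ∈ I.vertSet) (hx' : x ∉ I'.vertSet) : I'.weight < I.weight := by
  have h1 := Finset.card_lt_card (Finset.ssubset_iff_of_subset hW |>.2 ⟨x, hx, hx'⟩)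
  have h2 := Finset.card_le_card hU
  unfold Inst.weight
  omega

theorem weight_lt_of_notMem_undSet (hW : I'.vertSet ⊆ I.vertSet) (hU : I'.undSet ⊆ I.undSet)
    (hx : x ∈ I.undSet) (hx' : x ∉ I'.undSet) : I'.weight < I.weight := by
  have h1 := Finset.card_lt_card (Finset.ssubset_iff_of_subset hU |>.2 ⟨x, hx, hx'⟩)
  have h2 := Finset.card_le_card hW
  unfold Inst.weight
  omega

end Weight

/-- `kfvd` is correct and fast on the instances of weight less than `m`. -/
def SolvedBelow (G : Digraph V) [DecidableRel G.Adj] (B m : ℕ) : Prop :=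
  ∀ I : Inst V, I.Fits B → I.weight < m →
    RunsWithin (kfvd G I) (Answers G I) (timeBound B m (measure G I.vertSet I.undSet))

namespace SolvedBelow

variable {G : Digraph V} [DecidableRel G.Adj] {I : Inst V} {B m k : ℕ} {s x y : V} {T X : List V}

theorem runsWithin_delete (ih : SolvedBelow G B m) (h : I.Fits B) (hm : I.weight < m + 1)
    (hx : x ∈ I.vertSet) (hxX : x ∈ X) (hX : X.length + 1 ≤ B) :
    RunsWithin (do let I' ← deleteP I X; kfvd G I') (Answers G (I.delete X))
      (timeBound B m (measure G I.vertSet I.undSet) + nodeCost B) := by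
  refine .bind_computes (computes_deleteP_pow h hX) h.two_le ?_
  have hW : (I.delete X).vertSet ⊆ I.vertSet := by
    rw [Inst.vertSet_delete]
    exact Finset.sdiff_subset
  have hU : (I.delete X).undSet ⊆ I.undSet := by
    rw [Inst.undSet_delete]
    exact Finset.sdiff_subset
  have hlt : (I.delete X).weight < I.weight :=
    weight_lt_of_notMem_vertSet hW hU hx (by simp [Inst.vertSet_delete, hxX])
  refine (ih _ (h.delete X) (by omega)).mono (fun _ => id) ?_
  rw [add_sub_cancel_right]
  refine timeBound_mono (measure_mono hW hU (fun v hv hvW => ?_) Inst.undSet_subset)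
  rw [Inst.vertSet_delete, Finset.mem_sdiff] at hvW
  rw [Inst.undSet_delete]
  exact Finset.mem_sdiff.2 ⟨freeVerts_subset hv, hvW.2⟩

theorem runsWithin_source (ih : SolvedBelow G B m) (h : I.Fits B) (hm : I.weight < m + 1)
    (hx : x ∈ I.vertSet) (hsrc : ∀ w ∈ I.vertSet, ¬ Arc G w x) :
    RunsWithin (do let I' ← deleteP I [x]; kfvd G I') (Answers G I)
      (timeBound B m (measure G I.vertSet I.undSet) + nodeCost B) := by
  refine (ih.runsWithin_delete h hm hx (List.mem_singleton_self x) h.two_le).mono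
    (fun k ⟨⟨S, hS, hSk⟩, hcomp⟩ => ?_) le_rfl
  simp only [Inst.vertSet_delete, Inst.undSet_delete, List.toFinset_cons, List.toFinset_nil,
    insert_empty_eq, Finset.sdiff_singleton_eq_erase] at hS hcomp
  exact ⟨⟨S, hS.insert_source hsrc, hSk⟩, fun S hS _ =>
    (hcomp _ (hS.erase_source hsrc) trivial).trans Finset.card_erase_le⟩

theorem runsWithin_sink (ih : SolvedBelow G B m) (h : I.Fits B) (hm : I.weight < m + 1)
    (hx : IsSink G I.vertSet x) :
    RunsWithin (do let r ← bigRP G I x; let I' ← deleteP I r; kfvd G I') (Answers G I)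
      (timeBound B m (measure G I.vertSet I.undSet) + 2 * nodeCost B) := by
  have hxR : x ∈ bigRList G I x := (mem_bigRList hx.1).2 (self_mem_bigR hx.1)
  refine .bind_computes (computes_bigRP_pow h x) h.two_le ?_
  refine (ih.runsWithin_delete h hm hx.1 hxR (bigRList_lt h)).mono
    (fun k ⟨⟨S, hS, hSk⟩, hcomp⟩ => ?_) (by linarith)
  simp only [Inst.vertSet_delete, Inst.undSet_delete, toFinset_bigRList hx.1] at hS hcomp
  have hout : outs G I.vertSet x = ∅ := Finset.eq_empty_of_forall_notMem fun w hw =>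
    hx.2 w (mem_outs.1 hw).1 (mem_outs.1 hw).2
  refine ⟨⟨_, hS.lift hx.1, by simpa [hout] using hSk⟩, fun S hS _ => ?_⟩
  exact (hcomp _ (hS.restrict (hS.1.isSink_of_isSink hx) fun z hz _ hzR _ =>
    Finset.mem_sdiff.2 ⟨hz, hzR⟩) trivial).trans (Finset.card_le_card Finset.sdiff_subset)

theorem runsWithin_lower (ih : SolvedBelow G B m) (h : I.Fits B) (hm : I.weight < m + 1)
    (hx : x ∈ I.undSet) :
    RunsWithin (kfvd G (I.lower [x])) (AnswersOn G I fun S => ¬ IsSink G (I.vertSet \ S) x)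
      (timeBound B m (measure G I.vertSet (I.undSet.erase x))) := by
  have hU : (I.lower [x]).undSet = I.undSet.erase x := by
    simp [Inst.undSet_lower, Finset.sdiff_singleton_eq_erase]
  have hlt : (I.lower [x]).weight < I.weight :=
    weight_lt_of_notMem_undSet Inst.vertSet_lower.subset (hU ▸ Finset.erase_subset x _) hx
      (by simp [hU])
  have hrun := ih _ (h.lower [x]) (by omega)
  rw [Inst.vertSet_lower, hU] at hrun
  refine hrun.mono (fun k ⟨hatt, hcomp⟩ => ?_) le_rfl
  rw [Inst.vertSet_lower] at hatt hcomp
  rw [hU] at hcomp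
  exact ⟨hatt, fun S hS hxS => hcomp S (hS.erase_undecided hxS) trivial⟩

theorem runsWithin_afterSink (ih : SolvedBelow G B m) (h : I.Fits B) (hm : I.weight < m + 1)
    (hs : s ∈ I.undSet) (T : List V) :
    RunsWithin (kfvd G (afterSink G I s T))
      (fun a => AnswersOn G I (FirstSink G I.vertSet s T) (a + (outs G I.vertSet s).card))
      (timeBound B m (measureAfter G I.vertSet I.undSet s T.toFinset)) := by
  have hsW := Inst.undSet_subset hs
  have hW := vertSet_afterSink (G := G) (T := T) hsW
  have hU := undSet_afterSink (G := G) (T := T) hsW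
  have hlt : (afterSink G I s T).weight < I.weight :=
    weight_lt_of_notMem_vertSet (hW ▸ Finset.sdiff_subset) (hU ▸ undAfter_subset) hsW
      (by simp [hW, self_mem_bigR hsW])
  have hrun := ih (afterSink G I s T) (fits_afterSink h s T) (by omega)
  rw [hW, hU] at hrun
  refine hrun.mono (fun a ⟨⟨S', hS', hS'a⟩, hcomp⟩ => ?_) le_rfl
  rw [hW] at hS' hcomp
  rw [hU] at hcomp
  refine ⟨⟨_, hS'.lift hsW, ?_⟩, fun S hS ⟨hsS, hT⟩ => ?_⟩
  · rw [Finset.card_union_of_disjoint (disjoint_outs_of_subset_sdiff_bigR hS'.1)]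
    omega
  · have hcard := card_sdiff_bigR_add_card_outs_le hS.1.1.1 hsS
    have := hcomp _ (hS.restrict hsS fun z hz hzS hzR hzs => mem_undAfter.2 ⟨hz, fun hzI =>
      ((mem_interacting_iff Inst.undSet_subset hsW).1 hzI).2.elim hzR hzs, fun hzT =>
        hT z (List.mem_toFinset.1 hzT) hzS⟩) trivial
    omega

theorem runsWithin_branch_of_drop (ih : SolvedBelow G B m) (h : I.Fits B) (hm : I.weight < m + 1)
    (hx : x ∈ I.undSet) (hdrop : 15 ≤ 3 * (interacting G I.vertSet I.undSet x).card +
      (bigR G I.vertSet x).card) :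
    RunsWithin (do
      let I₁ ← updateSinkP G I x []
      let I₂ ← updateNonsinkP I [x]
      let d ← outDegP G I x
      let a ← kfvd G I₁
      let b ← kfvd G I₂
      tick
      return min (a + d) b) (Answers G I)
      (timeBound B m (measure G I.vertSet I.undSet) + 4 * nodeCost B) := by
  have hB := h.two_le
  refine .bind_computes (computes_updateSinkP_pow h x h.nil_lt) hB ?_
  refine .bind_computes (computes_lowerP_pow h h.two_le) hB ?_
  refine .bind_computes (computes_outDegP_pow h x) hB ?_
  refine .bind (ih.runsWithin_afterSink h hm hx []) fun a ha => ?_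
  refine .bind (ih.runsWithin_lower h hm hx) fun b hb => .bind_tick hB (.pure ?_ ?_)
  · exact (ha.min hb).answers fun S _ => by simpa only [firstSink_nil] using em _
  · have := sum_timeBound_le (B := B) (m := m) (l := [_, _])
      (by simpa using base_pow_measureAfter_add_erase_le Inst.undSet_subset hx hdrop)
    simp only [List.map_cons, List.map_nil, List.sum_cons, List.sum_nil, add_zero] at this
    rw [List.toFinset_nil]
    linarith

theorem runsWithin_candidateLoop (ih : SolvedBelow G B m) (h : I.Fits B) (hm : I.weight < m + 1)
    {Q : Finset V → Prop} (hk : AnswersOn G I Q k) (L : List V) (hL : ∀ s ∈ L, s ∈ I.undSet) :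
    RunsWithin (L.foldlM (fun m s => do
      tick
      let Is ← updateSinkP G I s []
      let d ← outDegP G I s
      let a ← kfvd G Is
      return min m (a + d)) k)
      (AnswersOn G I fun S => Q S ∨ ∃ s ∈ L, IsSink G (I.vertSet \ S) s)
      (L.length * (3 * nodeCost B) +
        ((L.map fun s => measureAfter G I.vertSet I.undSet s ∅).map (timeBound B m)).sum) := by
  have hB := h.two_le
  induction L generalizing k Q with
  | nil => exact .pure (hk.mono fun S _ => by simp) (by simp)
  | cons s L ih' =>
    have hs := hL s List.mem_cons_self
    rw [List.foldlM_cons]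
    refine .bind (P := AnswersOn G I fun S => Q S ∨ IsSink G (I.vertSet \ S) s)
      (b' := 3 * nodeCost B + timeBound B m (measureAfter G I.vertSet I.undSet s ∅)) ?_
      fun k' hk' => ?_
    · refine .bind_tick hB (.bind_computes (computes_updateSinkP_pow h s h.nil_lt) hB ?_)
      refine .bind_computes (computes_outDegP_pow h s) hB ?_
      refine .bind (ih.runsWithin_afterSink h hm hs []) fun a ha => .pure ?_ ?_
      · exact (hk.min ha).mono fun S _ => by simp only [firstSink_nil, imp_self]
      · rw [List.toFinset_nil]
        linarith
    · refine (ih' hk' fun t ht => hL t (List.mem_cons_of_mem s ht)).mono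
        (fun _ ha => ha.mono fun S _ => by simp [or_assoc]) ?_
      simp only [List.length_cons, List.map_cons, List.sum_cons]
      push_cast
      linarith

theorem runsWithin_of_surviving_eq_nil (ih : SolvedBelow G B m) (h : I.Fits B)
    (hm : I.weight < m + 1) (hR : Reduced G I.vertSet I.undSet) (hx : x ∈ I.undSet)
    (hmax : ∀ v ∈ I.undSet, (undNbrs G I.undSet v).card ≤ (undNbrs G I.undSet x).card)
    (hsurv : survivingList G I x = []) (hk : AnswersOn G I (FirstSink G I.vertSet x []) k) :
    RunsWithin (do
      let C ← candidatesP G I x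
      C.foldlM (fun m s => do
        tick
        let Is ← updateSinkP G I s []
        let d ← outDegP G I s
        let a ← kfvd G Is
        return min m (a + d)) k) (Answers G I)
      (timeBound B m (measure G I.vertSet I.undSet) -
        timeBound B m (measureAfter G I.vertSet I.undSet x ∅) + 10 * nodeCost B) := by
  have hS : ∀ y ∈ outs G I.vertSet x, ∃ u ∈ I.undSet, u ≠ x ∧ Arc G u y := fun y hy => by
    by_contra! hn
    have : y ∈ survivingList G I x := mem_survivingList.2
      ⟨hy, fun w hw a => by_contra fun hwx => hn w hw hwx a⟩
    simp [hsurv] at this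
  have hcand : ∀ s ∈ (candidateList G I x).toFinset, ∃ y, Candidate G I.vertSet I.undSet x y s :=
    fun s hs => mem_candidateList.1 (List.mem_toFinset.1 hs)
  have hnodup : (candidateList G I x).Nodup := h.und_nodup.filter _
  have hlen : ((candidateList G I x).length : ℝ) ≤ 3 := by
    have h1 := card_candidates_lt hR.subset hx hcand
    have h2 := hR.drop_le x hx
    rw [List.toFinset_card_of_nodup hnodup] at h1
    exact_mod_cast (by omega : (candidateList G I x).length ≤ 3)
  have htime := sum_timeBound_le (B := B) (m := m) (l := _ :: (candidateList G I x).map _) (by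
    simpa [List.sum_toFinset _ hnodup, Function.comp_def] using
      base_pow_measureAfter_add_sum_le hR hx hmax hS hcand)
  rw [List.map_cons, List.sum_cons] at htime
  refine .bind_computes (computes_candidatesP_pow h x) h.two_le ?_
  refine (ih.runsWithin_candidateLoop h hm hk _ fun s hs =>
    (hcand s (List.mem_toFinset.2 hs)).choose_spec.mem).mono
    (fun _ ha => ha.answers fun S hS => ?_) ?_
  · rw [firstSink_nil, or_iff_not_imp_left]
    intro hxS
    obtain ⟨z, hz, hzS, y, hy, hzy⟩ := hS.exists_candidate hR.not_isSink (hR.subset hx) hxS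
    exact ⟨z, mem_candidateList.2 ⟨y, hy, hz, hzy⟩, hzS⟩
  · have := mul_le_mul_of_nonneg_right hlen (show 0 ≤ 3 * (nodeCost B : ℝ) by positivity)
    linarith

end SolvedBelow

/-- The measures of the instances to which the calls `KFVD(s₁, T), KFVD(s₂, {s₁} ∪ T), …` lead. -/
noncomputable def branchMeasures (G : Digraph V) (W U : Finset V) : List V → List V → List ℕ
  | _, [] => []
  | T, s :: L => measureAfter G W U s T.toFinset :: branchMeasures G W U (s :: T) L

namespace SolvedBelow

variable {G : Digraph V} [DecidableRel G.Adj] {I : Inst V} {B m k : ℕ} {x y : V}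

theorem runsWithin_prunedLoop (ih : SolvedBelow G B m) (h : I.Fits B) (hm : I.weight < m + 1)
    {Q : Finset V → Prop} (hk : AnswersOn G I Q k) {T L : List V}
    (hTQ : ∀ S, Compatible G I.vertSet I.undSet S → (∃ t ∈ T, IsSink G (I.vertSet \ S) t) → Q S)
    (hL : ∀ s ∈ L, s ∈ I.undSet) (hTL : T.length + L.length ≤ B) :
    RunsWithin (L.foldlM (fun (m : ℕ × List V) s => do
      tick
      let Is ← updateSinkP G I s m.2
      let d ← outDegP G I s
      let a ← kfvd G Is
      return (min m.1 (a + d), s :: m.2)) (k, T))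
      (fun r => AnswersOn G I (fun S => Q S ∨ ∃ s ∈ L, IsSink G (I.vertSet \ S) s) r.1)
      (L.length * (3 * nodeCost B) +
        ((branchMeasures G I.vertSet I.undSet T L).map (timeBound B m)).sum) := by
  have hB := h.two_le
  induction L generalizing k Q T with
  | nil => exact .pure (hk.mono fun S _ => by simp) (by simp [branchMeasures])
  | cons s L ih' =>
    have hs := hL s List.mem_cons_self
    rw [List.length_cons] at hTL
    rw [List.foldlM_cons]
    refine .bind (P := fun r => r.2 = s :: T ∧
        AnswersOn G I (fun S => Q S ∨ IsSink G (I.vertSet \ S) s) r.1)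
      (b' := 3 * nodeCost B + timeBound B m (measureAfter G I.vertSet I.undSet s T.toFinset)) ?_ ?_
    · refine .bind_tick hB (.bind_computes (computes_updateSinkP_pow (T := T) h s (by omega)) hB ?_)
      refine .bind_computes (computes_outDegP_pow h s) hB ?_
      refine .bind (ih.runsWithin_afterSink h hm hs T) fun a ha => .pure ⟨rfl, ?_⟩ (by linarith)
      refine (hk.min ha).mono fun S hS hSs => or_iff_not_imp_left.2 fun hSQ => ?_
      exact ⟨hSs.resolve_left hSQ, fun t ht hts => hSQ (hTQ S hS ⟨t, ht, hts⟩)⟩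
    · rintro ⟨k', _⟩ ⟨rfl, hk'⟩
      refine (ih' hk' (fun S hS => ?_) (fun t ht => hL t (List.mem_cons_of_mem s ht))
        (by rw [List.length_cons]; omega)).mono
        (fun _ ha => ha.mono fun S _ => by simp [or_assoc]) ?_
      · simp only [List.exists_mem_cons_iff]
        exact fun hSt => hSt.symm.imp_left (hTQ S hS)
      · simp only [branchMeasures, List.length_cons, List.map_cons, List.sum_cons]
        push_cast
        linarith

end SolvedBelow

section Pruned

variable {G : Digraph V} [DecidableRel G.Adj] {I : Inst V} {B m k : ℕ} {x y : V}
variable (hR : Reduced G I.vertSet I.undSet) (hx : x ∈ I.undSet) (hy : y ∈ outs G I.vertSet x)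

include hy in
theorem mem_outReachList_iff_candidate {s : V} :
    s ∈ outReachList G I y ↔ Candidate G I.vertSet I.undSet x y s :=
  mem_outReachList.trans ⟨fun h => ⟨hy, h.1, h.2⟩, fun h => ⟨h.mem, h.inReach⟩⟩

include hR hx hy

theorem length_outReachList_le_two (hnodup : I.und.Nodup)
    (hne : (undNbrs G I.undSet x).Nonempty) : (outReachList G I y).length ≤ 2 := by
  rw [← List.toFinset_card_of_nodup (l := outReachList G I y) (hnodup.filter _)]
  exact card_candidates_le_two hR hx hne hy fun s =>
    List.mem_toFinset.trans (mem_outReachList_iff_candidate hy)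

theorem base_pow_add_sum_branchMeasures_le (hnodup : I.und.Nodup)
    (hne : (undNbrs G I.undSet x).Nonempty) {L : List V}
    (hL : pruneList G I (outReachList G I y) (outReachList G I y) = L) :
    base ^ measureAfter G I.vertSet I.undSet x ∅ +
      ((branchMeasures G I.vertSet I.undSet [] L).map (base ^ ·)).sum ≤
        base ^ measure G I.vertSet I.undSet := by
  have hcand : ∀ s ∈ L, Candidate G I.vertSet I.undSet x y s := fun s hs =>
    (mem_outReachList_iff_candidate hy).1 ((hL ▸ pruneList_sublist (G := G)).mem hs)
  have hsub : L.Sublist (outReachList G I y) := hL ▸ pruneList_sublist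
  have hlen := length_outReachList_le_two hR hx hy hnodup hne
  match L, hL, hcand, hsub, hsub.length_le.trans hlen with
  | [], _, _, _, _ =>
    simpa [branchMeasures] using
      pow_le_pow_right₀ one_le_base (measureAfter_le (G := G) hR.subset hx)
  | [s], _, hcand, _, _ =>
    simpa [branchMeasures] using (hcand s (by simp)).base_pow_add_le hR hx
  | [s, t], hL, hcand, hsub, _ =>
    rw [← hsub.eq_of_length_le hlen] at hL
    have hmem : ∀ u, u ∈ [s, t] ↔ Candidate G I.vertSet I.undSet x y u := fun u => by
      rw [hsub.eq_of_length_le hlen, mem_outReachList_iff_candidate hy]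
    have hst : s ≠ t := by simpa using (hnodup.filter _).sublist hsub
    have hyL : y ∈ I.undSet → y = s ∨ y = t := fun hyU => by
      simpa using (hmem y).2 ⟨hy, hyU, .self (hR.subset hyU)⟩
    have := base_pow_add_le_of_survivor hR hx hne hyL (hcand s (by simp)) (hcand t (by simp)) hst
      (not_outs_subset_of_pruneList_eq hL (by simp) (by simp) (by simp) hst.symm)
      (not_outs_subset_of_pruneList_eq hL (by simp) (by simp) (by simp) hst)
    simpa [branchMeasures, add_assoc] using this

end Pruned

namespace SolvedBelow

variable {G : Digraph V} [DecidableRel G.Adj] {I : Inst V} {B m k : ℕ} {x y : V}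

theorem runsWithin_of_survivor (ih : SolvedBelow G B m) (h : I.Fits B) (hm : I.weight < m + 1)
    (hR : Reduced G I.vertSet I.undSet) (hx : x ∈ I.undSet) (hy : y ∈ outs G I.vertSet x)
    (hyx : ∀ u ∈ I.undSet, Arc G u y → u = x) (hne : (undNbrs G I.undSet x).Nonempty)
    (hk : AnswersOn G I (FirstSink G I.vertSet x []) k) :
    RunsWithin (do
      let L ← pruneP G I (outReachList G I y) (outReachList G I y)
      let res ← L.foldlM (fun (m : ℕ × List V) s => do
        tick
        let Is ← updateSinkP G I s m.2
        let d ← outDegP G I s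
        let a ← kfvd G Is
        return (min m.1 (a + d), s :: m.2)) (k, [])
      return res.1) (Answers G I)
      (timeBound B m (measure G I.vertSet I.undSet) -
        timeBound B m (measureAfter G I.vertSet I.undSet x ∅) + 7 * nodeCost B) := by
  set L := pruneList G I (outReachList G I y) (outReachList G I y) with hL
  have hsub : L.Sublist (outReachList G I y) := pruneList_sublist
  have hcand : ∀ s ∈ outReachList G I y, Candidate G I.vertSet I.undSet x y s := fun s =>
    (mem_outReachList_iff_candidate hy).1
  have hlen := hsub.length_le.trans (length_outReachList_le_two hR hx hy h.und_nodup hne)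
  have htime := sum_timeBound_le (B := B) (m := m) (l := _ :: branchMeasures _ _ _ _ _)
    (by simpa using base_pow_add_sum_branchMeasures_le hR hx hy h.und_nodup hne hL.symm)
  rw [List.map_cons, List.sum_cons] at htime
  refine .bind_computes (computes_pruneP_pow h (outReachList_lt h) (outReachList_lt h)) h.two_le ?_
  refine .bind (ih.runsWithin_prunedLoop h hm hk (by simp)
    (fun s hs => (hcand s (hsub.mem hs)).mem) (by simpa using hlen.trans h.two_le))
    fun r hr => .pure (hr.answers fun S hS => ?_) ?_
  · rw [firstSink_nil, or_iff_not_imp_left]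
    intro hxS
    obtain ⟨z, hz, hzS, hzy⟩ :=
      hS.exists_sink_of_surviving hR.not_isSink hxS (mem_outs.1 hy).1 hyx
    exact exists_mem_pruneList (fun s hs t _ hst ht =>
      hS.1.isSink_of_outs_subset_outs ht (hR.subset (hcand s hs).mem) hst)
      ⟨z, mem_outReachList.2 ⟨hz, hzy⟩, hzS⟩
  · have := mul_le_mul_of_nonneg_right (show (L.length : ℝ) ≤ 2 by exact_mod_cast hlen)
      (show 0 ≤ 3 * (nodeCost B : ℝ) by positivity)
    linarith

theorem runsWithin_of_survivor_of_independent (ih : SolvedBelow G B m) (h : I.Fits B)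
    (hm : I.weight < m + 1) (hR : Reduced G I.vertSet I.undSet) (hx : x ∈ I.undSet)
    (hy : y ∈ outs G I.vertSet x) (hyx : ∀ u ∈ I.undSet, Arc G u y → u = x)
    (hind : ∀ u ∈ I.undSet, ∀ w ∈ I.undSet, ¬ Arc G u w)
    (hk : AnswersOn G I (FirstSink G I.vertSet x []) k) :
    RunsWithin (match outReachList G I y with
      | [] => return k
      | s :: _ => do
        let Is ← updateSinkP G I s []
        let d ← outDegP G I s
        let a ← kfvd G Is
        tick
        return min k (a + d)) (Answers G I)
      (timeBound B m (measure G I.vertSet I.undSet) -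
        timeBound B m (measureAfter G I.vertSet I.undSet x ∅) + 3 * nodeCost B) := by
  have hB := h.two_le
  cases hL : outReachList G I y with
  | nil =>
    refine .pure (hk.answers fun S hS => ?_) ?_
    · by_contra hxS
      rw [firstSink_nil] at hxS
      obtain ⟨z, hz, _, hzy⟩ :=
        hS.exists_sink_of_surviving hR.not_isSink hxS (mem_outs.1 hy).1 hyx
      simpa [hL] using mem_outReachList.2 ⟨hz, hzy⟩
    · have := timeBound_mono (B := B) (m := m) (measureAfter_le (G := G) hR.subset hx)
      have : (0 : ℝ) ≤ nodeCost B := Nat.cast_nonneg _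
      linarith
  | cons s l =>
    have hs := (mem_outReachList_iff_candidate hy).1 (hL ▸ List.mem_cons_self (a := s))
    have htime := sum_timeBound_le (B := B) (m := m) (l := [_, _])
      (by simpa using hs.base_pow_add_le hR hx)
    simp only [List.map_cons, List.map_nil, List.sum_cons, List.sum_nil, add_zero] at htime
    refine .bind_computes (computes_updateSinkP_pow h s h.nil_lt) hB ?_
    refine .bind_computes (computes_outDegP_pow h s) hB ?_
    refine .bind (ih.runsWithin_afterSink h hm hs.mem []) fun a ha => .bind_tick hB (.pure ?_ ?_)
    · refine (hk.min ha).answers fun S hS => ?_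
      simp only [firstSink_nil, or_iff_not_imp_left]
      exact hS.isSink_of_independent hR hx hind hs hyx
    · rw [List.toFinset_nil]
      linarith

theorem runsWithin_of_surviving_cons (ih : SolvedBelow G B m) (h : I.Fits B)
    (hm : I.weight < m + 1) (hR : Reduced G I.vertSet I.undSet) (hx : x ∈ I.undSet)
    (hmax : ∀ v ∈ I.undSet, (undNbrs G I.undSet v).card ≤ (undNbrs G I.undSet x).card)
    (hy : y ∈ survivingList G I x) (hk : AnswersOn G I (FirstSink G I.vertSet x []) k) :
    RunsWithin (do
      let L₀ ← outReachP G I y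
      let n ← (do let l ← undNbrsP G I x; lengthP l)
      if 1 ≤ n then do
        let L ← pruneP G I L₀ L₀
        let res ← L.foldlM (fun (m : ℕ × List V) s => do
          tick
          let Is ← updateSinkP G I s m.2
          let d ← outDegP G I s
          let a ← kfvd G Is
          return (min m.1 (a + d), s :: m.2)) (k, [])
        return res.1
      else
        match L₀ with
        | [] => return k
        | s :: _ => do
          let Is ← updateSinkP G I s []
          let d ← outDegP G I s
          let a ← kfvd G Is
          tick
          return min k (a + d)) (Answers G I)
      (timeBound B m (measure G I.vertSet I.undSet) -
        timeBound B m (measureAfter G I.vertSet I.undSet x ∅) + 10 * nodeCost B) := by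
  have hB := h.two_le
  have : (0 : ℝ) ≤ nodeCost B := Nat.cast_nonneg _
  obtain ⟨hy, hyx⟩ := mem_survivingList.1 hy
  refine .bind_computes (computes_outReachP_pow h y) hB ?_
  refine .bind_computes (computes_undDegree_pow h x) hB ?_
  split_ifs with hn
  · exact (ih.runsWithin_of_survivor h hm hR hx hy hyx (Finset.card_pos.1 hn) hk).mono
      (fun _ => id) (by linarith)
  · refine (ih.runsWithin_of_survivor_of_independent h hm hR hx hy hyx (fun u hu w hw a => ?_)
      hk).mono (fun _ => id) (by linarith)
    have := Finset.card_pos.2 ⟨w, mem_undNbrs.2 ⟨hw, .inl a⟩⟩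
    have := hmax u hu
    omega

end SolvedBelow

section Search

variable {G : Digraph V} [DecidableRel G.Adj] {I : Inst V} {B m : ℕ}

theorem computes_findSource_pow (h : I.Fits B) :
    Computes (findP (fun v => do let l ← inP G I v; return l.isEmpty) I.verts)
      (I.verts.find? fun v => decide (∀ w ∈ I.vertSet, ¬ Arc G w v)) (B ^ 5) := by
  refine computes_findP_pow (k := 3) h.two_le h.verts_lt fun v _ => ?_
  have e : decide (∀ w ∈ I.vertSet, ¬ Arc G w v) =
      (I.verts.filter fun w => decide (Arc G w v)).isEmpty := by
    rw [Bool.eq_iff_iff]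
    simp [Inst.mem_vertSet]
  exact e ▸ (computes_inP_pow h v).bind_pure

theorem computes_findSink_pow (h : I.Fits B) :
    Computes (findP (fun v => do let l ← outP G I v; return l.isEmpty) I.verts)
      (I.verts.find? fun v => decide (∀ w ∈ I.vertSet, ¬ Arc G v w)) (B ^ 5) := by
  refine computes_findP_pow (k := 3) h.two_le h.verts_lt fun v _ => ?_
  have e : decide (∀ w ∈ I.vertSet, ¬ Arc G v w) = (outList G I v).isEmpty := by
    rw [Bool.eq_iff_iff]
    simp [Inst.mem_vertSet, outList]
  exact e ▸ (computes_outP_pow h v).bind_pure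

theorem computes_findDrop_pow (h : I.Fits B) :
    Computes (findP (fun v => do let k ← dropP G I v; tick; return decide (15 ≤ k)) I.und)
      (I.und.find? fun v => decide (15 ≤
        3 * (interacting G I.vertSet I.undSet v).card + (bigR G I.vertSet v).card)) (B ^ 21) := by
  refine computes_findP_pow h.two_le h.und_lt fun v hv => ?_
  refine .bind_pow 19 h.two_le (computes_dropP_pow h (Inst.mem_vertSet_of_mem_und hv)) (j := 0) ?_
    (by omega) (by omega)
  exact .bind_pure (f := fun _ => _) (.tick_pow 0 h.two_le)

omit [DecidableRel G.Adj] in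
theorem answers_card_of_undSet_eq_empty (hU : I.undSet = ∅)
    (hns : ∀ x ∈ I.vertSet, ¬ IsSink G I.vertSet x) : Answers G I I.vertSet.card := by
  refine ⟨⟨I.vertSet, ⟨subset_rfl, by simp [KnotFreeOn]⟩, le_rfl⟩, fun S hS _ => ?_⟩
  rw [hU] at hS
  rw [hS.eq_of_undecided_empty hns]

theorem exists_computes_argmaxFrom_undDegree (h : I.Fits B) {x₀ : V} {l : List V}
    (hund : I.und = x₀ :: l) : ∃ x ∈ I.undSet,
      (∀ v ∈ I.undSet, (undNbrs G I.undSet v).card ≤ (undNbrs G I.undSet x).card) ∧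
      Computes (argmaxFrom (fun v => do let l ← undNbrsP G I v; lengthP l) x₀
        (undNbrs G I.undSet x₀).card l) x (B ^ 6) := by
  obtain ⟨x, hx⟩ : ∃ x, x ∈ I.und.argmax fun v => (undNbrs G I.undSet v).card :=
    Option.ne_none_iff_exists'.1 (by simp [List.argmax_eq_none, hund])
  refine ⟨x, Inst.mem_undSet.2 (List.argmax_mem hx), fun v hv =>
    List.le_of_mem_argmax (f := fun v => (undNbrs G I.undSet v).card) (Inst.mem_undSet.1 hv) hx,
    computes_argmaxFrom_pow (g := fun v => (undNbrs G I.undSet v).card) h.two_le ?_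
      (fun v _ => computes_undDegree_pow h v) (hund ▸ hx)⟩
  simpa [hund] using (Nat.le_succ _).trans h.und_lt

end Search

namespace SolvedBelow

variable {G : Digraph V} [DecidableRel G.Adj] {I : Inst V} {B m : ℕ}

theorem runsWithin_of_reduced (ih : SolvedBelow G B m) (h : I.Fits B) (hm : I.weight < m + 1)
    (hsrc : ∀ v ∈ I.vertSet, ∃ w ∈ I.vertSet, Arc G w v) (hR : Reduced G I.vertSet I.undSet)
    (hU : I.undSet.Nonempty) :
    RunsWithin (kfvd G I) (Answers G I)
      (timeBound B m (measure G I.vertSet I.undSet) + 64 * nodeCost B) := by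
  have hB := h.two_le
  have : (0 : ℝ) ≤ nodeCost B := Nat.cast_nonneg _
  rw [kfvd]
  refine .bind_tick hB (.bind_computes (computes_vertsP_pow h) hB ?_)
  refine .bind_computes (computes_findSource_pow h) hB ?_
  rw [List.find?_eq_none.2 fun v hv => by simpa using hsrc v (Inst.mem_vertSet.2 hv)]
  refine .bind_computes (computes_findSink_pow h) hB ?_
  rw [List.find?_eq_none.2 fun v hv => by simpa using hR.exists_succ v (Inst.mem_vertSet.2 hv)]
  dsimp only
  have hdrop := computes_findDrop_pow (G := G) h
  rw [List.find?_eq_none.2 fun v hv => by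
    simpa using Nat.lt_succ_of_le (hR.drop_le v (Inst.mem_undSet.2 hv))] at hdrop
  obtain ⟨x₀, l, hund⟩ : ∃ x₀ l, I.und = x₀ :: l :=
    List.exists_cons_of_ne_nil fun e => by simp [Inst.undSet, e] at hU
  obtain ⟨x, hx, hmax, hpick⟩ := exists_computes_argmaxFrom_undDegree (G := G) h hund
  rw [hund] at hdrop ⊢
  refine .bind_computes hdrop hB ?_
  refine .bind_computes (computes_undDegree_pow h x₀) hB (.bind_computes hpick hB ?_)
  refine .bind_computes (computes_updateSinkP_pow h x h.nil_lt) hB ?_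
  refine .bind_computes (computes_outDegP_pow h x) hB ?_
  refine .bind (ih.runsWithin_afterSink h hm hx []) fun a ha => .bind_tick hB ?_
  refine .bind_computes (computes_survivingP_pow h x) hB ?_
  rw [List.toFinset_nil]
  cases hsurv : survivingList G I x with
  | nil =>
    exact (ih.runsWithin_of_surviving_eq_nil h hm hR hx hmax hsurv ha).mono (fun _ => id)
      (by linarith)
  | cons y l =>
    exact (ih.runsWithin_of_surviving_cons h hm hR hx hmax (hsurv ▸ List.mem_cons_self) ha).mono
      (fun _ => id) (by linarith)

theorem runsWithin_of_source_or_sink (ih : SolvedBelow G B m) (h : I.Fits B)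
    (hm : I.weight < m + 1) (hends : (∀ v ∈ I.vertSet, ∃ w ∈ I.vertSet, Arc G w v) →
      ∃ v ∈ I.vertSet, ∀ w ∈ I.vertSet, ¬ Arc G v w) :
    RunsWithin (kfvd G I) (Answers G I)
      (timeBound B m (measure G I.vertSet I.undSet) + 64 * nodeCost B) := by
  have hB := h.two_le
  have : (0 : ℝ) ≤ nodeCost B := Nat.cast_nonneg _
  rw [kfvd]
  refine .bind_tick hB (.bind_computes (computes_vertsP_pow h) hB ?_)
  refine .bind_computes (computes_findSource_pow h) hB ?_
  cases hsrc : I.verts.find? fun v => decide (∀ w ∈ I.vertSet, ¬ Arc G w v) with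
  | some x =>
    exact (ih.runsWithin_source h hm (Inst.mem_vertSet.2 (List.mem_of_find?_eq_some hsrc))
      (by simpa using List.find?_some hsrc)).mono (fun _ => id) (by linarith)
  | none =>
  refine .bind_computes (computes_findSink_pow h) hB ?_
  cases hsnk : I.verts.find? fun v => decide (∀ w ∈ I.vertSet, ¬ Arc G v w) with
  | some x =>
    exact (ih.runsWithin_sink h hm ⟨Inst.mem_vertSet.2 (List.mem_of_find?_eq_some hsnk),
      by simpa using List.find?_some hsnk⟩).mono (fun _ => id) (by linarith)
  | none =>
  obtain ⟨v, hv, hvs⟩ := hends fun v hv => by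
    simpa using List.find?_eq_none.1 hsrc v (Inst.mem_vertSet.1 hv)
  exact absurd (decide_eq_true hvs) (List.find?_eq_none.1 hsnk v (Inst.mem_vertSet.1 hv))

theorem runsWithin_of_drop_or_undSet_eq_empty (ih : SolvedBelow G B m) (h : I.Fits B)
    (hm : I.weight < m + 1) (hsrc : ∀ v ∈ I.vertSet, ∃ w ∈ I.vertSet, Arc G w v)
    (hsnk : ∀ v ∈ I.vertSet, ∃ w ∈ I.vertSet, Arc G v w)
    (hdrop : I.undSet.Nonempty → ∃ v ∈ I.undSet,
      15 ≤ 3 * (interacting G I.vertSet I.undSet v).card + (bigR G I.vertSet v).card) :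
    RunsWithin (kfvd G I) (Answers G I)
      (timeBound B m (measure G I.vertSet I.undSet) + 64 * nodeCost B) := by
  have hB := h.two_le
  have hcost : (0 : ℝ) ≤ nodeCost B := Nat.cast_nonneg _
  rw [kfvd]
  refine .bind_tick hB (.bind_computes (computes_vertsP_pow h) hB ?_)
  refine .bind_computes (computes_findSource_pow h) hB ?_
  rw [List.find?_eq_none.2 fun v hv => by simpa using hsrc v (Inst.mem_vertSet.2 hv)]
  refine .bind_computes (computes_findSink_pow h) hB ?_
  rw [List.find?_eq_none.2 fun v hv => by simpa using hsnk v (Inst.mem_vertSet.2 hv)]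
  have hfind := computes_findDrop_pow (G := G) h
  cases hund : I.und with
  | nil =>
    have hU : I.undSet = ∅ := by simp [Inst.undSet, hund]
    have hcard : I.vertSet.card = I.verts.length := List.toFinset_card_of_nodup h.nodup
    have hans := answers_card_of_undSet_eq_empty (G := G) hU fun x hx hs =>
      (hsnk x hx).elim fun w hw => hs.2 w hw.1 hw.2
    refine ⟨_, _, (computes_lengthP_pow h.verts_lt).pow_mono 24 hB (by omega), hcard ▸ hans, ?_⟩
    have := timeBound_nonneg (B := B) (m := m) (M := measure G I.vertSet I.undSet)
    rw [← nodeCost]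
    linarith
  | cons x₀ l =>
  rw [hund] at hfind
  refine .bind_computes hfind hB ?_
  rw [← hund]
  cases hfound : I.und.find? fun v => decide (15 ≤
      3 * (interacting G I.vertSet I.undSet v).card + (bigR G I.vertSet v).card) with
  | some x =>
    exact (ih.runsWithin_branch_of_drop h hm (Inst.mem_undSet.2 (List.mem_of_find?_eq_some hfound))
      (by simpa using List.find?_some hfound)).mono (fun _ => id) (by linarith)
  | none =>
  obtain ⟨v, hv, hvd⟩ := hdrop ⟨x₀, by simp [Inst.undSet, hund]⟩
  exact absurd (decide_eq_true hvd) (List.find?_eq_none.1 hfound v (Inst.mem_undSet.1 hv))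

theorem succ (ih : SolvedBelow G B m) : SolvedBelow G B (m + 1) := fun I h hm => by
  refine RunsWithin.mono ?_ (fun _ => id) timeBound_add_le_succ
  by_cases hends : (∀ v ∈ I.vertSet, ∃ w ∈ I.vertSet, Arc G w v) →
      ∃ v ∈ I.vertSet, ∀ w ∈ I.vertSet, ¬ Arc G v w
  · exact ih.runsWithin_of_source_or_sink h hm hends
  push Not at hends
  by_cases hdrop : I.undSet.Nonempty → ∃ v ∈ I.undSet,
      15 ≤ 3 * (interacting G I.vertSet I.undSet v).card + (bigR G I.vertSet v).card
  · exact ih.runsWithin_of_drop_or_undSet_eq_empty h hm hends.1 hends.2 hdrop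
  push Not at hdrop
  exact ih.runsWithin_of_reduced h hm hends.1
    ⟨Inst.undSet_subset, hends.2, fun v hv => Nat.le_of_lt_succ (hdrop.2 v hv)⟩ hdrop.1

end SolvedBelow

theorem solvedBelow {G : Digraph V} [DecidableRel G.Adj] {B : ℕ} (m : ℕ) : SolvedBelow G B m := by
  induction m with
  | zero => exact fun I _ h => absurd h (Nat.not_lt_zero _)
  | succ m ih => exact ih.succ

end Recursion

/-! ### Knots and sinks -/

section Knots

theorem exists_reach_terminal {X : Type} [Finite X] (H : Digraph X) (u : X) :
    ∃ v, H.Reach u v ∧ ∀ q, H.Reach v q → H.Reach q v := by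
  obtain ⟨v, hv, hmin⟩ := Set.exists_min_image {w | H.Reach u w}
    (fun w => {q | H.Reach w q}.ncard) (Set.toFinite _) ⟨u, .refl⟩
  refine ⟨v, hv, fun q hq => ?_⟩
  have heq : {r | H.Reach q r} = {r | H.Reach v r} :=
    Set.eq_of_subset_of_ncard_le (fun r hr => hq.trans hr) (hmin q (hv.trans hq)) (Set.toFinite _)
  exact (Set.ext_iff.1 heq v).2 .refl

theorem mem_of_reach {X : Type} {H : Digraph X} {K : Set X} {u v : X}
    (hK : ∀ p ∈ K, ∀ q, H.Adj p q → q ∈ K) (hu : u ∈ K) (h : H.Reach u v) : v ∈ K := by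
  unfold Digraph.Reach at h
  induction h with
  | refl => exact hu
  | tail _ a ih => exact hK _ ih _ a

theorem knotFree_iff_exists_sink {X : Type} [Finite X] {H : Digraph X} :
    H.KnotFree ↔ ∀ u, ∃ z, (∀ w, H.Adj z w → w = z) ∧ H.Reach u z := by
  constructor
  · intro h u
    obtain ⟨z, huz, hz⟩ := exists_reach_terminal H u
    refine ⟨z, fun w a => by_contra fun hwz => ?_, huz⟩
    have hzw : H.Reach z w := .single a
    refine h {q | H.Reach z q ∧ H.Reach q z}
      ⟨⟨z, rfl⟩, ⟨w, ⟨hzw, hz w hzw⟩, z, ⟨.refl, .refl⟩, hwz⟩, fun p hp q hpq => ?_⟩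
    have hzq : H.Reach z q := hp.1.tail hpq
    exact ⟨hzq, hz q hzq⟩
  · rintro h K ⟨⟨v, rfl⟩, hnt, hclosed⟩
    obtain ⟨z, hz, hvz⟩ := h v
    have hzv : H.Reach z v := (mem_of_reach hclosed ⟨.refl, .refl⟩ hvz).2
    obtain ⟨q, hq, hqz⟩ := hnt.exists_ne z
    exact hqz (mem_of_reach (K := {z}) (fun p hp r a => by
      obtain rfl := hp
      exact hz r a) rfl (hzv.trans hq.1))

variable {V : Type} [Fintype V] [DecidableEq V] {G : Digraph V} {S : Finset V}

theorem mem_univ_sdiff {v : V} : v ∈ Finset.univ \ S ↔ v ∉ S := by simp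

theorem reaches_univ_sdiff_iff {u v : {v : V // v ∉ S}} :
    Reaches G (Finset.univ \ S) u v ↔ (G.deleteVertices S).Reach u v := by
  constructor
  · obtain ⟨v, hv⟩ := v
    suffices ∀ p, Reaches G (Finset.univ \ S) p v →
        ∀ hp : p ∉ S, (G.deleteVertices S).Reach ⟨p, hp⟩ ⟨v, hv⟩ from fun h => this u h u.2
    intro p h
    induction h using Reaches.head_induction_on with
    | refl _ => exact fun _ => .refl
    | head p q _ a h ih =>
      intro hp
      have hq : q ∉ S := mem_univ_sdiff.1 h.mem_left
      have hadj : (G.deleteVertices S).Adj ⟨p, hp⟩ ⟨q, hq⟩ := a.2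
      exact .head hadj (ih hq)
  · intro h
    induction h using Relation.ReflTransGen.head_induction_on with
    | refl => exact .refl (mem_univ_sdiff.2 v.2)
    | @head a c hac _ ih =>
      by_cases e : (a : V) = c
      · rwa [e]
      · exact .head (mem_univ_sdiff.2 a.2) ⟨e, hac⟩ ih

theorem isSink_univ_sdiff_iff {z : {v : V // v ∉ S}} :
    IsSink G (Finset.univ \ S) z ↔ ∀ w, (G.deleteVertices S).Adj z w → w = z :=
  ⟨fun h w a => by_contra fun e =>
      h.2 w (mem_univ_sdiff.2 w.2) ⟨fun e' => e (Subtype.ext e'.symm), a⟩,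
    fun h => ⟨mem_univ_sdiff.2 z.2, fun w hw a =>
      a.ne (congrArg Subtype.val (h ⟨w, mem_univ_sdiff.1 hw⟩ a.2)).symm⟩⟩

theorem isKnotFreeDeletionSet_iff : G.IsKnotFreeDeletionSet S ↔ Sol G Finset.univ S := by
  rw [Digraph.IsKnotFreeDeletionSet, knotFree_iff_exists_sink, Sol,
    and_iff_right (Finset.subset_univ S), KnotFreeOn]
  simp only [← isSink_univ_sdiff_iff, ← reaches_univ_sdiff_iff]
  simp only [mem_univ_sdiff, Subtype.forall, Subtype.exists]
  exact forall₂_congr fun u _ => exists_congr fun z =>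
    ⟨fun ⟨_, h⟩ => h, fun h => ⟨mem_univ_sdiff.1 h.1.1, h⟩⟩

theorem isLeast_of_answers {I : Inst V} {k : ℕ} (hW : I.vertSet = Finset.univ)
    (hU : I.undSet = Finset.univ) (h : Answers G I k) :
    IsLeast {m | ∃ S, G.IsKnotFreeDeletionSet S ∧ S.card = m} k := by
  obtain ⟨⟨S, hS, hSk⟩, hmin⟩ := h
  rw [hW] at hS
  simp only [hW, hU] at hmin
  obtain ⟨S₀, hS₀, hS₀min⟩ := Set.exists_min_image {S | Sol G Finset.univ S} Finset.card
    (Set.toFinite _) ⟨S, hS⟩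
  have hk : ∀ S', Sol G Finset.univ S' → k ≤ S'.card := fun S' hS' =>
    (hmin S₀ ⟨⟨hS₀, hS₀min⟩, fun z _ => .inl (Finset.mem_univ z)⟩ trivial).trans (hS₀min S' hS')
  refine ⟨⟨S, isKnotFreeDeletionSet_iff.2 hS, hSk.antisymm (hk S hS)⟩, ?_⟩
  rintro _ ⟨S', hS', rfl⟩
  exact hk S' (isKnotFreeDeletionSet_iff.1 hS')

end Knots

section Start

variable {n : ℕ}

theorem vertSet_start : (⟨List.finRange n, []⟩ : Inst (Fin n)).vertSet = Finset.univ := by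
  ext v
  simp [Inst.mem_vertSet, Inst.verts]

theorem undSet_start : (⟨List.finRange n, []⟩ : Inst (Fin n)).undSet = Finset.univ := by
  ext v
  simp [Inst.mem_undSet]

theorem fits_start : (⟨List.finRange n, []⟩ : Inst (Fin n)).Fits (2 * n + 2) :=
  ⟨by simpa [Inst.verts] using List.nodup_finRange n, by simp [Inst.verts]⟩

theorem weight_start : (⟨List.finRange n, []⟩ : Inst (Fin n)).weight = 4 * n := by
  rw [Inst.weight, vertSet_start, undSet_start, Finset.card_univ, Fintype.card_fin]
  omega

theorem measure_univ_le (G : Digraph (Fin n)) :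
    measure G Finset.univ Finset.univ ≤ 4 * n := by
  have := measure_add_card_freeVerts (G := G) (subset_refl (Finset.univ : Finset (Fin n)))
  rw [Finset.card_univ, Fintype.card_fin] at this
  omega

theorem timeBound_start_le {M : ℕ} (hM : M ≤ 4 * n) : timeBound (2 * n + 2) (4 * n + 1) M ≤
    64 * 2 ^ 24 * 4 * ((n : ℝ) + 1) ^ 25 * (1.4549 : ℝ) ^ n := by
  have hbase : base ^ M ≤ (1.4549 : ℝ) ^ n :=
    calc base ^ M ≤ base ^ (4 * n) := pow_le_pow_right₀ one_le_base hM
      _ = (base ^ 4) ^ n := pow_mul _ _ _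
      _ ≤ 1.4549 ^ n := pow_le_pow_left₀ (pow_pos base_pos 4).le base_pow_four_le n
  calc timeBound (2 * n + 2) (4 * n + 1) M
      = 64 * (2 * (n : ℝ) + 2) ^ 24 * (4 * n + 1) * base ^ M := by
        simp only [timeBound, nodeCost]
        push_cast
        ring
    _ ≤ 64 * (2 * (n : ℝ) + 2) ^ 24 * (4 * (n + 1)) * 1.4549 ^ n := by
        have := pow_pos base_pos M
        gcongr
        linarith
    _ = 64 * 2 ^ 24 * 4 * ((n : ℝ) + 1) ^ 25 * 1.4549 ^ n := by
        rw [show 2 * (n : ℝ) + 2 = 2 * (n + 1) by ring, mul_pow]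
        ring

end Start

end KFVD

theorem mainTheorem1 :
    ∃ (C : ℝ) (k : ℕ), ∀ (n : ℕ) (G : Digraph (Fin n)) [DecidableRel G.Adj],
      ∃ opt time : ℕ,
        (KFVD.solve G).run 0 = some (opt, time) ∧
        IsLeast {m : ℕ | ∃ S : Finset (Fin n), G.IsKnotFreeDeletionSet S ∧ S.card = m} opt ∧
        (time : ℝ) ≤ C * ((n : ℝ) + 1) ^ k * (1.4549 : ℝ) ^ n := by
  refine ⟨64 * 2 ^ 24 * 4, 25, fun n G _ => ?_⟩
  obtain ⟨opt, c, hc, hopt, hbound⟩ := KFVD.solvedBelow (G := G) (4 * n + 1) _ KFVD.fits_start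
    (KFVD.weight_start.trans_lt (Nat.lt_succ_self _))
  obtain ⟨time, hrun, htime⟩ := hc 0
  refine ⟨opt, time, hrun,
    KFVD.isLeast_of_answers KFVD.vertSet_start KFVD.undSet_start hopt, ?_⟩
  rw [KFVD.vertSet_start, KFVD.undSet_start] at hbound
  calc (time : ℝ) ≤ c := by exact_mod_cast htime.trans_eq (Nat.zero_add c)
    _ ≤ KFVD.timeBound (2 * n + 2) (4 * n + 1) _ := hbound
    _ ≤ 64 * 2 ^ 24 * 4 * ((n : ℝ) + 1) ^ 25 * (1.4549 : ℝ) ^ n :=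
      KFVD.timeBound_start_le (KFVD.measure_univ_le G)
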